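/- **Setting.** Let $a<b$, $K,n_1,n_2,n_3,n_z,n_w\in\mathbb N$, delays $\tau_1,\dots,\tau_K>0$, and $U=L_2^{n_1}[a,b]\times H_1^{n_2}[a,b]\times H_2^{n_3}[a,b]$. For $u=(u_1,u_2,u_3)\in U$ put $\mathscr D_{\rm int}u=(u_1,u_2,u_3,\partial_xu_2,\partial_xu_3,\partial_x^2u_3)$, $\mathscr D_{\rm bc}u=(u_2,u_3,\partial_xu_3)$ and $\Lambda_{\rm bf}u=\big((\mathscr D_{\rm bc}u)(a),(\mathscr D_{\rm bc}u)(b)\big)$. Put $n_{\rm p}=n_1+n_2+n_3$. Let $E_{\rm p}\in L_2$, $E_{\rm b}$, $E_z$ be matrix-valued boundary parameters with $n_2+2n_3$ rows, and for $\zeta\in\mathbb R^{n_z}$ let $$X_\zeta=\Big\{u\in U:\ \int_a^bE_{\rm p}\,\mathscr D_{\rm int}u\,dx+E_{\rm b}\Lambda_{\rm bf}u+E_z\zeta=0\Big\}.$$ The boundary conditions are *well-posed*: when $\mathscr D_{\rm int}u$ and $\Lambda_{\rm bf}u$ are expressed through $c=(\mathscr D_{\rm bc}u)(a)$ and $v=\mathscr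 Du:=(u_1,\partial_xu_2,\partial_x^2u_3)$, the condition $u\in X_\zeta$ becomes $Mc+\int_a^bN(\theta)v(\theta)\,d\theta+E_z\zeta=0$, and the square matrix $M$ is invertible. Solving for $c$ defines a 3-PI operator $T$ and a multiplication operator $T_z$ with $u=Tv+T_z\zeta$ for $u\in X_\zeta$, $v=\mathscr Du$. **Delayed PDE.** Let $A_{\rm p},A_{{\rm p},j}\in L_\infty$, $A_{\rm b},A_{{\rm b},j},B_z,B_{z,j},C_{w{\rm p}},C_{w{\rm p},j}\in L_2$ be matrix-valued functions on $[a,b]$ and $C_{w{\rm b}},C_{w{\rm b},j},D_{wz},D_{wz,j}$ matrices. For an input $z:[0,\infty)\to\mathbb R^{n_z}$ consider the 1D PDE $$u_t=[A_{\rm p}\ A_{\rm b}\ B_z]\,q+\sum_{j=1}^K[A_{{\rm p},j}\ A_{{\rm b},j}\ B_{z,j}]\,r_j,\quad w=\big[\textstyle\int_a^b[C_{w{\rm p}}]\ C_{w{\rm b}}\ D_{wz}\big]q+\sum_{j=1}^K\big[\int_a^b[C_{w{\rm p},j}]\ C_{w{\rm b},j}\ D_{wz,j}\big]r_j,$$ $$q=(\mathscr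 D_{\rm int}u,\Lambda_{\rm bf}u,z),\qquad u(t)\in X_{z(t)},$$ coupled to the transport equations, for $j=1,\dots,K$ and $\phi_j=(\phi_{u,j},\phi_{z,j})$, $$\partial_t\phi_j=-\tfrac1{\tau_j}\partial_s\phi_j\ (s\in[0,1]),\quad r_j(t)=\big(\mathscr D_{\rm int}\phi_{u,j},\Lambda_{\rm bf}\phi_{u,j},\phi_{z,j}\big)(t,1),\quad \phi_j(t)\in Y_{q(t)}.$$ Here $Y_q$, for $q=(\mathscr D_{\rm int}u,\Lambda_{\rm bf}u,\zeta)$, is the set of $(\phi_u,\phi_z)\in H_1([0,1];U)\times H_1([0,1];\mathbb R^{n_z})$ with $(\phi_u,\phi_z)(0)=(u,\zeta)=:T_qq$ and $\phi_u(s)\in X_{\phi_z(s)}$ for all $s\in[0,1]$. A *solution* $((u,\phi),w)$ with initial state $(u_0,\phi_0)$, $u_0\in X_{z(0)}$, $\phi_{0,j}\in Y_{q_0}$, $q_0=(\mathscr D_{\rm int}u_0,\Lambda_{\rm bf}u_0,z(0))$, is such that $t\mapsto(u(t),\phi(t))$ is differentiable on $[0,\infty)$ in the Sobolev norms of these spaces,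 $(u(0),\phi(0))=(u_0,\phi_0)$, and for some signals $q,r$ all equations hold for every $t\ge0$. **PIEs.** A solution $(\mathbf x,w)$ of the PIE $\mathcal T\mathbf x_t+\mathcal T_zz_t=\mathcal A\mathbf x+\mathcal B_zz$, $w=\mathcal C_w\mathbf x+\mathcal D_{wz}z$ with initial state $\mathbf x_0$ is such that $\mathbf x$ and $z$ are differentiable on $[0,\infty)$ (in the norm of the product of $L_2$ spaces for $\mathbf x$), $\mathbf x(0)=\mathbf x_0$, and both equations hold for every $t\ge0$. Put $\hat Tv=(\mathscr D_{\rm int}Tv,\Lambda_{\rm bf}Tv,0)$ and $\hat T_z\zeta=(\mathscr D_{\rm int}T_z\zeta,\Lambda_{\rm bf}T_z\zeta,\zeta)$. * The PIE of the 1D PDE, $\mathbf G_1$, has state $v\in L_2^{n_{\rm p}}[a,b]$, inputs $z,r$ and outputs $w,q$: $$Tv_t+T_zz_t=[A_{\rm p}\ A_{\rm b}\ B_z](\hat Tv+\hat T_zz)+\sum_j[A_{{\rm p},j}\ A_{{\rm b},j}\ B_{z,j}]r_j,$$ $$w=\big[\textstyle\int_a^b[C_{w{\rm p}}]\ C_{w{\rm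 b}}\ D_{wz}\big](\hat Tv+\hat T_zz)+\sum_j\big[\int_a^b[C_{w{\rm p},j}]\ C_{w{\rm b},j}\ D_{wz,j}\big]r_j,\qquad q=\hat Tv+\hat T_zz.$$ * The PIE of the transport equations, $\mathbf G_2$, has state $\psi=(\psi_{u,j},\psi_{z,j})_j\in L_2^{Kn_{\rm p}}([0,1]\times[a,b])\times L_2^{Kn_z}[0,1]$, input $q$ and output $r$: $$\bar T\psi_t+(T_qq_t)_j=\bar A\psi,\qquad r_j=\int_0^1(\hat T\psi_{u,j}+\hat T_z\psi_{z,j})(s)\,ds+q,$$ $$(\bar T\psi)_j(s)=\int_0^s(T\psi_{u,j}+T_z\psi_{z,j},\,\psi_{z,j})(\theta)\,d\theta,\qquad(\bar A\psi)_j=-\tfrac1{\tau_j}(T\psi_{u,j}+T_z\psi_{z,j},\,\psi_{z,j}).$$ Let $\{\mathcal T,\mathcal T_z,\mathcal A,\mathcal B_z,\mathcal C_w,\mathcal D_{wz}\}$ be the operators of their feedback interconnection (output $q$ of $\mathbf G_1$ fed to $\mathbf G_2$, output $r$ of $\mathbf G_2$ fed to $\mathbf G_1$), with state $(v,\psi)$,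 input $z$ and output $w$. **Claim.** These six operators are 2D PI operators. Let $z:[0,\infty)\to\mathbb R^{n_z}$ be differentiable. If $$(u,\phi)(t)=\mathcal T(v,\psi)(t)+\mathcal T_zz(t)\ \ (t\ge0),\qquad(u_0,\phi_0)=\mathcal T(v_0,\psi_0)+\mathcal T_zz(0),\tag{$*$}$$ then $((v,\psi),w)$ is a solution of the interconnected PIE with input $z$ and initial state $(v_0,\psi_0)$ if and only if $((u,\phi),w)$ is a solution of the delayed PDE with input $z$ and initial state $(u_0,\phi_0)$. Moreover, $(*)$ is a bijection between solutions: each solution of the PIE is related by $(*)$ to exactly one solution of the delayed PDE, and each solution of the delayed PDE to exactly one solution of the PIE. -/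

import Mathlib

open MeasureTheory Set
open scoped Matrix ContDiff ENNReal

noncomputable section

namespace DelayPIE

/-! ## Square-integrable functions, weak derivatives and Sobolev spaces on an interval -/

/-- `L₂([a,b]; E)`. -/
abbrev L2 (a b : ℝ) (E : Type) [NormedAddCommGroup E] : Type :=
  Lp E 2 (volume.restrict (Icc a b))

/-- The class in `L₂([a,b]; E)` of a square-integrable function (zero for any other function). -/
def toL2 (a b : ℝ) {E : Type} [NormedAddCommGroup E] (f : ℝ → E) : L2 a b E :=
  open Classical in
  if h : MemLp f 2 (volume.restrict (Icc a b)) then h.toLp f else 0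

/-- `u'` is the weak derivative of `u` on `(a,b)`. -/
def IsWeakDeriv {a b : ℝ} {E : Type} [NormedAddCommGroup E] [NormedSpace ℝ E]
    (u u' : L2 a b E) : Prop :=
  ∀ η : ℝ → ℝ, ContDiff ℝ ∞ η → HasCompactSupport η → tsupport η ⊆ Ioo a b →
    ∫ x in Icc a b, deriv η x • u x = - ∫ x in Icc a b, η x • u' x

section weak

variable {a b : ℝ} {E : Type} [NormedAddCommGroup E] [NormedSpace ℝ E]

theorem integrable_test_smul {η : ℝ → ℝ} (hη : Continuous η) (hc : HasCompactSupport η)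
    (u : L2 a b E) : Integrable (fun x => η x • u x) (volume.restrict (Icc a b)) := by
  obtain ⟨C, hC⟩ := hc.exists_bound_of_continuous hη
  have hu : Integrable u (volume.restrict (Icc a b)) := (Lp.memLp u).integrable (by norm_num)
  exact hu.bdd_smul C hη.aestronglyMeasurable (Filter.Eventually.of_forall hC)

theorem isWeakDeriv_zero : IsWeakDeriv (0 : L2 a b E) 0 := by
  intro η _ _ _
  have h : ∀ g : ℝ → ℝ, ∫ x in Icc a b, g x • (0 : L2 a b E) x = 0 := by
    intro g
    rw [← integral_zero ℝ E (μ := volume.restrict (Icc a b))]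
    refine integral_congr_ae ?_
    filter_upwards [Lp.coeFn_zero E 2 (volume.restrict (Icc a b))] with x hx
    rw [hx]; simp
  rw [h, h, neg_zero]

theorem IsWeakDeriv.add {u u' v v' : L2 a b E} (hu : IsWeakDeriv u u') (hv : IsWeakDeriv v v') :
    IsWeakDeriv (u + v) (u' + v') := by
  intro η h1 h2 h3
  have key : ∀ g : ℝ → ℝ, Continuous g → HasCompactSupport g → ∀ p q : L2 a b E,
      ∫ x in Icc a b, g x • (p + q) x =
        (∫ x in Icc a b, g x • p x) + ∫ x in Icc a b, g x • q x := by
    intro g hg hgc p q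
    rw [← integral_add (integrable_test_smul hg hgc p) (integrable_test_smul hg hgc q)]
    refine integral_congr_ae ?_
    filter_upwards [Lp.coeFn_add p q] with x hx
    rw [hx, Pi.add_apply, smul_add]
  rw [key _ (h1.continuous_deriv (by simp)) h2.deriv, key _ h1.continuous h2,
    hu η h1 h2 h3, hv η h1 h2 h3, neg_add]

theorem IsWeakDeriv.smul (c : ℝ) {u u' : L2 a b E} (hu : IsWeakDeriv u u') :
    IsWeakDeriv (c • u) (c • u') := by
  intro η h1 h2 h3
  have key : ∀ g : ℝ → ℝ, ∀ p : L2 a b E,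
      ∫ x in Icc a b, g x • (c • p) x = c • ∫ x in Icc a b, g x • p x := by
    intro g p
    rw [← integral_smul]
    refine integral_congr_ae ?_
    filter_upwards [Lp.coeFn_smul c p] with x hx
    rw [hx, Pi.smul_apply, smul_comm]
  rw [key, key, hu η h1 h2 h3, smul_neg]

end weak

/-- `H₁([a,b]; E)`: pairs `(u, ∂u)` of square-integrable functions, normed as a subspace of
`L₂ × L₂` (that is, with a norm equivalent to the usual Sobolev norm). -/
def H1 (a b : ℝ) (E : Type) [NormedAddCommGroup E] [NormedSpace ℝ E] :
    Submodule ℝ (L2 a b E × L2 a b E) where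
  carrier := {p | IsWeakDeriv p.1 p.2}
  add_mem' hp hq := hp.add hq
  zero_mem' := isWeakDeriv_zero
  smul_mem' c _ hp := hp.smul c

/-- `H₂([a,b]; E)`: triples `(u, ∂u, ∂²u)`, normed as a subspace of `L₂ × L₂ × L₂`. -/
def H2 (a b : ℝ) (E : Type) [NormedAddCommGroup E] [NormedSpace ℝ E] :
    Submodule ℝ (L2 a b E × L2 a b E × L2 a b E) where
  carrier := {p | IsWeakDeriv p.1 p.2.1 ∧ IsWeakDeriv p.2.1 p.2.2}
  add_mem' hp hq := ⟨hp.1.add hq.1, hp.2.add hq.2⟩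
  zero_mem' := ⟨isWeakDeriv_zero, isWeakDeriv_zero⟩
  smul_mem' c _ hp := ⟨hp.1.smul c, hp.2.smul c⟩

/-- The value at `x ∈ [a,b]` of the continuous representative of `f` (which is unique for `a < b`,
and exists whenever `f` has a weak derivative in `L₂`): the Dirac operator `Δ^x`. -/
def traceAt {a b : ℝ} {E : Type} [NormedAddCommGroup E] (f : L2 a b E) (x : ℝ) : E :=
  open Classical in
  if h : ∃ g : ℝ → E, ContinuousOn g (Icc a b) ∧ f =ᵐ[volume.restrict (Icc a b)] g
  then h.choose x else 0

/-! ## Partial integral operators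

Scalar components are kept apart: `L₂ⁿ[a,b]` is `n → L2 a b ℝ`. A function on the rectangle
`[c,d] × [a,b]` is read as a square-integrable function of `s ∈ [c,d]` with values in functions of
`x ∈ [a,b]`, so that `L₂^{n₀}[c,d] × L₂^{n₁}([c,d] × [a,b])` is `L₂([c,d]; ℝ^{n₀} × L₂^{n₁}[a,b])`. -/

/-- `Z₁ = ℝ^{n₀} × L₂^{n₁}[a,b]`. -/
abbrev Z1 (a b : ℝ) (n₀ n₁ : Type) [Fintype n₀] [Fintype n₁] : Type :=
  (n₀ → ℝ) × (n₁ → L2 a b ℝ)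

/-- `Z₂ = L₂^{n₀}[c,d] × L₂^{n₁}([c,d] × [a,b])`. -/
abbrev Z2 (a b c d : ℝ) (n₀ n₁ : Type) [Fintype n₀] [Fintype n₁] : Type :=
  L2 c d (Z1 a b n₀ n₁)

/-- `Z₁₂ = ℝ^{n₀} × L₂^{n₁}[a,b] × L₂^{p₀}[c,d] × L₂^{p₁}([c,d] × [a,b])`. -/
abbrev Z12 (a b c d : ℝ) (n₀ n₁ p₀ p₁ : Type) [Fintype n₀] [Fintype n₁] [Fintype p₀]
    [Fintype p₁] : Type :=
  Z1 a b n₀ n₁ × Z2 a b c d p₀ p₁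

/-- Parameters of a 3-PI operator. -/
structure N3 (m n : Type) where
  R₀ : ℝ → Matrix m n ℝ
  R₁ : ℝ → ℝ → Matrix m n ℝ
  R₂ : ℝ → ℝ → Matrix m n ℝ

/-- `R₀ ∈ L_∞[a,b]` and `R₁, R₂ ∈ L₂([a,b] × [a,b])`. -/
def N3.Admissible {m n : Type} (R : N3 m n) (a b : ℝ) : Prop :=
  ∀ i j, MemLp (fun x => R.R₀ x i j) ∞ (volume.restrict (Icc a b)) ∧
    MemLp (fun y : ℝ × ℝ => R.R₁ y.1 y.2 i j) 2
      ((volume.restrict (Icc a b)).prod (volume.restrict (Icc a b))) ∧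
    MemLp (fun y : ℝ × ℝ => R.R₂ y.1 y.2 i j) 2
      ((volume.restrict (Icc a b)).prod (volume.restrict (Icc a b)))

/-- The 3-PI operator
`(P[R]u)(x) = R₀(x)u(x) + ∫_a^x R₁(x,θ)u(θ)dθ + ∫_x^b R₂(x,θ)u(θ)dθ`. -/
def N3.op {m n : Type} [Fintype n] (R : N3 m n) (a b : ℝ) (u : n → L2 a b ℝ) :
    m → L2 a b ℝ := fun i => toL2 a b fun x =>
  ∑ j, (R.R₀ x i j * u j x + (∫ θ in a..x, R.R₁ x θ i j * u j θ) +
    ∫ θ in x..b, R.R₂ x θ i j * u j θ)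

/-- Parameters of a 4-PI operator from `ℝ^{n₀} × L₂^{n₁}` to `ℝ^{m₀} × L₂^{m₁}`. -/
structure N4 (m₀ m₁ n₀ n₁ : Type) where
  B₀₀ : Matrix m₀ n₀ ℝ
  B₀₁ : ℝ → Matrix m₀ n₁ ℝ
  B₁₀ : ℝ → Matrix m₁ n₀ ℝ
  B₁₁ : N3 m₁ n₁

def N4.Admissible {m₀ m₁ n₀ n₁ : Type} (B : N4 m₀ m₁ n₀ n₁) (a b : ℝ) : Prop :=
  (∀ i j, MemLp (fun x => B.B₀₁ x i j) 2 (volume.restrict (Icc a b))) ∧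
  (∀ i j, MemLp (fun x => B.B₁₀ x i j) 2 (volume.restrict (Icc a b))) ∧
  B.B₁₁.Admissible a b

/-- The 4-PI operator `P[B]`. -/
def N4.op {m₀ m₁ n₀ n₁ : Type} [Fintype m₀] [Fintype m₁] [Fintype n₀] [Fintype n₁]
    (B : N4 m₀ m₁ n₀ n₁) (a b : ℝ) (u : Z1 a b n₀ n₁) : Z1 a b m₀ m₁ :=
  (fun i => (B.B₀₀ *ᵥ u.1) i + ∑ j, ∫ x in a..b, B.B₀₁ x i j * u.2 j x,
   fun i => toL2 a b (fun x => (B.B₁₀ x *ᵥ u.1) i) + B.B₁₁.op a b u.2 i)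

/-- Parameters of a 2D PI operator from `Z₁^{(n₀,n₁)} × Z₂^{(p₀,p₁)}` to
`Z₁^{(m₀,m₁)} × Z₂^{(r₀,r₁)}`. -/
structure N12 (m₀ m₁ r₀ r₁ n₀ n₁ p₀ p₁ : Type) where
  B₁₁ : N4 m₀ m₁ n₀ n₁
  B₁₂ : N4 m₀ m₁ p₀ p₁
  B₂₁ : N4 r₀ r₁ n₀ n₁
  N₀ : N4 r₀ r₁ p₀ p₁
  N₁ : N4 r₀ r₁ p₀ p₁
  N₂ : N4 r₀ r₁ p₀ p₁

def N12.Admissible {m₀ m₁ r₀ r₁ n₀ n₁ p₀ p₁ : Type} (B : N12 m₀ m₁ r₀ r₁ n₀ n₁ p₀ p₁)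
    (a b : ℝ) : Prop :=
  B.B₁₁.Admissible a b ∧ B.B₁₂.Admissible a b ∧ B.B₂₁.Admissible a b ∧
  B.N₀.Admissible a b ∧ B.N₁.Admissible a b ∧ B.N₂.Admissible a b

/-- The 2D PI operator `P[B]`; 4-PI operators act as multipliers along `s ∈ [c,d]`. -/
def N12.op {m₀ m₁ r₀ r₁ n₀ n₁ p₀ p₁ : Type} [Fintype m₀] [Fintype m₁] [Fintype r₀] [Fintype r₁]
    [Fintype n₀] [Fintype n₁] [Fintype p₀] [Fintype p₁]
    (B : N12 m₀ m₁ r₀ r₁ n₀ n₁ p₀ p₁) (a b c d : ℝ) (u : Z12 a b c d n₀ n₁ p₀ p₁) :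
    Z12 a b c d m₀ m₁ r₀ r₁ :=
  (B.B₁₁.op a b u.1 + ∫ s in c..d, B.B₁₂.op a b (u.2 s),
   toL2 c d fun s => B.B₂₁.op a b u.1 + B.N₀.op a b (u.2 s) +
     (∫ ν in c..s, B.N₁.op a b (u.2 ν)) + ∫ ν in s..d, B.N₂.op a b (u.2 ν))

/-- `F : X → Y` is a PI operator, where `X` and `Y` are identified with spaces `Z₁₂` through
`e` and `f`. -/
def IsPI {a b c d : ℝ} {m₀ m₁ r₀ r₁ n₀ n₁ p₀ p₁ X Y : Type}
    [Fintype m₀] [Fintype m₁] [Fintype r₀] [Fintype r₁]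
    [Fintype n₀] [Fintype n₁] [Fintype p₀] [Fintype p₁]
    (e : X → Z12 a b c d n₀ n₁ p₀ p₁) (f : Y → Z12 a b c d m₀ m₁ r₀ r₁) (F : X → Y) : Prop :=
  ∃ B : N12 m₀ m₁ r₀ r₁ n₀ n₁ p₀ p₁, B.Admissible a b ∧ ∀ x, f (F x) = B.op a b c d (e x)

/-- `ℝⁿ` as a space `Z₁₂`, the other components being zero-dimensional. -/
def realSig (a b c d : ℝ) {n : Type} [Fintype n] (z : n → ℝ) :
    Z12 a b c d n (Fin 0) (Fin 0) (Fin 0) :=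
  ((z, 0), 0)

/-- `L₂^{n₁}[a,b] × Z₂` as a space `Z₁₂`, the component `ℝ^{n₀}` being zero-dimensional. -/
def stateSig {a b c d : ℝ} {n₁ p₀ p₁ : Type} [Fintype n₁] [Fintype p₀] [Fintype p₁]
    (y : (n₁ → L2 a b ℝ) × Z2 a b c d p₀ p₁) : Z12 a b c d (Fin 0) n₁ p₀ p₁ :=
  ((0, y.1), y.2)

/-! ## Partial integral equations and their interconnection -/

/-- The operators of a system `T v_t + T_w w_t = A v + B w`, `z = C v + D w` with state in `X`,
input in `W` and output in `Z`. -/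
structure PIE (X W Z : Type) where
  T : X → X
  Tw : W → X
  A : X → X
  B : W → X
  C : X → Z
  D : W → Z

/-- `(v, z)` is a solution for the input `w` and the initial state `v₀`. Signals are functions of
`t ≥ 0`; their values at `t < 0` play no role. -/
def PIE.IsSolution {X W Z : Type} [NormedAddCommGroup X] [NormedSpace ℝ X]
    [NormedAddCommGroup W] [NormedSpace ℝ W] [NormedAddCommGroup Z]
    (G : PIE X W Z) (w : ℝ → W) (v : ℝ → X) (z : ℝ → Z) (v₀ : X) : Prop :=
  v 0 = v₀ ∧ ∀ t, 0 ≤ t → ∃ v' w',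
    HasDerivWithinAt v v' (Ici 0) t ∧ HasDerivWithinAt w w' (Ici 0) t ∧
    G.Tw w' + G.T v' = G.A (v t) + G.B (w t) ∧
    z t = G.C (v t) + G.D (w t)

/-- The operators of a system with a second input `r` and a second output `q`:
`T v_t + T_w w_t + T_r r_t = A v + B_w w + B_r r`, `z = C_z v + D_zw w + D_zr r`,
`q = C_q v + D_qw w` (there is no feedthrough from `r` to `q`). -/
structure PIEqr (X W R Z Q : Type) where
  T : X → X
  Tw : W → X
  Tr : R → X
  A : X → X
  Bw : W → X
  Br : R → X
  Cz : X → Z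
  Dzw : W → Z
  Dzr : R → Z
  Cq : X → Q
  Dqw : W → Q

/-- The feedback interconnection `L_{pie×pie}(G₁, G₂)`: the output `q` of `G₁` is the input of `G₂`
and the output `r` of `G₂` is the input `r` of `G₁`. -/
def interconnect {X₁ X₂ W R Z Q : Type} [Add X₁] [Add X₂] [Add Z]
    (G₁ : PIEqr X₁ W R Z Q) (G₂ : PIE X₂ Q R) : PIE (X₁ × X₂) W Z where
  T y := (G₁.T y.1 + G₁.Tr (G₂.D (G₁.Cq y.1)) + G₁.Tr (G₂.C y.2),
    G₂.Tw (G₁.Cq y.1) + G₂.T y.2)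
  Tw w := (G₁.Tw w + G₁.Tr (G₂.D (G₁.Dqw w)), G₂.Tw (G₁.Dqw w))
  A y := (G₁.A y.1 + G₁.Br (G₂.D (G₁.Cq y.1)) + G₁.Br (G₂.C y.2),
    G₂.B (G₁.Cq y.1) + G₂.A y.2)
  B w := (G₁.Bw w + G₁.Br (G₂.D (G₁.Dqw w)), G₂.B (G₁.Dqw w))
  C y := G₁.Cz y.1 + G₁.Dzr (G₂.D (G₁.Cq y.1)) + G₁.Dzr (G₂.C y.2)
  D w := G₁.Dzw w + G₁.Dzr (G₂.D (G₁.Dqw w))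

/-! ## The delayed PDE -/

/-- Components of the state `(u₁, u₂, u₃)`. -/
abbrev StateIdx (n₁ n₂ n₃ : ℕ) : Type := Fin n₁ ⊕ Fin n₂ ⊕ Fin n₃

/-- Components of `D_bc u = (u₂, u₃, ∂u₃)`. -/
abbrev CoreIdx (n₂ n₃ : ℕ) : Type := Fin n₂ ⊕ Fin n₃ ⊕ Fin n₃

/-- Components of `Λ_bf u = (Δ^a D_bc u, Δ^b D_bc u)`. -/
abbrev BfIdx (n₂ n₃ : ℕ) : Type := CoreIdx n₂ n₃ ⊕ CoreIdx n₂ n₃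

/-- Components of `D_int u = (u₁, u₂, u₃, ∂u₂, ∂u₃, ∂²u₃)`. -/
abbrev IntIdx (n₁ n₂ n₃ : ℕ) : Type :=
  Fin n₁ ⊕ Fin n₂ ⊕ Fin n₃ ⊕ Fin n₂ ⊕ Fin n₃ ⊕ Fin n₃

/-- Position of the state components in `D_int u`. -/
def stateToInt {n₁ n₂ n₃ : ℕ} : StateIdx n₁ n₂ n₃ → IntIdx n₁ n₂ n₃
  | .inl i => .inl i
  | .inr (.inl i) => .inr (.inl i)
  | .inr (.inr i) => .inr (.inr (.inl i))

/-- Position of the components of `D_bc u` in `D_int u`. -/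
def coreToInt {n₁ n₂ n₃ : ℕ} : CoreIdx n₂ n₃ → IntIdx n₁ n₂ n₃
  | .inl i => .inr (.inl i)
  | .inr (.inl i) => .inr (.inr (.inl i))
  | .inr (.inr i) => .inr (.inr (.inr (.inr (.inl i))))

/-- `U = L₂^{n₁}[a,b] × H₁^{n₂}[a,b] × H₂^{n₃}[a,b]`. -/
def U (a b : ℝ) (n₁ n₂ n₃ : ℕ) : Type :=
  (Fin n₁ → L2 a b ℝ) × (Fin n₂ → H1 a b ℝ) × (Fin n₃ → H2 a b ℝ)

instance (a b : ℝ) (n₁ n₂ n₃ : ℕ) : NormedAddCommGroup (U a b n₁ n₂ n₃) :=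
  inferInstanceAs (NormedAddCommGroup
    ((Fin n₁ → L2 a b ℝ) × (Fin n₂ → H1 a b ℝ) × (Fin n₃ → H2 a b ℝ)))

instance (a b : ℝ) (n₁ n₂ n₃ : ℕ) : NormedSpace ℝ (U a b n₁ n₂ n₃) :=
  inferInstanceAs (NormedSpace ℝ
    ((Fin n₁ → L2 a b ℝ) × (Fin n₂ → H1 a b ℝ) × (Fin n₃ → H2 a b ℝ)))

/-- Values of `(D_int u, Λ_bf u, z)`, and of the interconnection signals. -/
abbrev Q (a b : ℝ) (n₁ n₂ n₃ nz : ℕ) : Type :=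
  (IntIdx n₁ n₂ n₃ → L2 a b ℝ) × (BfIdx n₂ n₃ → ℝ) × (Fin nz → ℝ)

section operators

variable {a b : ℝ} {n₁ n₂ n₃ : ℕ}

/-- The underlying `L₂` function of `u ∈ U`. -/
def U.toFun (u : U a b n₁ n₂ n₃) : StateIdx n₁ n₂ n₃ → L2 a b ℝ :=
  Sum.elim u.1 (Sum.elim (fun i => (u.2.1 i).1.1) (fun i => (u.2.2 i).1.1))

/-- The element of `U` with underlying `L₂` function `y`, for `y` in the image of `U`. -/
def U.lift (y : StateIdx n₁ n₂ n₃ → L2 a b ℝ) : U a b n₁ n₂ n₃ :=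
  open Classical in
  if h : ∃ u : U a b n₁ n₂ n₃, U.toFun u = y then h.choose else 0

/-- The differential operator `D_int`. -/
def Dint (u : U a b n₁ n₂ n₃) : IntIdx n₁ n₂ n₃ → L2 a b ℝ :=
  Sum.elim u.1 <| Sum.elim (fun i => (u.2.1 i).1.1) <| Sum.elim (fun i => (u.2.2 i).1.1) <|
    Sum.elim (fun i => (u.2.1 i).1.2) <|
    Sum.elim (fun i => (u.2.2 i).1.2.1) (fun i => (u.2.2 i).1.2.2)

/-- `Δ^x D_bc`. -/
def Dbc (u : U a b n₁ n₂ n₃) (x : ℝ) : CoreIdx n₂ n₃ → ℝ :=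
  Sum.elim (fun i => traceAt (u.2.1 i).1.1 x) <|
    Sum.elim (fun i => traceAt (u.2.2 i).1.1 x) (fun i => traceAt (u.2.2 i).1.2.1 x)

/-- The boundary operator `Λ_bf`. -/
def Lbf (u : U a b n₁ n₂ n₃) : BfIdx n₂ n₃ → ℝ :=
  Sum.elim (Dbc u a) (Dbc u b)

end operators

/-- The parameters `[A_p A_b B_z; ∫[C_wp] C_wb D_wz]`. -/
structure Coeffs (a b : ℝ) (n₁ n₂ n₃ nz nw : ℕ) where
  Ap : ℝ → Matrix (StateIdx n₁ n₂ n₃) (IntIdx n₁ n₂ n₃) ℝ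
  Ab : ℝ → Matrix (StateIdx n₁ n₂ n₃) (BfIdx n₂ n₃) ℝ
  Bz : ℝ → Matrix (StateIdx n₁ n₂ n₃) (Fin nz) ℝ
  Cwp : ℝ → Matrix (Fin nw) (IntIdx n₁ n₂ n₃) ℝ
  Cwb : Matrix (Fin nw) (BfIdx n₂ n₃) ℝ
  Dwz : Matrix (Fin nw) (Fin nz) ℝ
  memLp_Ap : ∀ i j, MemLp (fun x => Ap x i j) ∞ (volume.restrict (Icc a b))
  memLp_Ab : ∀ i j, MemLp (fun x => Ab x i j) 2 (volume.restrict (Icc a b))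
  memLp_Bz : ∀ i j, MemLp (fun x => Bz x i j) 2 (volume.restrict (Icc a b))
  memLp_Cwp : ∀ i j, MemLp (fun x => Cwp x i j) 2 (volume.restrict (Icc a b))

/-- The boundary parameters `[∫[E_p] E_b E_z]`; there are `n₂ + 2 n₃` boundary conditions. -/
structure BCs (a b : ℝ) (n₁ n₂ n₃ nz : ℕ) where
  Ep : ℝ → Matrix (CoreIdx n₂ n₃) (IntIdx n₁ n₂ n₃) ℝ
  Eb : Matrix (CoreIdx n₂ n₃) (BfIdx n₂ n₃) ℝ
  Ez : Matrix (CoreIdx n₂ n₃) (Fin nz) ℝ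
  memLp_Ep : ∀ i j, MemLp (fun x => Ep x i j) 2 (volume.restrict (Icc a b))

section system

variable {a b : ℝ} {n₁ n₂ n₃ nz nw K : ℕ}

/-- `[A_p A_b B_z] y`. -/
def Coeffs.dyn (G : Coeffs a b n₁ n₂ n₃ nz nw) (y : Q a b n₁ n₂ n₃ nz) :
    StateIdx n₁ n₂ n₃ → L2 a b ℝ := fun i => toL2 a b fun x =>
  (∑ k, G.Ap x i k * y.1 k x) + (G.Ab x *ᵥ y.2.1) i + (G.Bz x *ᵥ y.2.2) i

/-- `[∫[C_wp] C_wb D_wz] y`. -/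
def Coeffs.out (G : Coeffs a b n₁ n₂ n₃ nz nw) (y : Q a b n₁ n₂ n₃ nz) : Fin nw → ℝ := fun i =>
  (∑ k, ∫ x in a..b, G.Cwp x i k * y.1 k x) + (G.Cwb *ᵥ y.2.1) i + (G.Dwz *ᵥ y.2.2) i

/-- `X_ζ`: the `u ∈ U` with `∫ E_p D_int u + E_b Λ_bf u + E_z ζ = 0`. -/
def BCs.X (E : BCs a b n₁ n₂ n₃ nz) (ζ : Fin nz → ℝ) : Set (U a b n₁ n₂ n₃) :=
  {u | ∀ i, (∑ k, ∫ x in a..b, E.Ep x i k * Dint u k x) + (E.Eb *ᵥ Lbf u) i +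
    (E.Ez *ᵥ ζ) i = 0}

/-- The values of the delayed state at one `s`: for each delay `j` the pair `(φ_{u,j}, φ_{z,j})`. -/
abbrev DelayVal (a b : ℝ) (n₁ n₂ n₃ nz K : ℕ) : Type :=
  Fin K → U a b n₁ n₂ n₃ × (Fin nz → ℝ)

/-- The space of delayed states. As `H₁([0,1]; E)`-functions with `E = U × ℝ^{n_z}`, the components
have the mixed weak derivatives `∂_s^α ∂_x^β`, `α ≤ 1`, `β ≤ 0, 1, 2`, in `L₂([0,1] × [a,b])`. -/
abbrev DelayState (a b : ℝ) (n₁ n₂ n₃ nz K : ℕ) : Type :=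
  H1 0 1 (DelayVal a b n₁ n₂ n₃ nz K)

/-- `Y_q × ⋯ × Y_q`: the delayed states that satisfy `φ_j(0) = T_q q` and the boundary conditions
at every `s ∈ [0,1]`. -/
def BCs.Y (E : BCs a b n₁ n₂ n₃ nz) (K : ℕ) (q : Q a b n₁ n₂ n₃ nz) :
    Set (DelayState a b n₁ n₂ n₃ nz K) :=
  {φ | ∀ j, U.toFun (traceAt φ.1.1 0 j).1 = (fun i => q.1 (stateToInt i)) ∧
      (traceAt φ.1.1 0 j).2 = q.2.2 ∧
      ∀ s ∈ Icc (0 : ℝ) 1, (traceAt φ.1.1 s j).1 ∈ E.X (traceAt φ.1.1 s j).2}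

/-- `((u, φ), w)` is a solution, for the input `z` and the initial state `(u₀, φ₀)`, of the 1D PDE
with output `q` and input `r`, coupled to the transport equations with input `q` and output `r`. -/
def IsDPDESolution (G : Coeffs a b n₁ n₂ n₃ nz nw) (Gd : Fin K → Coeffs a b n₁ n₂ n₃ nz nw)
    (E : BCs a b n₁ n₂ n₃ nz) (τ : Fin K → ℝ) (z : ℝ → Fin nz → ℝ)
    (y : ℝ → U a b n₁ n₂ n₃ × DelayState a b n₁ n₂ n₃ nz K) (w : ℝ → Fin nw → ℝ)
    (y₀ : U a b n₁ n₂ n₃ × DelayState a b n₁ n₂ n₃ nz K) : Prop :=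
  y₀.1 ∈ E.X (z 0) ∧ y₀.2 ∈ E.Y K (Dint y₀.1, Lbf y₀.1, z 0) ∧ y 0 = y₀ ∧
  ∃ (q : ℝ → Q a b n₁ n₂ n₃ nz) (r : ℝ → Fin K → Q a b n₁ n₂ n₃ nz), ∀ t, 0 ≤ t →
    ∃ y', HasDerivWithinAt y y' (Ici 0) t ∧
    -- the 1D PDE
    (U.toFun y'.1 = G.dyn (Dint (y t).1, Lbf (y t).1, z t) + ∑ j, (Gd j).dyn (r t j) ∧
      w t = G.out (Dint (y t).1, Lbf (y t).1, z t) + ∑ j, (Gd j).out (r t j) ∧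
      q t = (Dint (y t).1, Lbf (y t).1, z t) ∧
      (y t).1 ∈ E.X (z t)) ∧
    -- the transport equations
    ((∀ᵐ s ∂(volume.restrict (Icc (0 : ℝ) 1)), ∀ j,
        y'.2.1.1 s j = -(1 / τ j) • (y t).2.1.2 s j) ∧
      (∀ j, r t j = (Dint (traceAt (y t).2.1.1 1 j).1, Lbf (traceAt (y t).2.1.1 1 j).1,
        (traceAt (y t).2.1.1 1 j).2)) ∧
      (y t).2 ∈ E.Y K (q t))

/-! ## The PIE of the 1D PDE

With `c = D_bc u(a)` and `v = (u₁, ∂u₂, ∂²u₃)`,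
`D_int u (x) = Kint(x) c + Rint v(x) + ∫_a^x Lint(x,θ) v(θ) dθ`. -/

def Kint (a : ℝ) (n₁ n₂ n₃ : ℕ) (x : ℝ) : Matrix (IntIdx n₁ n₂ n₃) (CoreIdx n₂ n₃) ℝ :=
  Matrix.of fun
    | .inr (.inl i), .inl k => if i = k then 1 else 0
    | .inr (.inr (.inl i)), .inr (.inl k) => if i = k then 1 else 0
    | .inr (.inr (.inl i)), .inr (.inr k) => if i = k then x - a else 0
    | .inr (.inr (.inr (.inr (.inl i)))), .inr (.inr k) => if i = k then 1 else 0
    | _, _ => 0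

def Rint (n₁ n₂ n₃ : ℕ) : Matrix (IntIdx n₁ n₂ n₃) (StateIdx n₁ n₂ n₃) ℝ :=
  Matrix.of fun
    | .inl i, .inl k => if i = k then 1 else 0
    | .inr (.inr (.inr (.inl i))), .inr (.inl k) => if i = k then 1 else 0
    | .inr (.inr (.inr (.inr (.inr i)))), .inr (.inr k) => if i = k then 1 else 0
    | _, _ => 0

def Lint (n₁ n₂ n₃ : ℕ) (x θ : ℝ) : Matrix (IntIdx n₁ n₂ n₃) (StateIdx n₁ n₂ n₃) ℝ :=
  Matrix.of fun
    | .inr (.inl i), .inr (.inl k) => if i = k then 1 else 0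
    | .inr (.inr (.inl i)), .inr (.inr k) => if i = k then x - θ else 0
    | .inr (.inr (.inr (.inr (.inl i)))), .inr (.inr k) => if i = k then 1 else 0
    | _, _ => 0

/-- The matrix of the boundary conditions in terms of `c = D_bc u(a)`: the boundary conditions read
`E.mat c + ∫ E.ker(θ) v(θ) dθ + E_z z = 0`. -/
def BCs.mat (E : BCs a b n₁ n₂ n₃ nz) : Matrix (CoreIdx n₂ n₃) (CoreIdx n₂ n₃) ℝ :=
  E.Eb * Matrix.fromRows ((Kint a n₁ n₂ n₃ a).submatrix coreToInt id)
      ((Kint a n₁ n₂ n₃ b).submatrix coreToInt id) +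
    Matrix.of fun i k => ∫ x in a..b, (E.Ep x * Kint a n₁ n₂ n₃ x) i k

def BCs.ker (E : BCs a b n₁ n₂ n₃ nz) (θ : ℝ) :
    Matrix (CoreIdx n₂ n₃) (StateIdx n₁ n₂ n₃) ℝ :=
  E.Eb * Matrix.fromRows 0 ((Lint n₁ n₂ n₃ b θ).submatrix coreToInt id) +
    E.Ep θ * Rint n₁ n₂ n₃ +
    Matrix.of fun i k => ∫ x in θ..b, (E.Ep x * Lint n₁ n₂ n₃ x θ) i k

/-- The boundary conditions are well-posed. -/
def BCs.WellPosed (E : BCs a b n₁ n₂ n₃ nz) : Prop := IsUnit E.mat.det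

/-- `K(x) M⁻¹`, with `K(x)` the state rows of `Kint(x)` and `M = E.mat`. -/
def BCs.coreInv (E : BCs a b n₁ n₂ n₃ nz) (x : ℝ) :
    Matrix (StateIdx n₁ n₂ n₃) (CoreIdx n₂ n₃) ℝ :=
  (Kint a n₁ n₂ n₃ x).submatrix stateToInt id * E.mat⁻¹

/-- The 3-PI operator `T`. -/
def BCs.T (E : BCs a b n₁ n₂ n₃ nz) :
    (StateIdx n₁ n₂ n₃ → L2 a b ℝ) → StateIdx n₁ n₂ n₃ → L2 a b ℝ :=
  N3.op
    { R₀ := fun _ => (Rint n₁ n₂ n₃).submatrix stateToInt id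
      R₁ := fun x θ => (Lint n₁ n₂ n₃ x θ).submatrix stateToInt id - E.coreInv x * E.ker θ
      R₂ := fun x θ => -(E.coreInv x * E.ker θ) } a b

/-- The operator `T_z`. -/
def BCs.Tz (E : BCs a b n₁ n₂ n₃ nz) (ζ : Fin nz → ℝ) : StateIdx n₁ n₂ n₃ → L2 a b ℝ :=
  fun i => toL2 a b fun x => (-(E.coreInv x * E.Ez) *ᵥ ζ) i

/-- `(D_int ∘ T, Λ_bf ∘ T, 0)`, that is `(T_int, T_bf, 0)`. -/
def BCs.Tq (E : BCs a b n₁ n₂ n₃ nz) (v : StateIdx n₁ n₂ n₃ → L2 a b ℝ) :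
    Q a b n₁ n₂ n₃ nz :=
  (Dint (U.lift (E.T v)), Lbf (U.lift (E.T v)), 0)

/-- `(D_int ∘ T_z, Λ_bf ∘ T_z, I)`, that is `(T_{int,z}, T_{bf,z}, I)`. -/
def BCs.Tqz (E : BCs a b n₁ n₂ n₃ nz) (ζ : Fin nz → ℝ) : Q a b n₁ n₂ n₃ nz :=
  (Dint (U.lift (E.Tz ζ)), Lbf (U.lift (E.Tz ζ)), ζ)

/-- The PIE of the 1D PDE, with inputs `z`, `r` and outputs `w`, `q`. -/
def pie1D (G : Coeffs a b n₁ n₂ n₃ nz nw) (Gd : Fin K → Coeffs a b n₁ n₂ n₃ nz nw)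
    (E : BCs a b n₁ n₂ n₃ nz) :
    PIEqr (StateIdx n₁ n₂ n₃ → L2 a b ℝ) (Fin nz → ℝ) (Fin K → Q a b n₁ n₂ n₃ nz)
      (Fin nw → ℝ) (Q a b n₁ n₂ n₃ nz) where
  T := E.T
  Tw := E.Tz
  Tr _ := 0
  A v := G.dyn (E.Tq v)
  Bw ζ := G.dyn (E.Tqz ζ)
  Br r := ∑ j, (Gd j).dyn (r j)
  Cz v := G.out (E.Tq v)
  Dzw ζ := G.out (E.Tqz ζ)
  Dzr r := ∑ j, (Gd j).out (r j)
  Cq := E.Tq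
  Dqw := E.Tqz

/-! ## The PIE of the transport equations -/

/-- Fundamental delayed states `ψ = (ψ_{z,j}, ψ_{u,j})_j`. -/
abbrev Psi (a b : ℝ) (n₁ n₂ n₃ nz K : ℕ) : Type :=
  Z2 a b 0 1 (Fin K × Fin nz) (Fin K × StateIdx n₁ n₂ n₃)

/-- `(T ψ_{u,j} + T_z ψ_{z,j}, ψ_{z,j})_j` at one `s`. -/
def BCs.delayMap (E : BCs a b n₁ n₂ n₃ nz)
    (p : Z1 a b (Fin K × Fin nz) (Fin K × StateIdx n₁ n₂ n₃)) :
    Z1 a b (Fin K × Fin nz) (Fin K × StateIdx n₁ n₂ n₃) :=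
  (p.1, fun k => E.T (fun i => p.2 (k.1, i)) k.2 + E.Tz (fun i => p.1 (k.1, i)) k.2)

/-- The PIE of the transport equations, with input `q` and output `r`. -/
def pieTransport (E : BCs a b n₁ n₂ n₃ nz) (τ : Fin K → ℝ) :
    PIE (Psi a b n₁ n₂ n₃ nz K) (Q a b n₁ n₂ n₃ nz) (Fin K → Q a b n₁ n₂ n₃ nz) where
  T ψ := toL2 0 1 fun s => ∫ θ in (0 : ℝ)..s, E.delayMap (ψ θ)
  Tw q := toL2 0 1 fun _ => (fun k => q.2.2 k.2, fun k => q.1 (stateToInt k.2))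
  A ψ := toL2 0 1 fun s =>
    (fun k => -(1 / τ k.1) * (E.delayMap (ψ s)).1 k,
     fun k => -(1 / τ k.1) • (E.delayMap (ψ s)).2 k)
  B _ := 0
  C ψ := fun j => ∫ s in (0 : ℝ)..1,
    (E.Tq (fun i => (ψ s).2 (j, i)) + E.Tqz (fun i => (ψ s).1 (j, i)))
  D q := fun _ => q

/-- The PIE of the delayed PDE. -/
def pieDPDE (G : Coeffs a b n₁ n₂ n₃ nz nw) (Gd : Fin K → Coeffs a b n₁ n₂ n₃ nz nw)
    (E : BCs a b n₁ n₂ n₃ nz) (τ : Fin K → ℝ) :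
    PIE ((StateIdx n₁ n₂ n₃ → L2 a b ℝ) × Psi a b n₁ n₂ n₃ nz K) (Fin nz → ℝ) (Fin nw → ℝ) :=
  interconnect (pie1D G Gd E) (pieTransport E τ)

/-- The underlying `L₂` functions of `(u, φ)`. -/
def toState (y : U a b n₁ n₂ n₃ × DelayState a b n₁ n₂ n₃ nz K) :
    (StateIdx n₁ n₂ n₃ → L2 a b ℝ) × Psi a b n₁ n₂ n₃ nz K :=
  (U.toFun y.1, toL2 0 1 fun s =>
    (fun k => (y.2.1.1 s k.1).2 k.2, fun k => U.toFun (y.2.1.1 s k.1).1 k.2))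

/-- The trajectories and initial states are related by `(u, φ) = T (v, ψ) + T_z z` for all `t ≥ 0`
and `(u₀, φ₀) = T (v₀, ψ₀) + T_z z(0)`. -/
def Corresponds
    (P : PIE ((StateIdx n₁ n₂ n₃ → L2 a b ℝ) × Psi a b n₁ n₂ n₃ nz K) (Fin nz → ℝ) (Fin nw → ℝ))
    (z : ℝ → Fin nz → ℝ)
    (x : ℝ → (StateIdx n₁ n₂ n₃ → L2 a b ℝ) × Psi a b n₁ n₂ n₃ nz K)
    (x₀ : (StateIdx n₁ n₂ n₃ → L2 a b ℝ) × Psi a b n₁ n₂ n₃ nz K)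
    (y : ℝ → U a b n₁ n₂ n₃ × DelayState a b n₁ n₂ n₃ nz K)
    (y₀ : U a b n₁ n₂ n₃ × DelayState a b n₁ n₂ n₃ nz K) : Prop :=
  (∀ t, 0 ≤ t → toState (y t) = P.T (x t) + P.Tw (z t)) ∧ toState y₀ = P.T x₀ + P.Tw (z 0)

end system

end DelayPIE

end

open DelayPIE

noncomputable section
namespace DelayPIE

-- By Taylor's formula with integral remainder, a Sobolev function on an interval amounts to its
-- boundary values at `a` and its highest derivatives: u ↦ (c, v) = (D_bc u(a), 𝒟u) is an
-- isomorphism of U with ℝ^{n₂+2n₃} × L₂ (`U.equivCore`). In these coordinates the boundary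
-- conditions read M c + ∫ N v + E_z ζ = 0 (`bc_eq`), and invertibility of M turns u ∈ X_ζ into u =
-- T(𝒟u) + T_z ζ with 𝒟u unconstrained (`BCs.mem_X_iff`).
--
-- The delay variable s is treated in the same way: an H₁ function of s amounts to φ(0) and ∂_sφ,
-- and φ_j(0) = (u, ζ) is prescribed. One point needs an argument. The conditions φ_u(s) ∈
-- X_{φ_z(s)} constrain φ(s), whereas the PIE state parametrizes ∂_sφ. They are the kernel of a
-- bounded operator that does not depend on s, so they hold for all s exactly if they hold for φ(0)
-- and, almost everywhere, for ∂_sφ. Thus ∂_sφ_j = (Tψ_u + T_zψ_z, ψ_z) with ψ free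
-- (`BCs.traceAt_lift_mem_X`, `eq_lift_fundState`).
--
-- Consequently (x, ζ) ↦ 𝒯x + 𝒯_zζ is the underlying L₂ function of a bounded map `lift𝒯 + lift𝒯z`
-- into the Sobolev spaces (`toState_lift`), and the bounded operator `fundState` recovers x from it
-- (`BCs.fundState_lift`). Since both maps are bounded and z is differentiable, differentiability in
-- t in the L₂ norms and in the Sobolev norms is equivalent, and the derivative of a lifted
-- trajectory is the lift of (x', z'). The fundamental theorem of calculus in s identifies the
-- output r_j of the transport PIE with the observation of φ_j(1); after this the two systems of
-- equations agree term by term (`pieDPDE_eq_iff`, `pieDPDE_out`).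
--
-- For the PI property, the component operators L₂ → L₂ are shown to be a bounded multiplier plus a
-- Hilbert–Schmidt operator (`IsPI3`). Taylor's formula has this form, multiplication by L_∞
-- functions preserves it, and whatever factors through some ℝⁿ is Hilbert–Schmidt by the Riesz
-- theorem. Along s only multipliers, ∫_0^s and ∫_0^1 occur.

local notation "π₁" => ContinuousLinearMap.fst ℝ _ _
local notation "π₂" => ContinuousLinearMap.snd ℝ _ _

/-! ## Bounded operators on `L₂` -/

/-- Lebesgue measure on `[a,b]`. -/
abbrev vol (a b : ℝ) : Measure ℝ := volume.restrict (Icc a b)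

local instance {a b : ℝ} {E : Type} [NormedAddCommGroup E] :
    NormedAddCommGroup (L2 a b E) := inferInstance
local instance {a b : ℝ} {E : Type} [NormedAddCommGroup E] :
    SeminormedAddCommGroup (L2 a b E) := inferInstance
local instance {a b : ℝ} {E : Type} [NormedAddCommGroup E] :
    AddCommGroup (L2 a b E) := inferInstance
local instance {a b : ℝ} {E : Type} [NormedAddCommGroup E] :
    AddCommMonoid (L2 a b E) := inferInstance
local instance {a b : ℝ} {E : Type} [NormedAddCommGroup E] :
    TopologicalSpace (L2 a b E) := inferInstance
local instance {a b : ℝ} {E : Type} [NormedAddCommGroup E] :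
    IsTopologicalAddGroup (L2 a b E) := inferInstance
local instance {a b : ℝ} {E : Type} [NormedAddCommGroup E] :
    ContinuousAdd (L2 a b E) := inferInstance
local instance {a b : ℝ} {E : Type} [NormedAddCommGroup E] [NormedSpace ℝ E] :
    NormedSpace ℝ (L2 a b E) := inferInstance
local instance {a b : ℝ} {E : Type} [NormedAddCommGroup E] [NormedSpace ℝ E] :
    Module ℝ (L2 a b E) := inferInstance
local instance {a b : ℝ} {E : Type} [NormedAddCommGroup E] [NormedSpace ℝ E] :
    ContinuousConstSMul ℝ (L2 a b E) := inferInstance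

section basic

variable {a b : ℝ} {E F : Type} [NormedAddCommGroup E] [NormedAddCommGroup F]

theorem toL2_coeFn {f : ℝ → E} (h : MemLp f 2 (vol a b)) : toL2 a b f =ᵐ[vol a b] f := by
  rw [toL2, dif_pos h]; exact h.coeFn_toLp

theorem toL2_eq {f : ℝ → E} {u : L2 a b E} (h : f =ᵐ[vol a b] u) : toL2 a b f = u := by
  have hf : MemLp f 2 (vol a b) := (memLp_congr_ae h).2 (Lp.memLp u)
  exact Lp.ext ((toL2_coeFn hf).trans h)

theorem toL2_congr {f g : ℝ → E} (h : f =ᵐ[vol a b] g) : toL2 a b f = toL2 a b g := by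
  by_cases hg : MemLp g 2 (vol a b)
  · exact toL2_eq (h.trans (toL2_coeFn hg).symm)
  -- Neither function is square-integrable, so both classes are the default value 0.
  · have hf : ¬ MemLp f 2 (vol a b) := fun hf => hg ((memLp_congr_ae h).1 hf)
    rw [toL2, toL2, dif_neg hf, dif_neg hg]

theorem toL2_add {f g : ℝ → E} (hf : MemLp f 2 (vol a b)) (hg : MemLp g 2 (vol a b)) :
    toL2 a b (fun x => f x + g x) = toL2 a b f + toL2 a b g := by
  refine toL2_eq ?_
  filter_upwards [toL2_coeFn hf, toL2_coeFn hg, Lp.coeFn_add (toL2 a b f) (toL2 a b g)]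
    with x h1 h2 h3
  rw [h3, Pi.add_apply, h1, h2]

theorem toL2_coe (u : L2 a b E) : toL2 a b u = u := toL2_eq (ae_eq_refl _)

theorem integrable_coe (u : L2 a b E) : Integrable u (vol a b) :=
  (Lp.memLp u).integrable (by norm_num)

theorem ae_mem_Icc : ∀ᵐ x ∂(vol a b), x ∈ Icc a b := ae_restrict_mem measurableSet_Icc

theorem intervalIntegrable_of_integrable {f : ℝ → E} (hf : Integrable f (vol a b)) {c d : ℝ}
    (hc : c ∈ Icc a b) (hd : d ∈ Icc a b) : IntervalIntegrable f volume c d :=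
  (IntegrableOn.mono_set hf (uIcc_subset_Icc hc hd)).intervalIntegrable

theorem intervalIntegrable_coe (u : L2 a b E) {c d : ℝ}
    (hc : c ∈ Icc a b) (hd : d ∈ Icc a b) : IntervalIntegrable u volume c d :=
  intervalIntegrable_of_integrable (integrable_coe u) hc hd

theorem memLp_one {p : ℝ≥0∞} : MemLp (fun _ : ℝ => (1 : ℝ)) p (vol a b) := memLp_const 1

theorem memLp_of_continuousOn {f : ℝ → E} (hf : ContinuousOn f (Icc a b)) {p : ℝ≥0∞} :
    MemLp f p (vol a b) := by
  obtain ⟨C, hC⟩ := isCompact_Icc.exists_bound_of_continuousOn hf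
  refine MemLp.of_bound (hf.aestronglyMeasurable measurableSet_Icc) C ?_
  filter_upwards [ae_mem_Icc] with x hx using hC x hx

end basic

section operators

variable {a b : ℝ} {E F : Type} [NormedAddCommGroup E] [NormedSpace ℝ E]
  [NormedAddCommGroup F] [NormedSpace ℝ F]

theorem integral_congr_Icc {f g : ℝ → E} (h : f =ᵐ[vol a b] g) {c d : ℝ}
    (hc : c ∈ Icc a b) (hd : d ∈ Icc a b) : ∫ x in c..d, f x = ∫ x in c..d, g x := by
  refine intervalIntegral.integral_congr_ae_restrict ?_
  exact ae_mono (Measure.restrict_mono (uIoc_subset_uIcc.trans (uIcc_subset_Icc hc hd)) le_rfl) h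

theorem integral_eq_integral_Icc (hab : a ≤ b) (f : ℝ → E) :
    ∫ x in a..b, f x = ∫ x, f x ∂(vol a b) := by
  rw [intervalIntegral.integral_of_le hab, integral_Icc_eq_integral_Ioc]

/-- Moving the variable endpoint into an indicator leaves a fixed measure, to which L₂ duality and
Fubini's theorem apply. -/
theorem integral_prefix (x : ℝ) (hx : x ∈ Icc a b) (f : ℝ → E) :
    ∫ θ in a..x, f θ = ∫ θ, (Iic x).indicator f θ ∂(vol a b) := by
  rw [intervalIntegral.integral_of_le hx.1, integral_indicator measurableSet_Iic,
    Measure.restrict_restrict measurableSet_Iic, ← integral_Icc_eq_integral_Ioc]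
  congr 2
  ext y; simp only [mem_Icc, mem_inter_iff, mem_Iic]
  exact ⟨fun h => ⟨h.2, h.1, h.2.trans hx.2⟩, fun h => ⟨h.2.1, h.1⟩⟩

theorem integral_suffix (x : ℝ) (hx : x ∈ Icc a b) (f : ℝ → E) :
    ∫ θ in x..b, f θ = ∫ θ, (Ici x).indicator f θ ∂(vol a b) := by
  rw [intervalIntegral.integral_of_le hx.2, integral_indicator measurableSet_Ici,
    Measure.restrict_restrict measurableSet_Ici, ← integral_Icc_eq_integral_Ioc]
  congr 2
  ext y; simp only [mem_Icc, mem_inter_iff, mem_Ici]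
  exact ⟨fun h => ⟨h.1, hx.1.trans h.1, h.2⟩, fun h => ⟨h.1, h.2.2⟩⟩

/-- `u ↦ ∫ f(x) u(x) dx`. -/
def pairing [CompleteSpace E] (f : L2 a b ℝ) : L2 a b E →L[ℝ] E :=
  (ContinuousLinearMap.lsmul ℝ ℝ).lpPairing (vol a b) 2 2 f

theorem pairing_apply [CompleteSpace E] (f : L2 a b ℝ) (u : L2 a b E) :
    pairing f u = ∫ x, f x • u x ∂(vol a b) :=
  ContinuousLinearMap.lpPairing_eq_integral _ _ _

theorem pairing_toL2 [CompleteSpace E] {f : ℝ → ℝ} (hf : MemLp f 2 (vol a b)) (u : L2 a b E) :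
    pairing (toL2 a b f) u = ∫ x, f x • u x ∂(vol a b) := by
  rw [pairing_apply]
  refine integral_congr_ae ?_
  filter_upwards [toL2_coeFn hf] with x h
  rw [h]

/-- `u ↦ ∫_a^x u`. -/
def primAt [CompleteSpace E] (x : ℝ) : L2 a b E →L[ℝ] E := pairing (toL2 a b ((Iic x).indicator fun _ => 1))

theorem primAt_apply [CompleteSpace E] {x : ℝ} (hx : x ∈ Icc a b) (u : L2 a b E) :
    primAt x u = ∫ θ in a..x, u θ := by
  rw [primAt, pairing_toL2 (memLp_one.indicator measurableSet_Iic), integral_prefix x hx]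
  congr 1; ext θ
  by_cases h : θ ∈ Iic x <;> simp [h]

theorem continuousOn_prim {f : ℝ → E} (hf : Integrable f (vol a b)) :
    ContinuousOn (fun x => ∫ θ in a..x, f θ) (Icc a b) := by
  rcases le_or_gt a b with h | h
  · have := intervalIntegral.continuousOn_primitive_interval (μ := volume) (a := a) (b := b) (f := f)
      (by rw [uIcc_of_le h]; exact hf)
    rwa [uIcc_of_le h] at this
  · rw [Icc_eq_empty (not_le.2 h)]; exact continuousOn_empty _

theorem continuousOn_suffix {f : ℝ → E} (hf : Integrable f (vol a b)) :
    ContinuousOn (fun x => ∫ θ in x..b, f θ) (Icc a b) := by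
  rcases le_or_gt a b with h | h
  · have := intervalIntegral.continuousOn_primitive_interval_left (μ := volume) (a := a) (b := b)
      (f := f) (by rw [uIcc_of_le h]; exact hf)
    rwa [uIcc_of_le h] at this
  · rw [Icc_eq_empty (not_le.2 h)]; exact continuousOn_empty _

theorem memLp_prim (u : L2 a b E) {p : ℝ≥0∞} :
    MemLp (fun x => ∫ θ in a..x, u θ) p (vol a b) :=
  memLp_of_continuousOn (continuousOn_prim (integrable_coe u))

/-- Duality against the indicator of [a,x], whose norm is at most that of the constant 1. The bound
is uniform in x, which is what boundedness of `volterra` requires. -/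
theorem norm_prim_le [CompleteSpace E] {x : ℝ} (hx : x ∈ Icc a b) (u : L2 a b E) :
    ‖∫ θ in a..x, u θ‖ ≤ (‖(ContinuousLinearMap.lsmul ℝ ℝ : ℝ →L[ℝ] E →L[ℝ] E).lpPairing
      (vol a b) 2 2‖ * ‖toL2 a b (fun _ => (1 : ℝ))‖) * ‖u‖ := by
  rw [← primAt_apply hx]
  refine (ContinuousLinearMap.le_opNorm₂ _ _ _).trans ?_
  refine mul_le_mul_of_nonneg_right (mul_le_mul_of_nonneg_left ?_ ?_) (norm_nonneg _)
  swap; · exact ContinuousLinearMap.opNorm_nonneg _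
  have m : MemLp ((Iic x).indicator fun _ => (1 : ℝ)) 2 (vol a b) :=
    memLp_one.indicator measurableSet_Iic
  refine Lp.norm_le_norm_of_ae_le ?_
  filter_upwards [toL2_coeFn (memLp_one (a := a) (b := b) (p := 2)), toL2_coeFn m] with y h1 h2
  rw [h1, h2]
  exact norm_indicator_le_norm_self _ _

/-- `(V u)(x) = ∫_a^x u`. -/
def volterra [CompleteSpace E] : L2 a b E →L[ℝ] L2 a b E :=
  LinearMap.mkContinuous
    { toFun := fun u => toL2 a b fun x => ∫ θ in a..x, u θ
      map_add' := fun u v => by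
        rw [← toL2_add (memLp_prim u) (memLp_prim v)]
        refine toL2_congr ?_
        filter_upwards [ae_mem_Icc] with x hx
        simp only [← primAt_apply hx, map_add]
      map_smul' := fun c u => by
        refine toL2_eq ?_
        filter_upwards [ae_mem_Icc, Lp.coeFn_smul c (toL2 a b fun x => ∫ θ in a..x, u θ),
          toL2_coeFn (memLp_prim u)] with x hx h1 h2
        simp only [RingHom.id_apply]
        rw [h1, Pi.smul_apply, h2, ← primAt_apply hx, ← primAt_apply hx, map_smul] }
    ((vol a b).real univ ^ ((2 : ℝ≥0∞).toReal⁻¹) *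
      (‖(ContinuousLinearMap.lsmul ℝ ℝ : ℝ →L[ℝ] E →L[ℝ] E).lpPairing
      (vol a b) 2 2‖ * ‖toL2 a b (fun _ => (1 : ℝ))‖)) (by
    intro u
    rw [mul_assoc]
    refine Lp.norm_le_of_ae_bound (by positivity) ?_
    filter_upwards [ae_mem_Icc, toL2_coeFn (memLp_prim u)] with x hx h
    simp only [LinearMap.coe_mk, AddHom.coe_mk]
    rw [h]
    exact norm_prim_le hx u)

theorem volterra_coeFn [CompleteSpace E] (u : L2 a b E) : volterra u =ᵐ[vol a b] fun x => ∫ θ in a..x, u θ :=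
  toL2_coeFn (memLp_prim u)

/-- Constant functions. -/
def constL2 : E →L[ℝ] L2 a b E := Lp.constL 2 (vol a b) ℝ

theorem constL2_coeFn (c : E) : (constL2 c : L2 a b E) =ᵐ[vol a b] fun _ => c :=
  Lp.coeFn_const 2 _ c

theorem toL2_const (c : E) : toL2 a b (fun _ => c) = constL2 c := toL2_eq (constL2_coeFn c).symm

/-- Pointwise application of a bounded operator. -/
def mapL2 (L : E →L[ℝ] F) : L2 a b E →L[ℝ] L2 a b F := L.compLpL 2 (vol a b)

theorem mapL2_coeFn (L : E →L[ℝ] F) (u : L2 a b E) :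
    mapL2 L u =ᵐ[vol a b] fun x => L (u x) := L.coeFn_compLpL u

theorem toL2_map (L : E →L[ℝ] F) (u : L2 a b E) : toL2 a b (fun x => L (u x)) = mapL2 L u :=
  toL2_eq (mapL2_coeFn L u).symm

theorem mapL2_const (L : E →L[ℝ] F) (c : E) :
    mapL2 L (constL2 c : L2 a b E) = constL2 (L c) := by
  refine Lp.ext ?_
  filter_upwards [mapL2_coeFn L (constL2 c : L2 a b E), constL2_coeFn (a := a) (b := b) c,
    constL2_coeFn (a := a) (b := b) (L c)] with x h1 h2 h3
  rw [h1, h2, h3]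

/-- Bounded operators pass under the Bochner integral. With s as the variable of integration, this
moves operators that act in x through integration over the delay. -/
theorem mapL2_volterra [CompleteSpace E] [CompleteSpace F] (L : E →L[ℝ] F) (u : L2 a b E) :
    mapL2 L (volterra u) = volterra (mapL2 L u) := by
  refine Lp.ext ?_
  filter_upwards [ae_mem_Icc, mapL2_coeFn L (volterra u), volterra_coeFn u,
    volterra_coeFn (mapL2 L u)] with x hx h1 h2 h3
  rw [h1, h2, h3, ← L.intervalIntegral_comp_comm
    (intervalIntegrable_coe u ⟨le_rfl, hx.1.trans hx.2⟩ hx)]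
  exact (integral_congr_Icc (mapL2_coeFn L u) ⟨le_rfl, hx.1.trans hx.2⟩ hx).symm

/-- Multiplication by a bounded function. -/
def mulL2 (g : ℝ → ℝ) (hg : MemLp g ∞ (vol a b)) : L2 a b ℝ →L[ℝ] L2 a b ℝ :=
  (ContinuousLinearMap.mul ℝ ℝ).holderL (vol a b) ∞ 2 2 (hg.toLp g)

theorem mulL2_coeFn (g : ℝ → ℝ) (hg : MemLp g ∞ (vol a b)) (u : L2 a b ℝ) :
    mulL2 g hg u =ᵐ[vol a b] fun x => g x * u x := by
  filter_upwards [hg.coeFn_toLp, (ContinuousLinearMap.mul ℝ ℝ).coeFn_holder (r := 2) (hg.toLp g) u]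
    with x h1 h2
  rw [← h1]; exact h2

end operators

/-! ## Weak derivatives -/

/-- Two continuous functions that agree almost everywhere on a nondegenerate interval agree on all
of it, so the representative chosen in `traceAt` does not matter. -/
theorem traceAt_eq {a b : ℝ} {E : Type} [NormedAddCommGroup E] (hab : a < b) {f : L2 a b E} {g : ℝ → E} (hg : ContinuousOn g (Icc a b))
    (hf : f =ᵐ[vol a b] g) {x : ℝ} (hx : x ∈ Icc a b) : traceAt f x = g x := by
  have h : ∃ g : ℝ → E, ContinuousOn g (Icc a b) ∧ f =ᵐ[vol a b] g := ⟨g, hg, hf⟩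
  rw [traceAt, dif_pos h]
  exact Measure.eqOn_Icc_of_ae_eq volume hab.ne (h.choose_spec.2.symm.trans hf) h.choose_spec.1 hg hx

section weak

variable {a b : ℝ} {E F : Type} [NormedAddCommGroup E] [NormedSpace ℝ E]
  [NormedAddCommGroup F] [NormedSpace ℝ F]

/-- Fubini's theorem on the triangle `a ≤ θ ≤ x ≤ b`. -/
theorem integral_triangle (hab : a ≤ b) {f : ℝ → ℝ → E}
    (hf : Integrable (Function.uncurry f) ((vol a b).prod (vol a b))) :
    ∫ x in a..b, ∫ θ in a..x, f x θ = ∫ θ in a..b, ∫ x in θ..b, f x θ := by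
  have hS : MeasurableSet {p : ℝ × ℝ | p.2 ≤ p.1} := measurableSet_le measurable_snd measurable_fst
  have h := integral_integral_swap
    (f := fun x θ => {p : ℝ × ℝ | p.2 ≤ p.1}.indicator (Function.uncurry f) (x, θ))
    (hf.indicator hS)
  rw [integral_eq_integral_Icc hab, integral_eq_integral_Icc hab]
  refine (integral_congr_ae ?_).trans (h.trans (integral_congr_ae ?_))
  · filter_upwards [ae_mem_Icc] with x hx
    rw [integral_prefix x hx]
    rfl
  · filter_upwards [ae_mem_Icc] with x hx
    rw [integral_suffix x hx]
    rfl

theorem integrable_smul_prod {f : ℝ → ℝ} {u : ℝ → E} (hf : Integrable f (vol a b))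
    (hu : Integrable u (vol a b)) :
    Integrable (fun p : ℝ × ℝ => f p.1 • u p.2) ((vol a b).prod (vol a b)) :=
  hf.smul_prod hu

theorem integrable_test {η : ℝ → ℝ} (hη : Continuous η) : Integrable η (vol a b) :=
  hη.continuousOn.integrableOn_compact isCompact_Icc

theorem test_eq_zero {η : ℝ → ℝ} {s : Set ℝ} (hs : tsupport η ⊆ s) {x : ℝ} (hx : x ∉ s) :
    η x = 0 := image_eq_zero_of_notMem_tsupport fun h => hx (hs h)

/-- The constant contributes η(b) − η(a) = 0. For the primitive, Fubini's theorem turns ∫ η'(x)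
∫_a^x v into ∫ (η(b) − η(θ)) v(θ) dθ, where η(b) = 0. -/
theorem isWeakDeriv_of_prim (hab : a ≤ b) [CompleteSpace E] (c : E) (v : L2 a b E) :
    IsWeakDeriv (constL2 c + volterra v) v := by
  suffices h : IsWeakDeriv (constL2 c + volterra v) (0 + v) by rwa [zero_add] at h
  refine IsWeakDeriv.add ?_ ?_
  · intro η h1 h2 h3
    have e : ∫ x in Icc a b, η x • (0 : L2 a b E) x = 0 := by
      rw [← integral_zero ℝ E (μ := vol a b)]
      refine integral_congr_ae ?_
      filter_upwards [Lp.coeFn_zero E 2 (vol a b)] with x hx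
      rw [hx]; simp
    rw [e, neg_zero]
    have e2 : ∫ x in Icc a b, deriv η x • (constL2 c : L2 a b E) x
        = ∫ x in Icc a b, deriv η x • c := by
      refine integral_congr_ae ?_
      filter_upwards [constL2_coeFn (a := a) (b := b) c] with x hx
      rw [hx]
    rw [e2, integral_smul_const, ← integral_eq_integral_Icc hab,
      intervalIntegral.integral_deriv_eq_sub (fun x _ => (h1.differentiable (by simp)).differentiableAt)
        ((h1.continuous_deriv (by simp)).intervalIntegrable _ _),
      test_eq_zero h3 (by simp), test_eq_zero h3 (by simp), sub_zero, zero_smul]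
  · intro η h1 h2 h3
    have hd := h1.continuous_deriv (by simp)
    have e : ∫ x in Icc a b, deriv η x • (volterra v : L2 a b E) x
        = ∫ x in a..b, ∫ θ in a..x, deriv η x • v θ := by
      rw [integral_eq_integral_Icc hab]
      refine integral_congr_ae ?_
      filter_upwards [volterra_coeFn v] with x hx
      rw [hx, intervalIntegral.integral_smul]
    rw [e, integral_triangle hab (f := fun x θ => deriv η x • v θ)
      (integrable_smul_prod (integrable_test hd) (integrable_coe v)), ← integral_neg,
      integral_eq_integral_Icc hab]
    refine integral_congr_ae ?_
    filter_upwards [ae_mem_Icc] with θ hθ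
    rw [intervalIntegral.integral_smul_const,
      intervalIntegral.integral_deriv_eq_sub (fun x _ => (h1.differentiable (by simp)).differentiableAt)
        (hd.intervalIntegrable _ _), test_eq_zero h3 (x := b) (by simp), zero_sub, neg_smul]

theorem ae_mem_Ioo : ∀ᵐ x ∂(vol a b), x ∈ Ioo a b := by
  rw [show vol a b = volume.restrict (Ioo a b) from
    (restrict_Ioo_eq_restrict_Icc (μ := volume) (a := a) (b := b)).symm]
  exact ae_restrict_mem measurableSet_Ioo

/-- The fundamental lemma of the calculus of variations on the open interval; the endpoints form a
null set. -/
theorem ae_zero_of_test [CompleteSpace E] {u : ℝ → E} (hu : Integrable u (vol a b))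
    (h : ∀ η : ℝ → ℝ, ContDiff ℝ ∞ η → HasCompactSupport η → tsupport η ⊆ Ioo a b →
      ∫ x in Icc a b, η x • u x = 0) : u =ᵐ[vol a b] 0 := by
  have hl : LocallyIntegrableOn u (Ioo a b) volume :=
    (IntegrableOn.mono_set hu Ioo_subset_Icc_self).locallyIntegrableOn
  have := isOpen_Ioo.ae_eq_zero_of_integral_contDiff_smul_eq_zero hl (μ := volume)
    (fun g h1 h2 h3 => by
      rw [← h g h1 h2 h3, ← setIntegral_eq_integral_of_forall_compl_eq_zero (s := Icc a b)]
      intro x hx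
      rw [test_eq_zero h3 (fun h => hx (Ioo_subset_Icc_self h)), zero_smul])
  filter_upwards [ae_mem_Ioo, ae_restrict_of_ae (s := Icc a b) this] with x h1 h2 using h2 h1

theorem IsWeakDeriv.unique [CompleteSpace E] {u p q : L2 a b E} (hp : IsWeakDeriv u p)
    (hq : IsWeakDeriv u q) : p = q := by
  refine sub_eq_zero.1 (Lp.ext ?_)
  refine (ae_zero_of_test (integrable_coe (p - q)) fun η h1 h2 h3 => ?_).trans
    (Lp.coeFn_zero E 2 _).symm
  have e : ∫ x in Icc a b, η x • (p - q) x
      = (∫ x in Icc a b, η x • p x) - ∫ x in Icc a b, η x • q x := by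
    rw [← integral_sub (integrable_test_smul h1.continuous h2 p)
      (integrable_test_smul h1.continuous h2 q)]
    refine integral_congr_ae ?_
    filter_upwards [Lp.coeFn_sub p q] with x hx
    rw [hx, Pi.sub_apply, smul_sub]
  rw [e, neg_inj.1 ((hp η h1 h2 h3).symm.trans (hq η h1 h2 h3)), sub_self]

/-- The reference bump for du Bois-Reymond's lemma: subtracting a multiple of it gives any test
function integral zero. -/
theorem exists_test (hab : a < b) : ∃ ρ : ℝ → ℝ, ContDiff ℝ ∞ ρ ∧ HasCompactSupport ρ ∧
    tsupport ρ ⊆ Ioo a b ∧ ∫ x in a..b, ρ x = 1 := by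
  have hm : (a + b) / 2 ∈ Ioo a b := ⟨by linarith, by linarith⟩
  -- The support is the closed ball of radius (b − a)/4 about the midpoint, well inside the
  -- half-length (b − a)/2.
  let f : ContDiffBump ((a + b) / 2) := ⟨(b - a) / 8, (b - a) / 4, by linarith, by linarith⟩
  have hs : tsupport (f.normed volume) ⊆ Ioo a b := by
    rw [f.tsupport_normed_eq, Real.closedBall_eq_Icc]
    intro x hx
    have h1 := hx.1
    have h2 := hx.2
    simp only [f] at h1 h2
    exact ⟨by linarith, by linarith⟩
  refine ⟨f.normed volume, f.contDiff_normed, f.hasCompactSupport_normed, hs, ?_⟩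
  rw [integral_eq_integral_Icc hab.le, setIntegral_eq_integral_of_forall_compl_eq_zero,
    f.integral_normed]
  intro x hx
  exact test_eq_zero hs fun h => hx (Ioo_subset_Icc_self h)

/-- A test function of integral zero is the derivative of a test function. -/
theorem exists_antideriv {h : ℝ → ℝ} (h1 : ContDiff ℝ ∞ h) (h2 : HasCompactSupport h)
    (h3 : tsupport h ⊆ Ioo a b) (h0 : ∫ x in a..b, h x = 0) :
    ∃ η : ℝ → ℝ, ContDiff ℝ ∞ η ∧ HasCompactSupport η ∧ tsupport η ⊆ Ioo a b ∧ deriv η = h := by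
  rcases (tsupport h).eq_empty_or_nonempty with hemp | hne
  · have : h = 0 := by rwa [tsupport_eq_empty_iff] at hemp
    refine ⟨0, contDiff_const, HasCompactSupport.zero, ?_, ?_⟩
    · rw [tsupport_eq_empty_iff.2 rfl]; exact empty_subset _
    · rw [this]; ext x; simp
  obtain ⟨α, hα⟩ := h2.isCompact.exists_isLeast hne
  obtain ⟨β, hβ⟩ := h2.isCompact.exists_isGreatest hne
  have hα' := h3 hα.1
  have hβ' := h3 hβ.1
  have hd : ∀ x, HasDerivAt (fun x => ∫ t in a..x, h t) (h x) x := fun x =>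
    (h1.continuous.integral_hasStrictDerivAt a x).hasDerivAt
  have hderiv : deriv (fun x => ∫ t in a..x, h t) = h := funext fun x => (hd x).deriv
  -- With [α, β] the convex hull of the support, the primitive vanishes left of α because `h` does
  -- on the range of integration, and right of β because it equals the total integral, which is
  -- zero.
  have hz : ∀ x, x ∉ Icc α β → ∫ t in a..x, h t = 0 := by
    intro x hx
    have hout : ∀ y, y ∉ Icc α β → h y = 0 := fun y hy =>
      image_eq_zero_of_notMem_tsupport fun hm => hy ⟨hα.2 hm, hβ.2 hm⟩
    rcases lt_or_ge x α with hxα | hxα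
    · refine intervalIntegral.integral_zero_ae (Filter.Eventually.of_forall fun y hy => hout y ?_)
      rw [uIoc, mem_Ioc] at hy
      exact fun hm => absurd (hm.1.trans hy.2) (not_le.2 (max_lt hα'.1 hxα))
    · have hxβ : β < x := lt_of_not_ge fun hle => hx ⟨hxα, hle⟩
      have : ∫ t in x..b, h t = 0 := by
        refine intervalIntegral.integral_zero_ae (Filter.Eventually.of_forall fun y hy => hout y ?_)
        rw [uIoc, mem_Ioc] at hy
        exact fun hm => absurd (hy.1.trans_le hm.2) (not_lt.2 (le_min hxβ.le hβ'.2.le))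
      have h4 := intervalIntegral.integral_add_adjacent_intervals
        (h1.continuous.intervalIntegrable (μ := volume) a x)
        (h1.continuous.intervalIntegrable (μ := volume) x b)
      rw [this, h0, add_zero] at h4
      exact h4
  have hsub : tsupport (fun x => ∫ t in a..x, h t) ⊆ Icc α β :=
    closure_minimal (fun x hx => by_contra fun hn => hx (hz x hn)) isClosed_Icc
  refine ⟨fun x => ∫ t in a..x, h t, ?_, ?_, ?_, hderiv⟩
  · rw [contDiff_infty_iff_deriv, hderiv]
    exact ⟨fun x => (hd x).differentiableAt, h1⟩
  · exact HasCompactSupport.of_support_subset_isCompact isCompact_Icc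
      ((subset_tsupport _).trans hsub)
  · exact hsub.trans fun x hx => ⟨hα'.1.trans_le hx.1, hx.2.trans_lt hβ'.2⟩

/-- The lemma of du Bois-Reymond. -/
theorem ae_const_of_isWeakDeriv_zero (hab : a < b) [CompleteSpace E] {w : L2 a b E}
    (hw : IsWeakDeriv w 0) : ∃ c : E, w = constL2 c := by
  obtain ⟨ρ, r1, r2, r3, r4⟩ := exists_test hab
  -- The constant is the ρ-weighted mean c of w. For a test function g with integral m, the function
  -- g − mρ has integral zero, hence equals η' for a test function η, and ∫ η' w = 0 becomes ∫ g w =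
  -- m c.
  refine ⟨∫ x in Icc a b, ρ x • w x, sub_eq_zero.1 (Lp.ext ?_)⟩
  set c := ∫ x in Icc a b, ρ x • w x with hc
  refine (ae_zero_of_test (integrable_coe _) fun g g1 g2 g3 => ?_).trans (Lp.coeFn_zero E 2 _).symm
  set m := ∫ x in a..b, g x with hm
  have hsum : HasCompactSupport (fun x => g x - m * ρ x) := by
    have := g2.sub (r2.mul_left (f := fun _ => m))
    exact this
  have hsupp : tsupport (fun x => g x - m * ρ x) ⊆ Ioo a b := by
    refine (closure_minimal (t := tsupport g ∪ tsupport ρ) ?_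
      ((isClosed_tsupport g).union (isClosed_tsupport ρ))).trans (union_subset g3 r3)
    intro x hx
    by_contra hn
    rw [mem_union, not_or] at hn
    exact hx (by simp [image_eq_zero_of_notMem_tsupport hn.1, image_eq_zero_of_notMem_tsupport hn.2])
  have hcd : ContDiff ℝ ∞ (fun x => g x - m * ρ x) := g1.sub (contDiff_const.mul r1)
  obtain ⟨η, e1, e2, e3, e4⟩ := exists_antideriv hcd hsum hsupp (by
    rw [intervalIntegral.integral_sub (g1.continuous.intervalIntegrable _ _)
      ((r1.continuous.const_mul m).intervalIntegrable _ _),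
      intervalIntegral.integral_const_mul, r4, mul_one, ← hm, sub_self])
  have hη := hw η e1 e2 e3
  have hz : ∫ x in Icc a b, η x • (0 : L2 a b E) x = 0 := by
    rw [← integral_zero ℝ E (μ := vol a b)]
    refine integral_congr_ae ?_
    filter_upwards [Lp.coeFn_zero E 2 (vol a b)] with x hx
    rw [hx]; simp
  rw [e4, hz, neg_zero] at hη
  have ig := integrable_test_smul g1.continuous g2 w
  have ir := integrable_test_smul r1.continuous r2 w
  have h5 : ∫ x in Icc a b, g x • w x = m • c := by
    rw [hc, ← integral_smul, ← sub_eq_zero, ← integral_sub (g := fun x => m • ρ x • w x) ig (ir.smul m),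
      ← hη]
    congr 1; ext x
    rw [sub_smul, mul_smul]
  have h6 : ∫ x in Icc a b, g x • (w - constL2 c : L2 a b E) x
      = (∫ x in Icc a b, g x • w x) - ∫ x in Icc a b, g x • c := by
    rw [← integral_sub ig ((integrable_test g1.continuous).smul_const c)]
    refine integral_congr_ae ?_
    filter_upwards [Lp.coeFn_sub w (constL2 c), constL2_coeFn (a := a) (b := b) c] with x h1 h2
    rw [h1, Pi.sub_apply, h2, smul_sub]
  rw [h6, h5, integral_smul_const, ← integral_eq_integral_Icc hab.le, sub_self]

theorem IsWeakDeriv.sub {u u' v v' : L2 a b E} (hu : IsWeakDeriv u u') (hv : IsWeakDeriv v v') :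
    IsWeakDeriv (u - v) (u' - v') := by
  have := hu.add (hv.smul (-1))
  rwa [neg_one_smul, neg_one_smul, ← sub_eq_add_neg, ← sub_eq_add_neg] at this

/-- The difference of u and the primitive of v has weak derivative zero, so du Bois-Reymond's lemma
applies. -/
theorem IsWeakDeriv.exists_eq (hab : a < b) [CompleteSpace E] {u v : L2 a b E}
    (h : IsWeakDeriv u v) : ∃ c : E, u = constL2 c + volterra v := by
  have h2 := h.sub (isWeakDeriv_of_prim hab.le 0 v)
  rw [sub_self] at h2
  obtain ⟨c, hc⟩ := ae_const_of_isWeakDeriv_zero hab h2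
  exact ⟨c, by rw [← hc, map_zero, zero_add, sub_add_cancel]⟩

theorem traceAt_prim (hab : a < b) [CompleteSpace E] (c : E) (v : L2 a b E) {x : ℝ}
    (hx : x ∈ Icc a b) : traceAt (constL2 c + volterra v) x = c + ∫ θ in a..x, v θ := by
  refine traceAt_eq hab (g := fun x => c + ∫ θ in a..x, v θ)
    (continuousOn_const.add (continuousOn_prim (integrable_coe v))) ?_ hx
  filter_upwards [Lp.coeFn_add (constL2 c) (volterra v), constL2_coeFn (a := a) (b := b) c,
    volterra_coeFn v] with x h1 h2 h3
  rw [h1, Pi.add_apply, h2, h3]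

end weak

/-! ## Sobolev functions in terms of boundary values and highest derivatives -/

section sobolev

variable {a b : ℝ} {E : Type} [NormedAddCommGroup E] [NormedSpace ℝ E] [CompleteSpace E]

/-- `(c, v) ↦ c + ∫_a^x v`, with its derivative. -/
def primMk : E × L2 a b E →L[ℝ] L2 a b E × L2 a b E :=
  ((constL2 ∘L π₁) + volterra ∘L π₂).prod
    (π₂)

theorem primMk_apply (c : E) (v : L2 a b E) :
    primMk (c, v) = (constL2 c + volterra v, v) := rfl

/-- The boundary value at `a` of `(u, ∂u)`. -/
def bdry : L2 a b E × L2 a b E →L[ℝ] E :=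
  (b - a)⁻¹ • (primAt b ∘L (π₁ - volterra ∘L π₂))

/-- On H₁ the function u − ∫_a^x ∂u is the constant u(a), and `bdry` takes its mean. In this form
the boundary value is a bounded operator on all of L₂ × L₂, where point evaluation makes no sense.
-/
theorem bdry_primMk (hab : a < b) (c : E) (v : L2 a b E) : bdry (primMk (c, v)) = c := by
  have h : (b - a)⁻¹ • primAt b (constL2 c + volterra v - volterra v : L2 a b E) = c := by
    rw [add_sub_cancel_right, primAt_apply ⟨hab.le, le_rfl⟩,
      integral_congr_Icc (constL2_coeFn c) ⟨le_rfl, hab.le⟩ ⟨hab.le, le_rfl⟩,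
      intervalIntegral.integral_const, smul_smul, inv_mul_cancel₀ (sub_pos.2 hab).ne', one_smul]
  exact h

theorem eq_primMk (hab : a < b) {p : L2 a b E × L2 a b E} (h : IsWeakDeriv p.1 p.2) :
    p = primMk (bdry p, p.2) := by
  obtain ⟨c, hc⟩ := h.exists_eq hab
  have hp : p = primMk (c, p.2) := Prod.ext hc rfl
  rw [hp, bdry_primMk hab]; rfl

/-- This replaces the choice of a continuous representative by the restriction of a bounded
operator, which makes D_bc and Λ_bf bounded on U. -/
theorem traceAt_eq_bdry (hab : a < b) {p : L2 a b E × L2 a b E} (h : IsWeakDeriv p.1 p.2) {x : ℝ}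
    (hx : x ∈ Icc a b) : traceAt p.1 x = bdry p + primAt x p.2 := by
  conv_lhs => rw [eq_primMk hab h]
  rw [primMk_apply, traceAt_prim hab _ _ hx, primAt_apply hx]

/-- `(c, v) ↦ c + ∫_a^x v` with values in `H₁`. -/
def mkH1 (hab : a < b) : E × L2 a b E →L[ℝ] H1 a b E :=
  primMk.codRestrict (H1 a b E) fun p => isWeakDeriv_of_prim hab.le p.1 p.2

theorem mkH1_coe (hab : a < b) (p : E × L2 a b E) : (mkH1 hab p : L2 a b E × L2 a b E) = primMk p :=
  rfl

theorem H1.eq_mk (hab : a < b) (p : H1 a b E) : p = mkH1 hab (bdry p.1, p.1.2) :=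
  Subtype.ext (eq_primMk hab p.2)

/-- `(c, c', v) ↦ c + ∫_a^x (c' + ∫_a^y v)` with values in `H₂`. -/
def mkH2 (hab : a < b) : E × E × L2 a b E →L[ℝ] H2 a b E :=
  ((π₁ ∘L primMk ∘L (π₁).prod (π₁ ∘L primMk ∘L π₂)).prod (primMk ∘L π₂)).codRestrict (H2 a b E) fun _ =>
      ⟨isWeakDeriv_of_prim hab.le _ _, isWeakDeriv_of_prim hab.le _ _⟩

theorem mkH2_coe (hab : a < b) (c c' : E) (v : L2 a b E) :
    (mkH2 hab (c, c', v) : L2 a b E × L2 a b E × L2 a b E) =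
      (constL2 c + volterra (constL2 c' + volterra v), constL2 c' + volterra v, v) := rfl

theorem H2.eq_mk (hab : a < b) (p : H2 a b E) :
    p = mkH2 hab (bdry (p.1.1, p.1.2.1), bdry p.1.2, p.1.2.2) := by
  have h1 := eq_primMk hab (p := (p.1.1, p.1.2.1)) p.2.1
  have h2 := eq_primMk hab (p := p.1.2) p.2.2
  refine Subtype.ext (Prod.ext ?_ h2)
  rw [mkH2_coe]
  have h3 := congrArg Prod.fst h1
  have h4 := congrArg Prod.fst h2
  rw [primMk_apply] at h3 h4
  simp only at h3 h4 ⊢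
  rw [← h4]; exact h3

/-- Cauchy's formula for repeated integration, by exchanging the order on the triangle; it is the
origin of the kernel x − θ in `Lint`. -/
theorem integral_volterra (v : L2 a b E) {x : ℝ} (hx : x ∈ Icc a b) :
    ∫ θ in a..x, (volterra v : L2 a b E) θ = ∫ θ in a..x, (x - θ) • v θ := by
  have hax : a ∈ Icc a b := ⟨le_rfl, hx.1.trans hx.2⟩
  rw [integral_congr_Icc (volterra_coeFn v) hax hx]
  have hv : Integrable v (vol a x) :=
    IntegrableOn.mono_set (integrable_coe v) (Icc_subset_Icc_right hx.2)
  have := integral_triangle hx.1 (f := fun _ θ => v θ) (by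
    have := integrable_smul_prod (memLp_one.integrable (q := 1) le_rfl) hv
    simpa [Function.uncurry_def] using this)
  rw [this]
  simp only [intervalIntegral.integral_const]

theorem volterra_volterra (v : L2 a b E) :
    volterra (volterra v) =ᵐ[vol a b] fun x => ∫ θ in a..x, (x - θ) • v θ := by
  filter_upwards [ae_mem_Icc, volterra_coeFn (volterra v)] with x hx h
  rw [h, integral_volterra v hx]

end sobolev

/-! ### The space `U`: bounded traces and Taylor's formula -/

section state

variable {a b : ℝ} {n₁ n₂ n₃ : ℕ}

/-- `U` as a product. -/
def U.equivProd : U a b n₁ n₂ n₃ ≃L[ℝ]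
    ((Fin n₁ → L2 a b ℝ) × (Fin n₂ → H1 a b ℝ) × (Fin n₃ → H2 a b ℝ)) :=
  ContinuousLinearEquiv.refl ℝ ((Fin n₁ → L2 a b ℝ) × (Fin n₂ → H1 a b ℝ) × (Fin n₃ → H2 a b ℝ))

def U.comp₁ (i : Fin n₁) : U a b n₁ n₂ n₃ →L[ℝ] L2 a b ℝ :=
  ContinuousLinearMap.proj i ∘L π₁ ∘L U.equivProd.toContinuousLinearMap

def U.comp₂ (i : Fin n₂) : U a b n₁ n₂ n₃ →L[ℝ] L2 a b ℝ × L2 a b ℝ :=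
  (H1 a b ℝ).subtypeL ∘L ContinuousLinearMap.proj i ∘L π₁ ∘L
    π₂ ∘L U.equivProd.toContinuousLinearMap

def U.comp₃ (i : Fin n₃) : U a b n₁ n₂ n₃ →L[ℝ] L2 a b ℝ × L2 a b ℝ × L2 a b ℝ :=
  (H2 a b ℝ).subtypeL ∘L ContinuousLinearMap.proj i ∘L π₂ ∘L
    π₂ ∘L U.equivProd.toContinuousLinearMap

/-- `u ↦ (u₁, ∂u₂, ∂²u₃)`. -/
def U.fund : U a b n₁ n₂ n₃ →L[ℝ] (StateIdx n₁ n₂ n₃ → L2 a b ℝ) :=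
  ContinuousLinearMap.pi <| Sum.elim U.comp₁ <| Sum.elim (fun i => (π₂ ∘L U.comp₂ i))
    (fun i => π₂ ∘L π₂ ∘L U.comp₃ i)

/-- `U.toFun` as a bounded operator. -/
def U.toFunL : U a b n₁ n₂ n₃ →L[ℝ] (StateIdx n₁ n₂ n₃ → L2 a b ℝ) :=
  ContinuousLinearMap.pi <| Sum.elim U.comp₁ <| Sum.elim (fun i => π₁ ∘L U.comp₂ i)
    (fun i => π₁ ∘L U.comp₃ i)

/-- `D_int` as a bounded operator. -/
def DintL : U a b n₁ n₂ n₃ →L[ℝ] (IntIdx n₁ n₂ n₃ → L2 a b ℝ) :=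
  ContinuousLinearMap.pi <| Sum.elim U.comp₁ <| Sum.elim (fun i => π₁ ∘L U.comp₂ i) <|
    Sum.elim (fun i => π₁ ∘L U.comp₃ i) <| Sum.elim (fun i => (π₂ ∘L U.comp₂ i)) <|
    Sum.elim (fun i => (π₁ ∘L π₂ ∘L U.comp₃ i)) (fun i => π₂ ∘L π₂ ∘L U.comp₃ i)

theorem U.toFunL_apply (u : U a b n₁ n₂ n₃) : U.toFunL u = U.toFun u := by
  funext k; rcases k with k | k | k <;> rfl

theorem DintL_apply (u : U a b n₁ n₂ n₃) : DintL u = Dint u := by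
  funext k; rcases k with k | k | k | k | k | k <;> rfl

theorem Dint_stateToInt (u : U a b n₁ n₂ n₃) (k : StateIdx n₁ n₂ n₃) :
    Dint u (stateToInt k) = U.toFun u k := by
  rcases k with k | k | k <;> rfl

/-- Weak derivatives are unique, so the recorded derivatives carry no information beyond the
function itself. -/
theorem U.toFun_injective : Function.Injective (U.toFun : U a b n₁ n₂ n₃ → _) := by
  intro u v h
  have h1 : ∀ i, u.1 i = v.1 i := fun i => congrFun h (.inl i)
  have h2 : ∀ i, (u.2.1 i).1.1 = (v.2.1 i).1.1 := fun i => congrFun h (.inr (.inl i))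
  have h3 : ∀ i, (u.2.2 i).1.1 = (v.2.2 i).1.1 := fun i => congrFun h (.inr (.inr i))
  refine Prod.ext (funext h1) (Prod.ext (funext fun i => ?_) (funext fun i => ?_))
  · refine Subtype.ext (Prod.ext (h2 i) (IsWeakDeriv.unique (u.2.1 i).2 ?_))
    rw [h2 i]; exact (v.2.1 i).2
  · have h4 : (u.2.2 i).1.2.1 = (v.2.2 i).1.2.1 := IsWeakDeriv.unique (u.2.2 i).2.1 (by
      rw [h3 i]; exact (v.2.2 i).2.1)
    refine Subtype.ext (Prod.ext (h3 i) (Prod.ext h4 (IsWeakDeriv.unique (u.2.2 i).2.2 ?_)))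
    rw [h4]; exact (v.2.2 i).2.2

/-- `Δ^x D_bc` as a bounded operator. -/
def DbcL (x : ℝ) : U a b n₁ n₂ n₃ →L[ℝ] (CoreIdx n₂ n₃ → ℝ) :=
  ContinuousLinearMap.pi <|
    Sum.elim (fun i => (bdry + primAt x ∘L π₂) ∘L U.comp₂ i) <|
    Sum.elim (fun i => (bdry + primAt x ∘L π₂) ∘L
        (π₁ ∘L U.comp₃ i).prod (π₁ ∘L π₂ ∘L U.comp₃ i))
      (fun i => (bdry + primAt x ∘L π₂) ∘L (π₂ ∘L U.comp₃ i))

theorem DbcL_apply (hab : a < b) {x : ℝ} (hx : x ∈ Icc a b) (u : U a b n₁ n₂ n₃) :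
    DbcL x u = Dbc u x := by
  funext k
  rcases k with k | k | k
  · exact (traceAt_eq_bdry hab (p := (u.2.1 k).1) (u.2.1 k).2 hx).symm
  · exact (traceAt_eq_bdry hab (p := ((u.2.2 k).1.1, (u.2.2 k).1.2.1)) (u.2.2 k).2.1 hx).symm
  · exact (traceAt_eq_bdry hab (p := (u.2.2 k).1.2) (u.2.2 k).2.2 hx).symm

/-- `Λ_bf` as a bounded operator. -/
def LbfL : U a b n₁ n₂ n₃ →L[ℝ] (BfIdx n₂ n₃ → ℝ) :=
  ContinuousLinearMap.pi <| Sum.elim (fun k => ContinuousLinearMap.proj k ∘L DbcL a)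
    (fun k => ContinuousLinearMap.proj k ∘L DbcL b)

theorem LbfL_apply (hab : a < b) (u : U a b n₁ n₂ n₃) : LbfL u = Lbf u := by
  funext k
  rcases k with k | k
  · exact congrFun (DbcL_apply hab ⟨le_rfl, hab.le⟩ u) k
  · exact congrFun (DbcL_apply hab ⟨hab.le, le_rfl⟩ u) k

/-- The element of `U` with boundary values `D_bc u(a) = c` and `(u₁, ∂u₂, ∂²u₃) = v`. -/
def U.mk (hab : a < b) :
    (CoreIdx n₂ n₃ → ℝ) × (StateIdx n₁ n₂ n₃ → L2 a b ℝ) →L[ℝ] U a b n₁ n₂ n₃ :=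
  U.equivProd.symm.toContinuousLinearMap ∘L
    (ContinuousLinearMap.pi fun i =>
      ContinuousLinearMap.proj (.inl i) ∘L π₂).prod
    ((ContinuousLinearMap.pi fun i => mkH1 hab ∘L
      (ContinuousLinearMap.proj (.inl i) ∘L π₁).prod
      (ContinuousLinearMap.proj (.inr (.inl i)) ∘L π₂)).prod
    (ContinuousLinearMap.pi fun i => mkH2 hab ∘L
      (ContinuousLinearMap.proj (.inr (.inl i)) ∘L π₁).prod
      ((ContinuousLinearMap.proj (.inr (.inr i)) ∘L π₁).prod
      (ContinuousLinearMap.proj (.inr (.inr i)) ∘L π₂))))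

theorem U.fund_mk (hab : a < b) (c : CoreIdx n₂ n₃ → ℝ) (v : StateIdx n₁ n₂ n₃ → L2 a b ℝ) :
    U.fund (U.mk hab (c, v)) = v := by
  funext k; rcases k with k | k | k <;> rfl

theorem U.comp₂_mk (hab : a < b) (c : CoreIdx n₂ n₃ → ℝ) (v : StateIdx n₁ n₂ n₃ → L2 a b ℝ)
    (i : Fin n₂) : U.comp₂ i (U.mk hab (c, v)) = primMk (c (.inl i), v (.inr (.inl i))) := rfl

theorem U.comp₃_mk (hab : a < b) (c : CoreIdx n₂ n₃ → ℝ) (v : StateIdx n₁ n₂ n₃ → L2 a b ℝ)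
    (i : Fin n₃) : U.comp₃ i (U.mk hab (c, v)) =
      mkH2 hab (c (.inr (.inl i)), c (.inr (.inr i)), v (.inr (.inr i))) := rfl

theorem DbcL_inl (x : ℝ) (u : U a b n₁ n₂ n₃) (i : Fin n₂) :
    DbcL x u (.inl i) = bdry (U.comp₂ i u) + primAt x (U.comp₂ i u).2 := rfl

theorem DbcL_inr_inl (x : ℝ) (u : U a b n₁ n₂ n₃) (i : Fin n₃) :
    DbcL x u (.inr (.inl i)) = bdry ((U.comp₃ i u).1, (U.comp₃ i u).2.1) +
      primAt x (U.comp₃ i u).2.1 := rfl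

theorem DbcL_inr_inr (x : ℝ) (u : U a b n₁ n₂ n₃) (i : Fin n₃) :
    DbcL x u (.inr (.inr i)) = bdry (U.comp₃ i u).2 + primAt x (U.comp₃ i u).2.2 := rfl

theorem Dint_comp₂ (u : U a b n₁ n₂ n₃) (i : Fin n₂) :
    Dint u (.inr (.inl i)) = (U.comp₂ i u).1 := rfl

theorem Dint_comp₃ (u : U a b n₁ n₂ n₃) (i : Fin n₃) :
    Dint u (.inr (.inr (.inl i))) = (U.comp₃ i u).1 := rfl

theorem Dint_comp₃' (u : U a b n₁ n₂ n₃) (i : Fin n₃) :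
    Dint u (.inr (.inr (.inr (.inr (.inl i))))) = (U.comp₃ i u).2.1 := rfl

theorem U.mk_fund (hab : a < b) (u : U a b n₁ n₂ n₃) :
    U.mk hab (DbcL a u, U.fund u) = u := by
  -- At x = a the integral term of the trace is empty and only `bdry` remains.
  have e : ∀ p : L2 a b ℝ × L2 a b ℝ, bdry p + primAt a p.2 = bdry p := fun p => by
    rw [primAt_apply ⟨le_rfl, hab.le⟩, intervalIntegral.integral_same, add_zero]
  refine Prod.ext rfl (Prod.ext (funext fun i => ?_) (funext fun i => ?_))
  · refine Eq.trans ?_ (H1.eq_mk hab (u.2.1 i)).symm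
    exact congrArg (fun c => mkH1 hab (c, (u.2.1 i).1.2)) (e _)
  · refine Eq.trans ?_ (H2.eq_mk hab (u.2.2 i)).symm
    exact congrArg₂ (fun c c' => mkH2 hab (c, c', (u.2.2 i).1.2.2))
      (e ((u.2.2 i).1.1, (u.2.2 i).1.2.1)) (e _)

theorem integral_ite_zero (p : Prop) [Decidable p] (f : ℝ → ℝ) (c d : ℝ) :
    ∫ θ in c..d, (if p then f θ else 0) = if p then ∫ θ in c..d, f θ else 0 := by
  split_ifs <;> simp

/-- Taylor's formula at `a` with integral remainder, of first order for u₂ and ∂u₃ and of second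
order for u₃, where Cauchy's formula produces x − θ. -/
theorem Dint_mk (hab : a < b) (c : CoreIdx n₂ n₃ → ℝ) (v : StateIdx n₁ n₂ n₃ → L2 a b ℝ)
    (k : IntIdx n₁ n₂ n₃) :
    Dint (U.mk hab (c, v)) k =ᵐ[vol a b] fun x => (Kint a n₁ n₂ n₃ x *ᵥ c) k +
      ∑ l, (Rint n₁ n₂ n₃ k l * v l x + ∫ θ in a..x, Lint n₁ n₂ n₃ x θ k l * v l θ) := by
  rcases k with k | k | k | k | k | k
  · refine Filter.Eventually.of_forall fun x => ?_
    simp [Matrix.mulVec, dotProduct, Kint, Rint, Lint]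
    rfl
  · rw [Dint_comp₂, U.comp₂_mk, primMk_apply]
    filter_upwards [Lp.coeFn_add (constL2 (c (.inl k))) (volterra (v (.inr (.inl k)))),
      constL2_coeFn (a := a) (b := b) (c (.inl k)), volterra_coeFn (v (.inr (.inl k)))]
      with x h1 h2 h3
    rw [h1, Pi.add_apply, h2, h3]
    simp [Matrix.mulVec, dotProduct, Kint, Rint, Lint, integral_ite_zero]
  · rw [Dint_comp₃, U.comp₃_mk, mkH2_coe, map_add]
    filter_upwards [Lp.coeFn_add (constL2 (c (.inr (.inl k)))) (volterra (constL2 (c (.inr (.inr k))))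
        + volterra (volterra (v (.inr (.inr k))))),
      Lp.coeFn_add (volterra (constL2 (c (.inr (.inr k))))) (volterra (volterra (v (.inr (.inr k))))),
      constL2_coeFn (a := a) (b := b) (c (.inr (.inl k))), volterra_volterra (v (.inr (.inr k))),
      volterra_coeFn (constL2 (c (.inr (.inr k))) : L2 a b ℝ), ae_mem_Icc]
      with x h1 h2 h3 h4 h5 hx
    rw [h1, Pi.add_apply, h2, Pi.add_apply, h3, h4, h5,
      integral_congr_Icc (constL2_coeFn _) ⟨le_rfl, hab.le⟩ hx]
    simp [Matrix.mulVec, dotProduct, Kint, Rint, Lint, integral_ite_zero]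
    ring
  · refine Filter.Eventually.of_forall fun x => ?_
    simp [Matrix.mulVec, dotProduct, Kint, Rint, Lint]
    rfl
  · rw [Dint_comp₃', U.comp₃_mk, mkH2_coe]
    filter_upwards [Lp.coeFn_add (constL2 (c (.inr (.inr k)))) (volterra (v (.inr (.inr k)))),
      constL2_coeFn (a := a) (b := b) (c (.inr (.inr k))), volterra_coeFn (v (.inr (.inr k)))]
      with x h1 h2 h3
    rw [h1, Pi.add_apply, h2, h3]
    simp [Matrix.mulVec, dotProduct, Kint, Rint, Lint, integral_ite_zero]
  · refine Filter.Eventually.of_forall fun x => ?_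
    simp [Matrix.mulVec, dotProduct, Kint, Rint, Lint]
    rfl

/-- The components of D_bc u are continuous, so for them Taylor's formula holds at every point and
not only almost everywhere; the boundary conditions use it at `a` and `b`. -/
theorem DbcL_mk (hab : a < b) (c : CoreIdx n₂ n₃ → ℝ) (v : StateIdx n₁ n₂ n₃ → L2 a b ℝ)
    (k : CoreIdx n₂ n₃) {x : ℝ} (hx : x ∈ Icc a b) :
    DbcL x (U.mk hab (c, v)) k = (Kint a n₁ n₂ n₃ x *ᵥ c) (coreToInt k) +
      ∑ l, ∫ θ in a..x, Lint n₁ n₂ n₃ x θ (coreToInt k) l * v l θ := by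
  have hax : a ∈ Icc a b := ⟨le_rfl, hab.le⟩
  rcases k with k | k | k
  · rw [DbcL_inl, U.comp₂_mk, bdry_primMk hab, primAt_apply hx]
    simp [primMk_apply, Matrix.mulVec, dotProduct, Kint, Lint, coreToInt, integral_ite_zero]
  · rw [DbcL_inr_inl, U.comp₃_mk, mkH2_coe]
    dsimp only
    rw [← primMk_apply, bdry_primMk hab]
    rw [map_add, primAt_apply hx, primAt_apply hx, integral_volterra _ hx,
      integral_congr_Icc (constL2_coeFn _) hax hx]
    simp [Matrix.mulVec, dotProduct, Kint, Lint, coreToInt, integral_ite_zero]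
    ring
  · rw [DbcL_inr_inr, U.comp₃_mk, mkH2_coe]
    dsimp only
    rw [← primMk_apply, bdry_primMk hab, primAt_apply hx]
    simp [Matrix.mulVec, dotProduct, Kint, Lint, coreToInt, integral_ite_zero]

end state

/-! ## Boundary conditions -/

section kernel

variable {a b : ℝ} {n₁ n₂ n₃ : ℕ}

/-- The affine form separates x from θ. All measurability and integrability of Taylor kernels below
is reduced in this way to products of functions of one variable. -/
theorem Lint_affine (k : IntIdx n₁ n₂ n₃) (l : StateIdx n₁ n₂ n₃) :
    ∃ α β : ℝ, ∀ x θ, Lint n₁ n₂ n₃ x θ k l = α + β * (x - θ) := by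
  rcases k with k | k | k | k | k | k <;> rcases l with l | l | l <;>
    simp only [Lint, Matrix.of_apply]
  case inr.inl.inr.inl => exact ⟨if k = l then 1 else 0, 0, by simp⟩
  case inr.inr.inl.inr.inr => exact ⟨0, if k = l then 1 else 0, by simp⟩
  case inr.inr.inr.inr.inl.inr.inr => exact ⟨if k = l then 1 else 0, 0, by simp⟩
  all_goals exact ⟨0, 0, by simp⟩

theorem continuous_Kint (k : IntIdx n₁ n₂ n₃) (l : CoreIdx n₂ n₃) :
    Continuous fun x => Kint a n₁ n₂ n₃ x k l := by
  rcases k with k | k | k | k | k | k <;> rcases l with l | l | l <;>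
    simp only [Kint, Matrix.of_apply] <;> (try split_ifs) <;> fun_prop

theorem integrable_mul {f : ℝ → ℝ} (hf : MemLp f 2 (vol a b)) {g : ℝ → ℝ}
    (hg : MemLp g 2 (vol a b)) : Integrable (fun x => f x * g x) (vol a b) :=
  MemLp.integrable_mul hf hg

theorem integrable_continuous_mul {f : ℝ → ℝ} (hf : Continuous f) {g : ℝ → ℝ}
    (hg : Integrable g (vol a b)) : Integrable (fun x => f x * g x) (vol a b) :=
  IntegrableOn.continuousOn_mul hf.continuousOn hg isCompact_Icc

theorem memLp_Lint_integral {f : ℝ → ℝ} (hf : Integrable f (vol a b)) (k : IntIdx n₁ n₂ n₃)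
    (l : StateIdx n₁ n₂ n₃) {p : ℝ≥0∞} :
    MemLp (fun θ => ∫ x in θ..b, f x * Lint n₁ n₂ n₃ x θ k l) p (vol a b) := by
  obtain ⟨α, β, h⟩ := Lint_affine k l
  have h1 : Integrable (fun x => (α + β * x) * f x) (vol a b) :=
    integrable_continuous_mul (by fun_prop) hf
  -- Writing α + β(x − θ) as (α + βx) − βθ leaves two integrals over [θ, b] whose integrands do not
  -- involve θ, and these are continuous in θ.
  refine memLp_of_continuousOn (ContinuousOn.congr (f := fun θ =>
    (∫ x in θ..b, (α + β * x) * f x) - β * θ * ∫ x in θ..b, f x) ?_ ?_)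
  · exact (continuousOn_suffix h1).sub
      (ContinuousOn.mul (by fun_prop) (continuousOn_suffix hf))
  · intro θ hθ
    have hb : b ∈ Icc a b := ⟨hθ.1.trans hθ.2, le_rfl⟩
    simp only [h]
    rw [← intervalIntegral.integral_const_mul, ← intervalIntegral.integral_sub
      (intervalIntegrable_of_integrable h1 hθ hb)
      ((intervalIntegrable_of_integrable hf hθ hb).const_mul _)]
    congr 1; ext x; ring

theorem continuousOn_integral_Lint (v : L2 a b ℝ) (k : IntIdx n₁ n₂ n₃) (l : StateIdx n₁ n₂ n₃) :
    ContinuousOn (fun x => ∫ θ in a..x, Lint n₁ n₂ n₃ x θ k l * v θ) (Icc a b) := by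
  obtain ⟨α, β, h⟩ := Lint_affine k l
  have h1 : Integrable (fun x => (α - β * x) * v x) (vol a b) :=
    integrable_continuous_mul (by fun_prop) (integrable_coe v)
  refine ContinuousOn.congr (f := fun x =>
    (∫ θ in a..x, (α - β * θ) * v θ) + β * x * ∫ θ in a..x, v θ) ?_ ?_
  · exact (continuousOn_prim h1).add
      (ContinuousOn.mul (by fun_prop) (continuousOn_prim (integrable_coe v)))
  · intro x hx
    have ha : a ∈ Icc a b := ⟨le_rfl, hx.1.trans hx.2⟩
    simp only [h]
    rw [← intervalIntegral.integral_const_mul, ← intervalIntegral.integral_add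
      (intervalIntegrable_of_integrable h1 ha hx)
      ((intervalIntegrable_coe v ha hx).const_mul _)]
    congr 1; ext x; ring

/-- Fubini's theorem moves the Taylor kernel from v to the weight f. With f an entry of E_p this is
the source of the integral term in `BCs.ker`. -/
theorem integral_Lint_swap (hab : a ≤ b) {f : ℝ → ℝ} (hf : Integrable f (vol a b))
    (v : L2 a b ℝ) (k : IntIdx n₁ n₂ n₃) (l : StateIdx n₁ n₂ n₃) :
    ∫ x in a..b, f x * ∫ θ in a..x, Lint n₁ n₂ n₃ x θ k l * v θ =
      ∫ θ in a..b, (∫ x in θ..b, f x * Lint n₁ n₂ n₃ x θ k l) * v θ := by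
  obtain ⟨α, β, h⟩ := Lint_affine k l
  have h1 : Integrable (fun x => (α + β * x) * f x) (vol a b) :=
    integrable_continuous_mul (by fun_prop) hf
  have h2 : Integrable (fun x => (-β * x) * v x) (vol a b) :=
    integrable_continuous_mul (by fun_prop) (integrable_coe v)
  -- The integrand is (α + βx)f(x)·v(θ) + f(x)·(−βθ v(θ)), a sum of two products of integrable
  -- functions of one variable.
  have := integral_triangle hab (f := fun x θ => f x * (Lint n₁ n₂ n₃ x θ k l * v θ)) (by
    refine ((integrable_smul_prod h1 (integrable_coe v)).add (integrable_smul_prod hf h2)).congr ?_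
    refine Filter.Eventually.of_forall fun p => ?_
    simp only [Pi.add_apply, Function.uncurry_def, smul_eq_mul, h]
    ring)
  simp only [intervalIntegral.integral_const_mul] at this
  rw [this]
  congr 1; ext θ
  rw [← intervalIntegral.integral_mul_const]
  congr 1; ext x; ring

theorem integral_sum_add_sum {ι κ : Type} [Fintype ι] [Fintype κ] {f : ι → ℝ → ℝ}
    {g h : κ → ℝ → ℝ} (hf : ∀ i, IntervalIntegrable (f i) volume a b)
    (hg : ∀ k, IntervalIntegrable (g k) volume a b)
    (hh : ∀ k, IntervalIntegrable (h k) volume a b) :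
    ∫ x in a..b, ((∑ i, f i x) + ∑ k, (g k x + h k x)) =
      (∑ i, ∫ x in a..b, f i x) + ∑ k, ((∫ x in a..b, g k x) + ∫ x in a..b, h k x) := by
  have h1 : IntervalIntegrable (fun x => ∑ i, f i x) volume a b := by
    simpa only [Finset.sum_fn] using IntervalIntegrable.sum Finset.univ fun i _ => hf i
  have h2 : IntervalIntegrable (fun x => ∑ k, (g k x + h k x)) volume a b := by
    simpa only [Finset.sum_fn] using
      IntervalIntegrable.sum Finset.univ (f := fun k x => g k x + h k x) fun k _ => (hg k).add (hh k)
  rw [intervalIntegral.integral_add h1 h2, intervalIntegral.integral_finsetSum fun i _ => hf i,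
    intervalIntegral.integral_finsetSum fun k _ => (hg k).add (hh k)]
  congr 1
  exact Finset.sum_congr rfl fun k _ => intervalIntegral.integral_add (hg k) (hh k)

end kernel

/-! ### Boundary conditions in terms of c and v -/

section bc

variable {a b : ℝ} {n₁ n₂ n₃ nz : ℕ}

theorem Ep_mul_Lint_integral (E : BCs a b n₁ n₂ n₃ nz) (i : CoreIdx n₂ n₃)
    (l : StateIdx n₁ n₂ n₃) {θ : ℝ} (hθ : θ ∈ Icc a b) :
    ∫ x in θ..b, (E.Ep x * Lint n₁ n₂ n₃ x θ) i l =
      ∑ k, ∫ x in θ..b, E.Ep x i k * Lint n₁ n₂ n₃ x θ k l := by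
  simp only [Matrix.mul_apply]
  refine intervalIntegral.integral_finsetSum fun k _ => ?_
  obtain ⟨α, β, h⟩ := Lint_affine k l
  simp only [h]
  refine (intervalIntegrable_of_integrable (integrable_continuous_mul
    (f := fun x => α + β * (x - θ)) (by fun_prop)
    ((E.memLp_Ep i k).integrable (by norm_num))) hθ ⟨hθ.1.trans hθ.2, le_rfl⟩).congr ?_
  exact fun x _ => mul_comm (α + β * (x - θ)) (E.Ep x i k)

theorem BCs.ker_apply (E : BCs a b n₁ n₂ n₃ nz) (i : CoreIdx n₂ n₃) (l : StateIdx n₁ n₂ n₃)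
    {θ : ℝ} (hθ : θ ∈ Icc a b) :
    E.ker θ i l = (∑ m, E.Eb i (.inr m) * Lint n₁ n₂ n₃ b θ (coreToInt m) l) +
      (∑ k, E.Ep θ i k * Rint n₁ n₂ n₃ k l) +
      ∑ k, ∫ x in θ..b, E.Ep x i k * Lint n₁ n₂ n₃ x θ k l := by
  have h : E.ker θ i l = (∑ m, E.Eb i m * Matrix.fromRows (0 : Matrix (CoreIdx n₂ n₃) _ ℝ)
      ((Lint n₁ n₂ n₃ b θ).submatrix coreToInt id) m l) + (∑ k, E.Ep θ i k * Rint n₁ n₂ n₃ k l) +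
      ∫ x in θ..b, (E.Ep x * Lint n₁ n₂ n₃ x θ) i l := rfl
  rw [h, Ep_mul_Lint_integral E i l hθ, Fintype.sum_sum_type]
  simp

theorem continuous_Lint (k : IntIdx n₁ n₂ n₃) (l : StateIdx n₁ n₂ n₃) (x : ℝ) :
    Continuous fun θ => Lint n₁ n₂ n₃ x θ k l := by
  obtain ⟨α, β, h⟩ := Lint_affine k l
  simp only [h]; fun_prop

theorem BCs.memLp_ker (E : BCs a b n₁ n₂ n₃ nz) (i : CoreIdx n₂ n₃) (l : StateIdx n₁ n₂ n₃) :
    MemLp (fun θ => E.ker θ i l) 2 (vol a b) := by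
  have h : MemLp (fun θ => (∑ m, E.Eb i (.inr m) * Lint n₁ n₂ n₃ b θ (coreToInt m) l) +
      (∑ k, E.Ep θ i k * Rint n₁ n₂ n₃ k l) +
      ∑ k, ∫ x in θ..b, E.Ep x i k * Lint n₁ n₂ n₃ x θ k l) 2 (vol a b) := by
    refine MemLp.add (MemLp.add ?_ ?_) ?_
    · exact memLp_of_continuousOn (continuous_finsetSum _ fun m _ =>
        (continuous_Lint _ _ _).const_mul _).continuousOn
    · exact memLp_finsetSum _ fun k _ => (E.memLp_Ep i k).mul_const _
    · exact memLp_finsetSum _ fun k _ =>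
        memLp_Lint_integral ((E.memLp_Ep i k).integrable (by norm_num)) k l
  refine (memLp_congr_ae ?_).2 h
  filter_upwards [ae_mem_Icc] with θ hθ
  exact E.ker_apply i l hθ

/-- `v ↦ ∫ E.ker(θ) v(θ) dθ`. -/
def BCs.kerL (E : BCs a b n₁ n₂ n₃ nz) :
    (StateIdx n₁ n₂ n₃ → L2 a b ℝ) →L[ℝ] (CoreIdx n₂ n₃ → ℝ) :=
  ContinuousLinearMap.pi fun i => ∑ l, pairing (toL2 a b fun θ => E.ker θ i l) ∘L
    ContinuousLinearMap.proj l

theorem BCs.kerL_apply (hab : a ≤ b) (E : BCs a b n₁ n₂ n₃ nz) (v : StateIdx n₁ n₂ n₃ → L2 a b ℝ)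
    (i : CoreIdx n₂ n₃) : E.kerL v i = ∑ l, ∫ θ in a..b, E.ker θ i l * v l θ := by
  simp only [BCs.kerL, ContinuousLinearMap.coe_pi', sum_apply,
    ContinuousLinearMap.comp_apply, ContinuousLinearMap.proj_apply]
  refine Finset.sum_congr rfl fun l _ => ?_
  rw [pairing_toL2 (E.memLp_ker i l), integral_eq_integral_Icc hab]
  rfl

theorem integral_mul_Dint (hab : a < b) {f : ℝ → ℝ} (hf : MemLp f 2 (vol a b))
    (c : CoreIdx n₂ n₃ → ℝ) (v : StateIdx n₁ n₂ n₃ → L2 a b ℝ) (k : IntIdx n₁ n₂ n₃) :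
    ∫ x in a..b, f x * Dint (U.mk hab (c, v)) k x =
      (∑ m, (∫ x in a..b, f x * Kint a n₁ n₂ n₃ x k m) * c m) +
      ∑ l, (Rint n₁ n₂ n₃ k l * (∫ x in a..b, f x * v l x) +
        ∫ θ in a..b, (∫ x in θ..b, f x * Lint n₁ n₂ n₃ x θ k l) * v l θ) := by
  have ha : a ∈ Icc a b := ⟨le_rfl, hab.le⟩
  have hb : b ∈ Icc a b := ⟨hab.le, le_rfl⟩
  have hf1 : Integrable f (vol a b) := hf.integrable (by norm_num)
  have i1 : ∀ m, IntervalIntegrable (fun x => f x * Kint a n₁ n₂ n₃ x k m * c m) volume a b :=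
    fun m => ((intervalIntegrable_of_integrable (integrable_continuous_mul (continuous_Kint k m)
      hf1) ha hb).congr fun x _ =>
      mul_comm (Kint a n₁ n₂ n₃ x k m) (f x)).mul_const _
  have i2 : ∀ l, IntervalIntegrable (fun x => Rint n₁ n₂ n₃ k l * (f x * v l x)) volume a b :=
    fun l => (intervalIntegrable_of_integrable (integrable_mul hf (Lp.memLp (v l))) ha hb).const_mul _
  have i3 : ∀ l, IntervalIntegrable (fun x => f x * ∫ θ in a..x, Lint n₁ n₂ n₃ x θ k l * v l θ)
      volume a b := fun l => intervalIntegrable_of_integrable (integrable_mul hf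
        (memLp_of_continuousOn (continuousOn_integral_Lint (v l) k l))) ha hb
  have e : (fun x => f x * Dint (U.mk hab (c, v)) k x) =ᵐ[vol a b] fun x =>
      (∑ m, f x * Kint a n₁ n₂ n₃ x k m * c m) + ∑ l, (Rint n₁ n₂ n₃ k l * (f x * v l x) +
        f x * ∫ θ in a..x, Lint n₁ n₂ n₃ x θ k l * v l θ) := by
    filter_upwards [Dint_mk hab c v k] with x hx
    rw [hx, mul_add, Matrix.mulVec, dotProduct, Finset.mul_sum, Finset.mul_sum]
    congr 1
    · exact Finset.sum_congr rfl fun m _ => by ring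
    · exact Finset.sum_congr rfl fun m _ => by ring
  rw [integral_congr_Icc e ha hb, integral_sum_add_sum i1 i2 i3]
  congr 1
  · exact Finset.sum_congr rfl fun m _ => intervalIntegral.integral_mul_const _ _
  · refine Finset.sum_congr rfl fun l _ => ?_
    rw [intervalIntegral.integral_const_mul, integral_Lint_swap hab.le hf1]

theorem BCs.mat_apply (hab : a ≤ b) (E : BCs a b n₁ n₂ n₃ nz) (i m : CoreIdx n₂ n₃) :
    E.mat i m = (∑ p, E.Eb i (.inl p) * Kint a n₁ n₂ n₃ a (coreToInt p) m) +
      (∑ p, E.Eb i (.inr p) * Kint a n₁ n₂ n₃ b (coreToInt p) m) +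
      ∑ k, ∫ x in a..b, E.Ep x i k * Kint a n₁ n₂ n₃ x k m := by
  have h : E.mat i m = (∑ p, E.Eb i p * Matrix.fromRows ((Kint a n₁ n₂ n₃ a).submatrix coreToInt id)
      ((Kint a n₁ n₂ n₃ b).submatrix coreToInt id) p m) +
      ∫ x in a..b, ∑ k, E.Ep x i k * Kint a n₁ n₂ n₃ x k m := rfl
  rw [h, Fintype.sum_sum_type, intervalIntegral.integral_finsetSum fun k _ => ?_]
  · simp
  · exact (intervalIntegrable_of_integrable (integrable_continuous_mul (continuous_Kint k m)
      ((E.memLp_Ep i k).integrable (by norm_num))) ⟨le_rfl, hab⟩ ⟨hab, le_rfl⟩).congr fun x _ =>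
      mul_comm (Kint a n₁ n₂ n₃ x k m) (E.Ep x i k)

/-- Taylor's formula is inserted into D_int u and into the traces at `a` and `b`. The coefficients
of c add up to `E.mat`; those of v, after Fubini's theorem in the E_p term, add up to `E.ker`. The
trace at `a` has no v-part, whence the zero block in `BCs.ker`. -/
theorem bc_eq (hab : a < b) (E : BCs a b n₁ n₂ n₃ nz) (c : CoreIdx n₂ n₃ → ℝ)
    (v : StateIdx n₁ n₂ n₃ → L2 a b ℝ) (i : CoreIdx n₂ n₃) :
    (∑ k, ∫ x in a..b, E.Ep x i k * Dint (U.mk hab (c, v)) k x) +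
      (E.Eb *ᵥ Lbf (U.mk hab (c, v))) i = (E.mat *ᵥ c) i + E.kerL v i := by
  have ha : a ∈ Icc a b := ⟨le_rfl, hab.le⟩
  have hb : b ∈ Icc a b := ⟨hab.le, le_rfl⟩
  have hker : ∀ l, ∫ θ in a..b, E.ker θ i l * v l θ =
      (∑ m, E.Eb i (.inr m) * ∫ θ in a..b, Lint n₁ n₂ n₃ b θ (coreToInt m) l * v l θ) +
      ∑ k, (Rint n₁ n₂ n₃ k l * (∫ x in a..b, E.Ep x i k * v l x) +
        ∫ θ in a..b, (∫ x in θ..b, E.Ep x i k * Lint n₁ n₂ n₃ x θ k l) * v l θ) := by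
    intro l
    have i1 : ∀ m, IntervalIntegrable (fun θ => E.Eb i (.inr m) *
        (Lint n₁ n₂ n₃ b θ (coreToInt m) l * v l θ)) volume a b := fun m =>
      (intervalIntegrable_of_integrable (integrable_continuous_mul (continuous_Lint _ _ _)
        (integrable_coe (v l))) ha hb).const_mul _
    have i2 : ∀ k, IntervalIntegrable (fun θ => Rint n₁ n₂ n₃ k l * (E.Ep θ i k * v l θ))
        volume a b := fun k => (intervalIntegrable_of_integrable
          (integrable_mul (E.memLp_Ep i k) (Lp.memLp (v l))) ha hb).const_mul _
    have i3 : ∀ k, IntervalIntegrable (fun θ =>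
        (∫ x in θ..b, E.Ep x i k * Lint n₁ n₂ n₃ x θ k l) * v l θ) volume a b := fun k =>
      intervalIntegrable_of_integrable (integrable_mul (memLp_Lint_integral
        ((E.memLp_Ep i k).integrable (by norm_num)) k l) (Lp.memLp (v l))) ha hb
    have e : (fun θ => E.ker θ i l * v l θ) =ᵐ[vol a b] fun θ =>
        (∑ m, E.Eb i (.inr m) * (Lint n₁ n₂ n₃ b θ (coreToInt m) l * v l θ)) +
        ∑ k, (Rint n₁ n₂ n₃ k l * (E.Ep θ i k * v l θ) +
          (∫ x in θ..b, E.Ep x i k * Lint n₁ n₂ n₃ x θ k l) * v l θ) := by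
      filter_upwards [ae_mem_Icc] with θ hθ
      rw [E.ker_apply i l hθ, add_mul, add_mul, Finset.sum_mul, Finset.sum_mul, Finset.sum_mul,
        add_assoc, ← Finset.sum_add_distrib]
      congr 1
      · exact Finset.sum_congr rfl fun m _ => by ring
      · exact Finset.sum_congr rfl fun m _ => by ring
    rw [integral_congr_Icc e ha hb, integral_sum_add_sum i1 i2 i3]
    congr 1
    · exact Finset.sum_congr rfl fun m _ => intervalIntegral.integral_const_mul _ _
    · refine Finset.sum_congr rfl fun k _ => ?_
      rw [intervalIntegral.integral_const_mul]
  have hLbf : (E.Eb *ᵥ Lbf (U.mk hab (c, v))) i =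
      (∑ p, E.Eb i (.inl p) * ∑ m, Kint a n₁ n₂ n₃ a (coreToInt p) m * c m) +
      ((∑ p, E.Eb i (.inr p) * ∑ m, Kint a n₁ n₂ n₃ b (coreToInt p) m * c m) +
      ∑ p, E.Eb i (.inr p) * ∑ l, ∫ θ in a..b, Lint n₁ n₂ n₃ b θ (coreToInt p) l * v l θ) := by
    rw [Matrix.mulVec, dotProduct, Fintype.sum_sum_type]
    congr 1
    · refine Finset.sum_congr rfl fun p _ => ?_
      rw [Lbf, Sum.elim_inl, ← DbcL_apply hab ha, DbcL_mk hab c v p ha]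
      simp [Matrix.mulVec, dotProduct]
    · rw [← Finset.sum_add_distrib]
      refine Finset.sum_congr rfl fun p _ => ?_
      rw [Lbf, Sum.elim_inr, ← DbcL_apply hab hb, DbcL_mk hab c v p hb, mul_add]
      rfl
  rw [hLbf, E.kerL_apply hab.le, Finset.sum_congr rfl fun l _ => hker l,
    Finset.sum_congr rfl fun k _ => integral_mul_Dint hab (E.memLp_Ep i k) c v k,
    Finset.sum_add_distrib, Finset.sum_add_distrib, Matrix.mulVec, dotProduct,
    Finset.sum_congr rfl fun m _ => congrArg (· * c m) (E.mat_apply hab.le i m)]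
  -- All integrals are now evaluated; what is left is to exchange finite sums.
  have s1 : ∀ (x : CoreIdx n₂ n₃ → ℝ) (f : CoreIdx n₂ n₃ → CoreIdx n₂ n₃ → ℝ),
      ∑ p, x p * ∑ m, f p m * c m = ∑ m, (∑ p, x p * f p m) * c m := fun x f => by
    simp only [Finset.mul_sum, Finset.sum_mul]
    rw [Finset.sum_comm]
    exact Finset.sum_congr rfl fun _ _ => Finset.sum_congr rfl fun _ _ => by ring
  have s2 : ∑ k, ∑ m, (∫ x in a..b, E.Ep x i k * Kint a n₁ n₂ n₃ x k m) * c m =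
      ∑ m, (∑ k, ∫ x in a..b, E.Ep x i k * Kint a n₁ n₂ n₃ x k m) * c m := by
    rw [Finset.sum_comm]
    exact Finset.sum_congr rfl fun _ _ => (Finset.sum_mul _ _ _).symm
  rw [s1, s1, s2]
  simp only [add_mul, Finset.sum_add_distrib, Finset.mul_sum]
  rw [Finset.sum_comm (f := fun k l => Rint n₁ n₂ n₃ k l * _),
    Finset.sum_comm (f := fun k l => ∫ θ in a..b, (∫ x in θ..b, E.Ep x i k * Lint n₁ n₂ n₃ x θ k l) *
      v l θ), Finset.sum_comm (f := fun p l => E.Eb i (.inr p) * _)]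
  ring

end bc

/-! ## The operators `T` and `T_z` -/

section solution

variable {a b : ℝ} {n₁ n₂ n₃ nz : ℕ}

theorem DbcL_mk_left (hab : a < b) (c : CoreIdx n₂ n₃ → ℝ) (v : StateIdx n₁ n₂ n₃ → L2 a b ℝ) :
    DbcL a (U.mk hab (c, v)) = c := by
  funext k
  rw [DbcL_mk hab c v k ⟨le_rfl, hab.le⟩]
  rcases k with k | k | k <;> simp [Matrix.mulVec, dotProduct, Kint, coreToInt]

/-- Multiplication by a matrix. -/
def mulVecL {m n : Type} [Fintype m] [Fintype n] (M : Matrix m n ℝ) : (n → ℝ) →L[ℝ] (m → ℝ) :=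
  LinearMap.toContinuousLinearMap M.mulVecLin

theorem mulVecL_apply {m n : Type} [Fintype m] [Fintype n] (M : Matrix m n ℝ) (x : n → ℝ) :
    mulVecL M x = M *ᵥ x := rfl

/-- `v ↦ T v` with values in `U`. -/
def BCs.sol (E : BCs a b n₁ n₂ n₃ nz) (hab : a < b) :
    (StateIdx n₁ n₂ n₃ → L2 a b ℝ) →L[ℝ] U a b n₁ n₂ n₃ :=
  U.mk hab ∘L (-(mulVecL E.mat⁻¹ ∘L E.kerL)).prod (ContinuousLinearMap.id ℝ _)

/-- `ζ ↦ T_z ζ` with values in `U`. -/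
def BCs.solz (E : BCs a b n₁ n₂ n₃ nz) (hab : a < b) : (Fin nz → ℝ) →L[ℝ] U a b n₁ n₂ n₃ :=
  U.mk hab ∘L (-(mulVecL E.mat⁻¹ ∘L mulVecL E.Ez)).prod 0

theorem BCs.sol_apply (E : BCs a b n₁ n₂ n₃ nz) (hab : a < b)
    (v : StateIdx n₁ n₂ n₃ → L2 a b ℝ) :
    E.sol hab v = U.mk hab (-(E.mat⁻¹ *ᵥ E.kerL v), v) := rfl

theorem BCs.solz_apply (E : BCs a b n₁ n₂ n₃ nz) (hab : a < b) (ζ : Fin nz → ℝ) :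
    E.solz hab ζ = U.mk hab (-(E.mat⁻¹ *ᵥ (E.Ez *ᵥ ζ)), 0) := rfl

theorem BCs.fund_sol (E : BCs a b n₁ n₂ n₃ nz) (hab : a < b)
    (v : StateIdx n₁ n₂ n₃ → L2 a b ℝ) : U.fund (E.sol hab v) = v := U.fund_mk hab _ _

theorem BCs.fund_solz (E : BCs a b n₁ n₂ n₃ nz) (hab : a < b) (ζ : Fin nz → ℝ) :
    U.fund (E.solz hab ζ) = 0 := U.fund_mk hab _ _

theorem BCs.mem_X_iff_core (E : BCs a b n₁ n₂ n₃ nz) (hab : a < b) (c : CoreIdx n₂ n₃ → ℝ)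
    (v : StateIdx n₁ n₂ n₃ → L2 a b ℝ) (ζ : Fin nz → ℝ) :
    U.mk hab (c, v) ∈ E.X ζ ↔ E.mat *ᵥ c + (E.kerL v + E.Ez *ᵥ ζ) = 0 := by
  rw [funext_iff]
  refine forall_congr' fun i => ?_
  rw [bc_eq hab E c v i, Pi.add_apply, Pi.add_apply, add_assoc]
  rfl

/-- Solving M c + ∫ N v + E_z ζ = 0 for c determines u from v = 𝒟u and ζ. The constraint thus
becomes an explicit formula for u. -/
theorem BCs.mem_X_iff (E : BCs a b n₁ n₂ n₃ nz) (hE : E.WellPosed) (hab : a < b)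
    (u : U a b n₁ n₂ n₃) (ζ : Fin nz → ℝ) :
    u ∈ E.X ζ ↔ E.sol hab (U.fund u) + E.solz hab ζ = u := by
  have h1 : E.sol hab (U.fund u) + E.solz hab ζ =
      U.mk hab (-(E.mat⁻¹ *ᵥ (E.kerL (U.fund u) + E.Ez *ᵥ ζ)), U.fund u) := by
    rw [E.sol_apply, E.solz_apply, ← map_add, Prod.mk_add_mk, add_zero, ← neg_add,
      ← Matrix.mulVec_add]
  have h2 : u ∈ E.X ζ ↔ E.mat *ᵥ DbcL a u + (E.kerL (U.fund u) + E.Ez *ᵥ ζ) = 0 := by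
    rw [← E.mem_X_iff_core hab, U.mk_fund]
  rw [h1, h2]
  have hM := (Matrix.isUnit_iff_isUnit_det _).2 hE
  constructor
  · intro h
    have h3 : -(E.mat⁻¹ *ᵥ (E.kerL (U.fund u) + E.Ez *ᵥ ζ)) = DbcL a u := by
      rw [eq_neg_of_add_eq_zero_right h, Matrix.mulVec_neg, neg_neg, Matrix.mulVec_mulVec,
        Matrix.nonsing_inv_mul _ hE, Matrix.one_mulVec]
    rw [h3, U.mk_fund]
  · intro h
    -- The trace at `a` of both sides recovers c = −M⁻¹(∫ N v + E_z ζ).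
    have h3 := congrArg (DbcL a) h
    rw [DbcL_mk_left] at h3
    rw [← h3, Matrix.mulVec_neg, Matrix.mulVec_mulVec, Matrix.mul_nonsing_inv _ hE,
      Matrix.one_mulVec, neg_add_cancel]

theorem BCs.sol_add_solz_mem_X (E : BCs a b n₁ n₂ n₃ nz) (hE : E.WellPosed) (hab : a < b)
    (v : StateIdx n₁ n₂ n₃ → L2 a b ℝ) (ζ : Fin nz → ℝ) :
    E.sol hab v + E.solz hab ζ ∈ E.X ζ := by
  rw [E.mem_X_iff hE hab, map_add, E.fund_sol, E.fund_solz, add_zero]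

theorem BCs.coreInv_mulVec (E : BCs a b n₁ n₂ n₃ nz) (x : ℝ) (c : CoreIdx n₂ n₃ → ℝ)
    (i : StateIdx n₁ n₂ n₃) :
    (E.coreInv x *ᵥ c) i = (Kint a n₁ n₂ n₃ x *ᵥ (E.mat⁻¹ *ᵥ c)) (stateToInt i) := by
  have h : E.coreInv x *ᵥ c =
    ((Kint a n₁ n₂ n₃ x).submatrix stateToInt id * E.mat⁻¹ :
      Matrix (StateIdx n₁ n₂ n₃) (CoreIdx n₂ n₃) ℝ) *ᵥ c := rfl
  rw [h, ← Matrix.mulVec_mulVec]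
  rfl

/-- The term −K(x)M⁻¹ ∫_a^b N v is cut at θ = x to fit the 3-PI format. Its kernel therefore occurs
in both R₁ and R₂, and Taylor's kernel is added to R₁ alone. -/
theorem BCs.T_eq (E : BCs a b n₁ n₂ n₃ nz) (hab : a < b) (v : StateIdx n₁ n₂ n₃ → L2 a b ℝ) :
    E.T v = U.toFun (E.sol hab v) := by
  funext i
  rw [← Dint_stateToInt, E.sol_apply]
  refine toL2_eq ?_
  filter_upwards [Dint_mk hab (-(E.mat⁻¹ *ᵥ E.kerL v)) v (stateToInt i), ae_mem_Icc] with x h hx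
  have ha : a ∈ Icc a b := ⟨le_rfl, hab.le⟩
  have hb : b ∈ Icc a b := ⟨hab.le, le_rfl⟩
  rw [h, Matrix.mulVec_neg, Pi.neg_apply, ← E.coreInv_mulVec]
  have hmul : ∀ j θ, (E.coreInv x * E.ker θ) i j * v j θ =
      ∑ m, E.coreInv x i m * (E.ker θ m j * v j θ) := fun j θ => by
    rw [show (E.coreInv x * E.ker θ) i j = ∑ m, E.coreInv x i m * E.ker θ m j from rfl,
      Finset.sum_mul]
    exact Finset.sum_congr rfl fun m _ => by ring
  have i1 : ∀ j, Integrable (fun θ => (E.coreInv x * E.ker θ) i j * v j θ) (vol a b) := by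
    intro j
    simp only [hmul]
    exact integrable_finsetSum _ fun m _ =>
      (integrable_mul (E.memLp_ker m j) (Lp.memLp (v j))).const_mul _
  have i2 : ∀ j, Integrable (fun θ => Lint n₁ n₂ n₃ x θ (stateToInt i) j * v j θ) (vol a b) :=
    fun j => integrable_continuous_mul (continuous_Lint _ _ _) (integrable_coe (v j))
  have e : ∀ j, Rint n₁ n₂ n₃ (stateToInt i) j * v j x +
      (∫ θ in a..x, (Lint n₁ n₂ n₃ x θ (stateToInt i) j - (E.coreInv x * E.ker θ) i j) * v j θ) +
      (∫ θ in x..b, -(E.coreInv x * E.ker θ) i j * v j θ) =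
      (Rint n₁ n₂ n₃ (stateToInt i) j * v j x +
        ∫ θ in a..x, Lint n₁ n₂ n₃ x θ (stateToInt i) j * v j θ) -
      ∑ m, E.coreInv x i m * ∫ θ in a..b, E.ker θ m j * v j θ := by
    intro j
    have e1 : ∑ m, E.coreInv x i m * ∫ θ in a..b, E.ker θ m j * v j θ =
        ∫ θ in a..b, (E.coreInv x * E.ker θ) i j * v j θ := by
      simp only [hmul]
      rw [intervalIntegral.integral_finsetSum fun m _ => intervalIntegrable_of_integrable
        ((integrable_mul (E.memLp_ker m j) (Lp.memLp (v j))).const_mul _) ha hb]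
      exact Finset.sum_congr rfl fun m _ => (intervalIntegral.integral_const_mul _ _).symm
    rw [e1, ← intervalIntegral.integral_add_adjacent_intervals
      (intervalIntegrable_of_integrable (i1 j) ha hx) (intervalIntegrable_of_integrable (i1 j) hx hb)]
    simp only [sub_mul, neg_mul]
    rw [intervalIntegral.integral_sub (intervalIntegrable_of_integrable (i2 j) ha hx)
      (intervalIntegrable_of_integrable (i1 j) ha hx), intervalIntegral.integral_neg]
    ring
  refine (Finset.sum_congr rfl fun j _ => e j).trans ?_
  rw [Finset.sum_sub_distrib, neg_add_eq_sub]
  congr 1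
  rw [Finset.sum_comm, Matrix.mulVec, dotProduct]
  refine Finset.sum_congr rfl fun m _ => ?_
  rw [E.kerL_apply hab.le, Finset.mul_sum]

theorem BCs.Tz_eq (E : BCs a b n₁ n₂ n₃ nz) (hab : a < b) (ζ : Fin nz → ℝ) :
    E.Tz ζ = U.toFun (E.solz hab ζ) := by
  funext i
  rw [← Dint_stateToInt, E.solz_apply]
  refine toL2_eq ?_
  have hz : ∀ᵐ x ∂(vol a b), ((0 : StateIdx n₁ n₂ n₃ → L2 a b ℝ) i : L2 a b ℝ) x = 0 :=
    Lp.coeFn_zero ℝ 2 (vol a b)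
  filter_upwards [Dint_mk hab (-(E.mat⁻¹ *ᵥ (E.Ez *ᵥ ζ))) 0 (stateToInt i), ae_mem_Icc, hz]
    with x h hx hx0
  have h0 : ∀ l, ∫ θ in a..x, Lint n₁ n₂ n₃ x θ (stateToInt i) l *
      ((0 : StateIdx n₁ n₂ n₃ → L2 a b ℝ) l : L2 a b ℝ) θ = 0 := fun l => by
    rw [integral_congr_Icc (g := fun _ => 0) ?_ ⟨le_rfl, hab.le⟩ hx, intervalIntegral.integral_zero]
    filter_upwards [hz] with θ h
    rw [show ((0 : StateIdx n₁ n₂ n₃ → L2 a b ℝ) l : L2 a b ℝ) θ = 0 from h, mul_zero]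
  rw [h, Finset.sum_eq_zero fun l _ => ?_, add_zero, Matrix.mulVec_neg, Pi.neg_apply,
    ← E.coreInv_mulVec]
  · rw [show (-(E.coreInv x * E.Ez) *ᵥ ζ) = -((E.coreInv x * E.Ez :
      Matrix (StateIdx n₁ n₂ n₃) (Fin nz) ℝ) *ᵥ ζ) from Matrix.neg_mulVec _ _,
      ← Matrix.mulVec_mulVec]
    rfl
  · rw [h0, add_zero, show ((0 : StateIdx n₁ n₂ n₃ → L2 a b ℝ) l : L2 a b ℝ) x = 0 from hx0, mul_zero]

/-- Injectivity of `U.toFun` leaves a single candidate for the choice in `U.lift`. -/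
theorem U.lift_toFun (u : U a b n₁ n₂ n₃) : U.lift (U.toFun u) = u := by
  have h : ∃ u' : U a b n₁ n₂ n₃, U.toFun u' = U.toFun u := ⟨u, rfl⟩
  rw [U.lift, dif_pos h]
  exact U.toFun_injective h.choose_spec

/-- `(u, ζ) ↦ (D_int u, Λ_bf u, ζ)`. -/
def obs : U a b n₁ n₂ n₃ × (Fin nz → ℝ) →L[ℝ] Q a b n₁ n₂ n₃ nz :=
  (DintL ∘L π₁).prod ((LbfL ∘L π₁).prod π₂)

theorem obs_apply (hab : a < b) (u : U a b n₁ n₂ n₃) (ζ : Fin nz → ℝ) :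
    obs (u, ζ) = (Dint u, Lbf u, ζ) := by
  rw [← DintL_apply, ← LbfL_apply hab]; rfl

/-- From here on the choice-based `Tq` is a composition of bounded operators, so it is linear and
commutes with integrals in s. -/
theorem BCs.Tq_eq (E : BCs a b n₁ n₂ n₃ nz) (hab : a < b) (v : StateIdx n₁ n₂ n₃ → L2 a b ℝ) :
    E.Tq v = obs (E.sol hab v, 0) := by
  rw [obs_apply hab, BCs.Tq, E.T_eq hab, U.lift_toFun]

theorem BCs.Tqz_eq (E : BCs a b n₁ n₂ n₃ nz) (hab : a < b) (ζ : Fin nz → ℝ) :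
    E.Tqz ζ = obs (E.solz hab ζ, ζ) := by
  rw [obs_apply hab, BCs.Tqz, E.Tz_eq hab, U.lift_toFun]

/-- `U` is isomorphic to `ℝ^{n₂ + 2 n₃} × L₂`. -/
def U.equivCore (hab : a < b) : U a b n₁ n₂ n₃ ≃L[ℝ]
    (CoreIdx n₂ n₃ → ℝ) × (StateIdx n₁ n₂ n₃ → L2 a b ℝ) :=
  ContinuousLinearEquiv.equivOfInverse ((DbcL a).prod U.fund) (U.mk hab) (U.mk_fund hab)
    fun p => Prod.ext (DbcL_mk_left hab p.1 p.2) (U.fund_mk hab p.1 p.2)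

/-- Completeness is needed for Bochner integrals over s with values in U. For a < b it is
transported along `U.equivCore`; for b ≤ a the measure is zero and U is a single point, so the
instance needs no hypothesis. -/
instance : CompleteSpace (U a b n₁ n₂ n₃) := by
  rcases lt_or_ge a b with hab | hab
  · exact (completeSpace_congr (e := (U.equivCore (n₁ := n₁) (n₂ := n₂) (n₃ := n₃) hab).toEquiv)
      (U.equivCore hab).isUniformEmbedding).2
      inferInstance
  · have h0 : ae (vol a b) = ⊥ := by
      rw [ae_eq_bot, Measure.restrict_eq_zero, Real.volume_Icc, ENNReal.ofReal_eq_zero]; linarith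
    have hs : ∀ u v : L2 a b ℝ, u = v := fun u v => Lp.ext (by
      show {x | u x = v x} ∈ ae (vol a b)
      rw [h0]; trivial)
    have : Subsingleton (U a b n₁ n₂ n₃) := ⟨fun u v => U.toFun_injective (funext fun i => hs _ _)⟩
    infer_instance

end solution

/-! ## Delayed states -/

section delay

variable {a b : ℝ} {n₁ n₂ n₃ nz nw K : ℕ}

/-- Block `j` of the real components. -/
def blockReal (j : Fin K) :
    Z1 a b (Fin K × Fin nz) (Fin K × StateIdx n₁ n₂ n₃) →L[ℝ] (Fin nz → ℝ) :=
  ContinuousLinearMap.pi fun i => ContinuousLinearMap.proj (j, i) ∘L π₁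

/-- Block `j` of the distributed components. -/
def blockFun (j : Fin K) : Z1 a b (Fin K × Fin nz) (Fin K × StateIdx n₁ n₂ n₃) →L[ℝ]
    (StateIdx n₁ n₂ n₃ → L2 a b ℝ) :=
  ContinuousLinearMap.pi fun i => ContinuousLinearMap.proj (j, i) ∘L π₂

/-- The delayed values `(T ψ_u + T_z ψ_z, ψ_z)_j`. -/
def BCs.delayVal (E : BCs a b n₁ n₂ n₃ nz) (hab : a < b) :
    Z1 a b (Fin K × Fin nz) (Fin K × StateIdx n₁ n₂ n₃) →L[ℝ] DelayVal a b n₁ n₂ n₃ nz K :=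
  ContinuousLinearMap.pi fun j =>
    (E.sol hab ∘L blockFun j + E.solz hab ∘L blockReal j).prod (blockReal j)

theorem BCs.delayVal_apply (E : BCs a b n₁ n₂ n₃ nz) (hab : a < b)
    (p : Z1 a b (Fin K × Fin nz) (Fin K × StateIdx n₁ n₂ n₃)) (j : Fin K) :
    E.delayVal hab p j =
      (E.sol hab (blockFun j p) + E.solz hab (blockReal j p), blockReal j p) := rfl

/-- The underlying `L₂` functions of delayed values. -/
def delayFun : DelayVal a b n₁ n₂ n₃ nz K →L[ℝ]
    Z1 a b (Fin K × Fin nz) (Fin K × StateIdx n₁ n₂ n₃) :=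
  (ContinuousLinearMap.pi fun k => ContinuousLinearMap.proj k.2 ∘L π₂ ∘L
    ContinuousLinearMap.proj k.1).prod
  (ContinuousLinearMap.pi fun k => ContinuousLinearMap.proj k.2 ∘L U.toFunL ∘L π₁ ∘L
    ContinuousLinearMap.proj k.1)

theorem delayFun_apply (φ : DelayVal a b n₁ n₂ n₃ nz K) :
    delayFun φ = (fun k => (φ k.1).2 k.2, fun k => U.toFun (φ k.1).1 k.2) := by
  exact Prod.ext rfl (funext fun k => congrFun (U.toFunL_apply (φ k.1).1) k.2)

theorem delayFun_injective :
    Function.Injective (delayFun : DelayVal a b n₁ n₂ n₃ nz K →L[ℝ] _) := by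
  intro φ φ' h
  rw [delayFun_apply, delayFun_apply, Prod.mk.injEq] at h
  funext j
  refine Prod.ext (U.toFun_injective (funext fun i => ?_)) (funext fun i => ?_)
  · exact congrFun h.2 (j, i)
  · exact congrFun h.1 (j, i)

/-- The fundamental components of delayed values. -/
def delayFund : DelayVal a b n₁ n₂ n₃ nz K →L[ℝ]
    Z1 a b (Fin K × Fin nz) (Fin K × StateIdx n₁ n₂ n₃) :=
  (ContinuousLinearMap.pi fun k => ContinuousLinearMap.proj k.2 ∘L π₂ ∘L
    ContinuousLinearMap.proj k.1).prod
  (ContinuousLinearMap.pi fun k => ContinuousLinearMap.proj k.2 ∘L U.fund ∘L π₁ ∘L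
    ContinuousLinearMap.proj k.1)

theorem blockFun_delayFund (φ : DelayVal a b n₁ n₂ n₃ nz K) (j : Fin K) :
    blockFun j (delayFund φ) = U.fund (φ j).1 := rfl

theorem blockReal_delayFund (φ : DelayVal a b n₁ n₂ n₃ nz K) (j : Fin K) :
    blockReal j (delayFund φ) = (φ j).2 := rfl

theorem BCs.delayFund_delayVal (E : BCs a b n₁ n₂ n₃ nz) (hab : a < b)
    (p : Z1 a b (Fin K × Fin nz) (Fin K × StateIdx n₁ n₂ n₃)) :
    delayFund (E.delayVal hab p) = p := by
  have h : ∀ j, U.fund (E.delayVal hab p j).1 = blockFun j p := fun j => by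
    rw [E.delayVal_apply, map_add, E.fund_sol, E.fund_solz, add_zero]
  exact Prod.ext rfl (funext fun k => congrFun (h k.1) k.2)

/-- On arbitrary values `delayVal ∘ delayFund` is only a projection. The boundary conditions
describe the values that it fixes, by `BCs.mem_X_iff`. -/
theorem BCs.delayVal_delayFund (E : BCs a b n₁ n₂ n₃ nz) (hE : E.WellPosed) (hab : a < b)
    {φ : DelayVal a b n₁ n₂ n₃ nz K} (h : ∀ j, (φ j).1 ∈ E.X (φ j).2) :
    E.delayVal hab (delayFund φ) = φ := by
  funext j
  rw [E.delayVal_apply, blockFun_delayFund, blockReal_delayFund, (E.mem_X_iff hE hab _ _).1 (h j)]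

theorem BCs.delayMap_eq (E : BCs a b n₁ n₂ n₃ nz) (hab : a < b)
    (p : Z1 a b (Fin K × Fin nz) (Fin K × StateIdx n₁ n₂ n₃)) :
    E.delayMap p = delayFun (E.delayVal hab p) := by
  rw [delayFun_apply]
  refine Prod.ext rfl (funext fun k => ?_)
  show E.T (blockFun k.1 p) k.2 + E.Tz (blockReal k.1 p) k.2 =
    U.toFun (E.sol hab (blockFun k.1 p) + E.solz hab (blockReal k.1 p)) k.2
  rw [← U.toFunL_apply, map_add, U.toFunL_apply, U.toFunL_apply, ← E.T_eq, ← E.Tz_eq]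
  rfl

/-! ## The correspondence of states -/

/-- `𝒯` with values in `U × H₁`. -/
def BCs.lift𝒯 (E : BCs a b n₁ n₂ n₃ nz) (hab : a < b) :
    (StateIdx n₁ n₂ n₃ → L2 a b ℝ) × Psi a b n₁ n₂ n₃ nz K →L[ℝ]
      U a b n₁ n₂ n₃ × DelayState a b n₁ n₂ n₃ nz K :=
  (E.sol hab ∘L π₁).prod (mkH1 zero_lt_one ∘L
    (ContinuousLinearMap.pi fun _ => (E.sol hab ∘L π₁).prod 0).prod
      (mapL2 (E.delayVal hab) ∘L π₂))

/-- `𝒯_z` with values in `U × H₁`. -/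
def BCs.lift𝒯z (E : BCs a b n₁ n₂ n₃ nz) (hab : a < b) :
    (Fin nz → ℝ) →L[ℝ] U a b n₁ n₂ n₃ × DelayState a b n₁ n₂ n₃ nz K :=
  (E.solz hab).prod (mkH1 zero_lt_one ∘L
    (ContinuousLinearMap.pi fun _ => (E.solz hab).prod (ContinuousLinearMap.id ℝ _)).prod 0)

/-- All delays share the initial value φ_j(0) = (u, ζ). The input ζ enters φ only through it and not
through ∂_sφ. -/
theorem BCs.lift_eq (E : BCs a b n₁ n₂ n₃ nz) (hab : a < b)
    (x : (StateIdx n₁ n₂ n₃ → L2 a b ℝ) × Psi a b n₁ n₂ n₃ nz K) (ζ : Fin nz → ℝ) :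
    E.lift𝒯 hab x + E.lift𝒯z hab ζ = (E.sol hab x.1 + E.solz hab ζ,
      mkH1 zero_lt_one ((fun _ => (E.sol hab x.1 + E.solz hab ζ, ζ)),
        mapL2 (E.delayVal hab) x.2)) := by
  refine Prod.ext rfl ?_
  show mkH1 zero_lt_one _ + mkH1 zero_lt_one _ = _
  rw [← map_add]
  congr 1
  refine Prod.ext (funext fun j => Prod.ext rfl ?_) ?_
  · exact zero_add ζ
  · exact add_zero (mapL2 (E.delayVal hab) x.2)

/-- `(u, φ) ↦ (D u, D ∂_s φ)`. -/
def fundState : U a b n₁ n₂ n₃ × DelayState a b n₁ n₂ n₃ nz K →L[ℝ]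
    (StateIdx n₁ n₂ n₃ → L2 a b ℝ) × Psi a b n₁ n₂ n₃ nz K :=
  (U.fund ∘L π₁).prod (mapL2 delayFund ∘L π₂ ∘L (H1 0 1 _).subtypeL ∘L π₂)

theorem fundState_apply (y : U a b n₁ n₂ n₃ × DelayState a b n₁ n₂ n₃ nz K) :
    fundState y = (U.fund y.1, mapL2 delayFund y.2.1.2) := rfl

theorem mapL2_mapL2 {E F G : Type} [NormedAddCommGroup E] [NormedSpace ℝ E]
    [NormedAddCommGroup F] [NormedSpace ℝ F] [NormedAddCommGroup G] [NormedSpace ℝ G]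
    (L : F →L[ℝ] G) (M : E →L[ℝ] F) (u : L2 a b E) : mapL2 L (mapL2 M u) = mapL2 (L ∘L M) u := by
  refine Lp.ext ?_
  filter_upwards [mapL2_coeFn L (mapL2 M u), mapL2_coeFn M u, mapL2_coeFn (L ∘L M) u]
    with x h1 h2 h3
  rw [h1, h2, h3]; rfl

theorem mapL2_congr {E F : Type} [NormedAddCommGroup E] [NormedSpace ℝ E]
    [NormedAddCommGroup F] [NormedSpace ℝ F] {L : E →L[ℝ] F} {u : L2 a b E} {v : L2 a b F}
    (h : ∀ᵐ x ∂(vol a b), L (u x) = v x) : mapL2 L u = v :=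
  Lp.ext ((mapL2_coeFn L u).trans h)

/-- 𝒟Tv = v and 𝒟T_zζ = 0, so the PIE state is recovered without knowledge of ζ. As `fundState` is
bounded, it takes differentiable PDE trajectories to differentiable PIE trajectories. -/
theorem BCs.fundState_lift (E : BCs a b n₁ n₂ n₃ nz) (hab : a < b)
    (x : (StateIdx n₁ n₂ n₃ → L2 a b ℝ) × Psi a b n₁ n₂ n₃ nz K) (ζ : Fin nz → ℝ) :
    fundState (E.lift𝒯 hab x + E.lift𝒯z hab ζ) = x := by
  rw [E.lift_eq, fundState_apply, map_add, E.fund_sol, E.fund_solz, add_zero, mkH1_coe, primMk_apply,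
    mapL2_mapL2]
  refine Prod.ext rfl (mapL2_congr (Filter.Eventually.of_forall fun s => ?_))
  exact E.delayFund_delayVal hab _

/-- `toState` as a bounded operator. -/
def toStateL : U a b n₁ n₂ n₃ × DelayState a b n₁ n₂ n₃ nz K →L[ℝ]
    (StateIdx n₁ n₂ n₃ → L2 a b ℝ) × Psi a b n₁ n₂ n₃ nz K :=
  (U.toFunL ∘L π₁).prod (mapL2 delayFun ∘L π₁ ∘L (H1 0 1 _).subtypeL ∘L π₂)

theorem toStateL_apply (y : U a b n₁ n₂ n₃ × DelayState a b n₁ n₂ n₃ nz K) :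
    toStateL y = (U.toFun y.1, mapL2 delayFun y.2.1.1) := by
  rw [← U.toFunL_apply]; rfl

theorem toState_eq (y : U a b n₁ n₂ n₃ × DelayState a b n₁ n₂ n₃ nz K) :
    toState y = toStateL y := by
  rw [toStateL_apply, ← toL2_map, toState]
  simp only [delayFun_apply]

theorem mapL2_injective {E F : Type} [NormedAddCommGroup E] [NormedSpace ℝ E]
    [NormedAddCommGroup F] [NormedSpace ℝ F] {L : E →L[ℝ] F} (hL : Function.Injective L) :
    Function.Injective (mapL2 L : L2 a b E →L[ℝ] L2 a b F) := by
  intro u v h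
  refine Lp.ext ?_
  filter_upwards [mapL2_coeFn L u, mapL2_coeFn L v] with x h1 h2
  exact hL (by rw [← h1, ← h2, h])

theorem H1.ext {E : Type} [NormedAddCommGroup E] [NormedSpace ℝ E] [CompleteSpace E]
    {p q : H1 a b E} (h : p.1.1 = q.1.1) : p = q := by
  refine Subtype.ext (Prod.ext h (IsWeakDeriv.unique p.2 ?_))
  rw [h]; exact q.2

/-- The relation (∗) compares only L₂ functions. This upgrades it to an equality in the Sobolev
spaces. -/
theorem toState_injective :
    Function.Injective (toState : U a b n₁ n₂ n₃ × DelayState a b n₁ n₂ n₃ nz K → _) := by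
  intro y y' h
  rw [toState_eq, toState_eq, toStateL_apply, toStateL_apply, Prod.mk.injEq] at h
  exact Prod.ext (U.toFun_injective h.1) (H1.ext (mapL2_injective delayFun_injective h.2))

theorem pieTransport_T (E : BCs a b n₁ n₂ n₃ nz) (hab : a < b) (τ : Fin K → ℝ)
    (ψ : Psi a b n₁ n₂ n₃ nz K) :
    (pieTransport E τ).T ψ = volterra (mapL2 delayFun (mapL2 (E.delayVal hab) ψ)) := by
  refine toL2_congr ?_
  filter_upwards [ae_mem_Icc] with s hs
  refine integral_congr_Icc ?_ ⟨le_rfl, zero_le_one⟩ hs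
  filter_upwards [mapL2_coeFn (a := 0) (b := 1) delayFun (mapL2 (E.delayVal hab) ψ),
    mapL2_coeFn (a := 0) (b := 1) (E.delayVal hab) ψ] with θ e1 e2
  rw [e1, e2, E.delayMap_eq hab]

theorem pieTransport_Tw (E : BCs a b n₁ n₂ n₃ nz) (hab : a < b) (τ : Fin K → ℝ)
    (u : U a b n₁ n₂ n₃) (ζ : Fin nz → ℝ) :
    (pieTransport E τ).Tw (obs (u, ζ)) = constL2 (delayFun fun _ => (u, ζ)) := by
  rw [obs_apply hab]
  show (toL2 0 1 fun _ => ((fun k => ζ k.2, fun k => Dint u (stateToInt k.2)) :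
    Z1 a b (Fin K × Fin nz) (Fin K × StateIdx n₁ n₂ n₃))) = _
  rw [toL2_const, delayFun_apply]
  simp only [Dint_stateToInt]

/-- The interconnection operators 𝒯 and 𝒯_z factor through the Sobolev spaces. In the delay
component this is φ(s) = φ(0) + ∫_0^s ∂_sφ read in L₂. -/
theorem toState_lift (E : BCs a b n₁ n₂ n₃ nz) (hab : a < b) (G : Coeffs a b n₁ n₂ n₃ nz nw)
    (Gd : Fin K → Coeffs a b n₁ n₂ n₃ nz nw) (τ : Fin K → ℝ)
    (x : (StateIdx n₁ n₂ n₃ → L2 a b ℝ) × Psi a b n₁ n₂ n₃ nz K) (ζ : Fin nz → ℝ) :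
    toState (E.lift𝒯 hab x + E.lift𝒯z hab ζ) =
      (pieDPDE G Gd E τ).T x + (pieDPDE G Gd E τ).Tw ζ := by
  -- The zeros come from `Tr`: the derivative of r does not enter the PIE of the 1D PDE.
  have h1 : U.toFun (E.sol hab x.1 + E.solz hab ζ) =
      (E.T x.1 + 0 + 0) + (E.Tz ζ + 0) := by
    rw [← U.toFunL_apply, map_add, U.toFunL_apply, U.toFunL_apply, ← E.T_eq, ← E.Tz_eq]
    simp only [add_zero]
  have h4 : mapL2 delayFun (constL2 (fun _ : Fin K => (E.sol hab x.1 + E.solz hab ζ, ζ)) +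
      volterra (mapL2 (E.delayVal hab) x.2) : L2 0 1 (DelayVal a b n₁ n₂ n₃ nz K)) =
      ((pieTransport E τ).Tw (E.Tq x.1) + (pieTransport E τ).T x.2) +
        (pieTransport E τ).Tw (E.Tqz ζ) := by
    rw [E.Tq_eq hab, E.Tqz_eq hab, pieTransport_Tw E hab, pieTransport_Tw E hab,
      pieTransport_T E hab, map_add, mapL2_volterra, mapL2_const, add_right_comm, ← map_add,
      ← map_add]
    congr 4
    funext j
    exact Prod.ext rfl (zero_add ζ).symm
  rw [toState_eq, E.lift_eq, toStateL_apply]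
  exact Prod.ext h1 h4

end delay

/-! ## Equivalence of solutions -/

/-! ### The coefficients as bounded operators -/

section coeffs

variable {a b : ℝ} {n₁ n₂ n₃ nz nw K : ℕ}

/-- `ζ ↦ ∑ ζ_k f_k`. -/
def combL {n : Type} [Fintype n] (f : n → L2 a b ℝ) : (n → ℝ) →L[ℝ] L2 a b ℝ :=
  ∑ k, (ContinuousLinearMap.proj k : (n → ℝ) →L[ℝ] ℝ).smulRight (f k)

theorem combL_apply {n : Type} [Fintype n] (f : n → L2 a b ℝ) (ζ : n → ℝ) :
    combL f ζ = ∑ k, ζ k • f k := by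
  simp [combL]

theorem coeFn_finset_sum {ι : Type} (s : Finset ι) (f : ι → L2 a b ℝ) :
    (∑ k ∈ s, f k : L2 a b ℝ) =ᵐ[vol a b] fun x => ∑ k ∈ s, f k x := by
  classical
  induction s using Finset.induction_on with
  | empty =>
    simp only [Finset.sum_empty]
    exact Lp.coeFn_zero ℝ 2 (vol a b)
  | insert k s hk ih =>
    rw [Finset.sum_insert hk]
    filter_upwards [Lp.coeFn_add (f k) (∑ k ∈ s, f k), ih] with x h1 h2
    rw [h1, Pi.add_apply, h2, Finset.sum_insert hk]

theorem combL_coeFn {n : Type} [Fintype n] {f : n → ℝ → ℝ} (hf : ∀ k, MemLp (f k) 2 (vol a b))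
    (ζ : n → ℝ) :
    combL (fun k => toL2 a b (f k)) ζ =ᵐ[vol a b] fun x => ∑ k, f k x * ζ k := by
  rw [combL_apply]
  have h1 : ∀ᵐ x ∂(vol a b), ∀ k, (ζ k • toL2 a b (f k) : L2 a b ℝ) x = f k x * ζ k := by
    rw [ae_all_iff]
    intro k
    filter_upwards [Lp.coeFn_smul (ζ k) (toL2 a b (f k)), toL2_coeFn (hf k)] with x e1 e2
    rw [e1, Pi.smul_apply, e2, smul_eq_mul, mul_comm]
  filter_upwards [coeFn_finset_sum Finset.univ fun k => ζ k • toL2 a b (f k), h1] with x e1 e2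
  rw [e1]
  exact Finset.sum_congr rfl fun k _ => e2 k

/-- `Coeffs.dyn` as a bounded operator. -/
def Coeffs.dynL (G : Coeffs a b n₁ n₂ n₃ nz nw) :
    Q a b n₁ n₂ n₃ nz →L[ℝ] (StateIdx n₁ n₂ n₃ → L2 a b ℝ) :=
  ContinuousLinearMap.pi fun i =>
    (∑ k, mulL2 (fun x => G.Ap x i k) (G.memLp_Ap i k) ∘L ContinuousLinearMap.proj k) ∘L π₁ +
    (combL (fun k => toL2 a b fun x => G.Ab x i k) ∘L π₁ ∘L π₂ +
      combL (fun k => toL2 a b fun x => G.Bz x i k) ∘L π₂ ∘L π₂)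

theorem Coeffs.dynL_apply (G : Coeffs a b n₁ n₂ n₃ nz nw) (y : Q a b n₁ n₂ n₃ nz)
    (i : StateIdx n₁ n₂ n₃) : G.dynL y i =
      (∑ k, mulL2 (fun x => G.Ap x i k) (G.memLp_Ap i k) (y.1 k)) +
      (combL (fun k => toL2 a b fun x => G.Ab x i k) y.2.1 +
      combL (fun k => toL2 a b fun x => G.Bz x i k) y.2.2) := by
  simp [Coeffs.dynL]

/-- Since `dyn` is defined through `toL2`, its linearity is not evident. The identification shows
that the default value of `toL2` never occurs. -/
theorem Coeffs.dyn_eq (G : Coeffs a b n₁ n₂ n₃ nz nw) (y : Q a b n₁ n₂ n₃ nz) :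
    G.dyn y = G.dynL y := by
  funext i
  rw [G.dynL_apply]
  refine toL2_eq ?_
  have h1 : ∀ᵐ x ∂(vol a b), ∀ k, mulL2 (fun x => G.Ap x i k) (G.memLp_Ap i k) (y.1 k) x =
      G.Ap x i k * y.1 k x := by
    rw [ae_all_iff]; exact fun k => mulL2_coeFn _ _ _
  filter_upwards [h1, coeFn_finset_sum Finset.univ fun k =>
      mulL2 (fun x => G.Ap x i k) (G.memLp_Ap i k) (y.1 k),
    combL_coeFn (fun k => G.memLp_Ab i k) y.2.1, combL_coeFn (fun k => G.memLp_Bz i k) y.2.2,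
    Lp.coeFn_add (∑ k, mulL2 (fun x => G.Ap x i k) (G.memLp_Ap i k) (y.1 k))
      (combL (fun k => toL2 a b fun x => G.Ab x i k) y.2.1 +
      combL (fun k => toL2 a b fun x => G.Bz x i k) y.2.2),
    Lp.coeFn_add (combL (fun k => toL2 a b fun x => G.Ab x i k) y.2.1)
      (combL (fun k => toL2 a b fun x => G.Bz x i k) y.2.2)] with x e1 e2 e3 e4 e5 e6
  rw [e5, Pi.add_apply, e6, Pi.add_apply, e2, e3, e4, add_assoc]
  congr 1
  exact Finset.sum_congr rfl fun k _ => (e1 k).symm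

/-- `Coeffs.out` as a bounded operator. -/
def Coeffs.outL (G : Coeffs a b n₁ n₂ n₃ nz nw) : Q a b n₁ n₂ n₃ nz →L[ℝ] (Fin nw → ℝ) :=
  (ContinuousLinearMap.pi fun i =>
    ∑ k, pairing (toL2 a b fun x => G.Cwp x i k) ∘L ContinuousLinearMap.proj k) ∘L π₁ +
  (mulVecL G.Cwb ∘L π₁ ∘L π₂ + mulVecL G.Dwz ∘L π₂ ∘L π₂)

theorem Coeffs.out_eq (hab : a ≤ b) (G : Coeffs a b n₁ n₂ n₃ nz nw) (y : Q a b n₁ n₂ n₃ nz) :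
    G.out y = G.outL y := by
  funext i
  have h : G.outL y i = (∑ k, pairing (toL2 a b fun x => G.Cwp x i k) (y.1 k)) +
      ((G.Cwb *ᵥ y.2.1) i + (G.Dwz *ᵥ y.2.2) i) := by
    simp [Coeffs.outL, mulVecL_apply]
  rw [h, ← add_assoc, Coeffs.out]
  congr 2
  refine Finset.sum_congr rfl fun k _ => ?_
  rw [pairing_toL2 (G.memLp_Cwp i k), integral_eq_integral_Icc hab]
  rfl

end coeffs

/-! ### The interconnected equations on lifted states -/

section solutions

variable {a b : ℝ} {n₁ n₂ n₃ nz nw K : ℕ}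

theorem BCs.Tq_add_Tqz (E : BCs a b n₁ n₂ n₃ nz) (hab : a < b)
    (v : StateIdx n₁ n₂ n₃ → L2 a b ℝ) (ζ : Fin nz → ℝ) :
    E.Tq v + E.Tqz ζ = obs (E.sol hab v + E.solz hab ζ, ζ) := by
  rw [E.Tq_eq hab, E.Tqz_eq hab, ← map_add, Prod.mk_add_mk, zero_add]

/-- The output of the transport equations in terms of the delayed values. -/
theorem pieTransport_C (E : BCs a b n₁ n₂ n₃ nz) (hab : a < b) (τ : Fin K → ℝ)
    (ψ : Psi a b n₁ n₂ n₃ nz K) (j : Fin K) :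
    (pieTransport E τ).C ψ j =
      obs ((∫ s in (0 : ℝ)..1, (mapL2 (E.delayVal hab) ψ : L2 0 1 _) s) j) := by
  have h := (obs ∘L ContinuousLinearMap.proj j :
    DelayVal a b n₁ n₂ n₃ nz K →L[ℝ] Q a b n₁ n₂ n₃ nz).intervalIntegral_comp_comm
    (intervalIntegrable_coe (mapL2 (E.delayVal hab) ψ) (left_mem_Icc.2 zero_le_one)
      (right_mem_Icc.2 zero_le_one))
  refine Eq.trans ?_ h
  refine integral_congr_Icc (a := 0) (b := 1) ?_ (left_mem_Icc.2 zero_le_one)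
    (right_mem_Icc.2 zero_le_one)
  filter_upwards [mapL2_coeFn (a := 0) (b := 1) (E.delayVal hab) ψ] with s hs
  rw [hs, E.Tq_add_Tqz hab]
  rfl

/-- Multiplication of block `j` by `-1/τ_j`. -/
def scaleL (τ : Fin K → ℝ) : DelayVal a b n₁ n₂ n₃ nz K →L[ℝ] DelayVal a b n₁ n₂ n₃ nz K :=
  ContinuousLinearMap.pi fun j => (-(1 / τ j)) • ContinuousLinearMap.proj j

theorem pieTransport_A (E : BCs a b n₁ n₂ n₃ nz) (hab : a < b) (τ : Fin K → ℝ)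
    (ψ : Psi a b n₁ n₂ n₃ nz K) :
    (pieTransport E τ).A ψ = mapL2 delayFun (mapL2 (scaleL τ) (mapL2 (E.delayVal hab) ψ)) := by
  refine toL2_eq ?_
  filter_upwards [mapL2_coeFn (a := 0) (b := 1) delayFun
      (mapL2 (scaleL τ) (mapL2 (E.delayVal hab) ψ)),
    mapL2_coeFn (a := 0) (b := 1) (scaleL τ) (mapL2 (E.delayVal hab) ψ),
    mapL2_coeFn (a := 0) (b := 1) (E.delayVal hab) ψ] with s h1 h2 h3
  rw [h1, h2, h3, E.delayMap_eq hab]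
  refine Prod.ext rfl (funext fun k => ?_)
  exact (congrFun (U.toFunL.map_smul (-(1 / τ k.1)) (E.delayVal hab (ψ s) k.1).1) k.2).symm

theorem BCs.traceAt_lift (E : BCs a b n₁ n₂ n₃ nz) (hab : a < b)
    (x : (StateIdx n₁ n₂ n₃ → L2 a b ℝ) × Psi a b n₁ n₂ n₃ nz K) (ζ : Fin nz → ℝ) {s : ℝ}
    (hs : s ∈ Icc (0 : ℝ) 1) :
    traceAt (E.lift𝒯 hab x + E.lift𝒯z hab ζ).2.1.1 s =
      (fun _ => (E.sol hab x.1 + E.solz hab ζ, ζ)) +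
        ∫ θ in (0 : ℝ)..s, (mapL2 (E.delayVal hab) x.2 : L2 0 1 _) θ := by
  rw [E.lift_eq hab x ζ, mkH1_coe, primMk_apply]
  exact traceAt_prim zero_lt_one _ _ hs

/-- Since `delayVal` commutes with ∫_0^s, the value φ_u(s) equals T(v + ∫_0^s ψ_u) + T_z(ζ + ∫_0^s
ψ_z), while φ_z(s) = ζ + ∫_0^s ψ_z. -/
theorem BCs.traceAt_lift_mem_X (E : BCs a b n₁ n₂ n₃ nz) (hE : E.WellPosed) (hab : a < b)
    (x : (StateIdx n₁ n₂ n₃ → L2 a b ℝ) × Psi a b n₁ n₂ n₃ nz K) (ζ : Fin nz → ℝ) {s : ℝ}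
    (hs : s ∈ Icc (0 : ℝ) 1) (j : Fin K) :
    (traceAt (E.lift𝒯 hab x + E.lift𝒯z hab ζ).2.1.1 s j).1 ∈
      E.X (traceAt (E.lift𝒯 hab x + E.lift𝒯z hab ζ).2.1.1 s j).2 := by
  have h0 : (0 : ℝ) ∈ Icc (0 : ℝ) 1 := left_mem_Icc.2 zero_le_one
  rw [E.traceAt_lift hab x ζ hs, integral_congr_Icc (mapL2_coeFn _ _) h0 hs,
    (E.delayVal hab).intervalIntegral_comp_comm (intervalIntegrable_coe x.2 h0 hs)]
  generalize ∫ θ in (0 : ℝ)..s, x.2 θ = p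
  show E.sol hab x.1 + E.solz hab ζ + (E.sol hab (blockFun j p) + E.solz hab (blockReal j p)) ∈
    E.X (ζ + blockReal j p)
  rw [add_add_add_comm, ← map_add, ← map_add]
  exact E.sol_add_solz_mem_X hE hab _ _

theorem BCs.lift_mem_X (E : BCs a b n₁ n₂ n₃ nz) (hE : E.WellPosed) (hab : a < b)
    (x : (StateIdx n₁ n₂ n₃ → L2 a b ℝ) × Psi a b n₁ n₂ n₃ nz K) (ζ : Fin nz → ℝ) :
    (E.lift𝒯 hab x + E.lift𝒯z hab ζ).1 ∈ E.X ζ := E.sol_add_solz_mem_X hE hab x.1 ζ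

theorem BCs.lift_mem_Y (E : BCs a b n₁ n₂ n₃ nz) (hE : E.WellPosed) (hab : a < b)
    (x : (StateIdx n₁ n₂ n₃ → L2 a b ℝ) × Psi a b n₁ n₂ n₃ nz K) (ζ : Fin nz → ℝ) :
    (E.lift𝒯 hab x + E.lift𝒯z hab ζ).2 ∈ E.Y K (Dint (E.lift𝒯 hab x + E.lift𝒯z hab ζ).1,
      Lbf (E.lift𝒯 hab x + E.lift𝒯z hab ζ).1, ζ) := by
  intro j
  refine ⟨?_, ?_, fun s hs => E.traceAt_lift_mem_X hE hab x ζ hs j⟩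
  · rw [E.traceAt_lift hab x ζ (left_mem_Icc.2 zero_le_one), intervalIntegral.integral_same, add_zero]
    funext i
    exact (Dint_stateToInt _ i).symm
  · rw [E.traceAt_lift hab x ζ (left_mem_Icc.2 zero_le_one), intervalIntegral.integral_same, add_zero]

theorem BCs.lift_deriv (E : BCs a b n₁ n₂ n₃ nz) (hab : a < b)
    (x : (StateIdx n₁ n₂ n₃ → L2 a b ℝ) × Psi a b n₁ n₂ n₃ nz K) (ζ : Fin nz → ℝ) :
    (E.lift𝒯 hab x + E.lift𝒯z hab ζ).2.1.2 = mapL2 (E.delayVal hab) x.2 := by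
  rw [E.lift_eq]; rfl

/-- The delayed values `φ(1)`. -/
def endVal (φ : DelayState a b n₁ n₂ n₃ nz K) : DelayVal a b n₁ n₂ n₃ nz K := traceAt φ.1.1 1

/-- The delayed input of the 1D PDE. -/
theorem obs_traceAt_lift (E : BCs a b n₁ n₂ n₃ nz) (hab : a < b) (τ : Fin K → ℝ)
    (x : (StateIdx n₁ n₂ n₃ → L2 a b ℝ) × Psi a b n₁ n₂ n₃ nz K) (ζ : Fin nz → ℝ) (j : Fin K) :
    obs (endVal (E.lift𝒯 hab x + E.lift𝒯z hab ζ).2 j) =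
      E.Tq x.1 + (pieTransport E τ).C x.2 j + E.Tqz ζ := by
  rw [endVal, E.traceAt_lift hab x ζ (right_mem_Icc.2 zero_le_one), add_right_comm, E.Tq_add_Tqz hab,
    pieTransport_C E hab, ← map_add]
  rfl

/-- Linearity collects the feedback terms of x and ζ into q + ∫_0^1 (…) = r_j, which by
`obs_traceAt_lift` is the observation of the lifted state at s = 1. -/
theorem pieDPDE_rhs (G : Coeffs a b n₁ n₂ n₃ nz nw) (Gd : Fin K → Coeffs a b n₁ n₂ n₃ nz nw)
    (E : BCs a b n₁ n₂ n₃ nz) (hab : a < b) (τ : Fin K → ℝ)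
    (x : (StateIdx n₁ n₂ n₃ → L2 a b ℝ) × Psi a b n₁ n₂ n₃ nz K) (ζ : Fin nz → ℝ) :
    (pieDPDE G Gd E τ).A x + (pieDPDE G Gd E τ).B ζ =
      (G.dyn (obs ((E.lift𝒯 hab x + E.lift𝒯z hab ζ).1, ζ)) +
          ∑ j, (Gd j).dyn (obs (endVal (E.lift𝒯 hab x + E.lift𝒯z hab ζ).2 j)),
        mapL2 delayFun (mapL2 (scaleL τ) (E.lift𝒯 hab x + E.lift𝒯z hab ζ).2.1.2)) := by
  -- The zeros in the second component come from the input operator B of the transport PIE, which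
  -- vanishes.
  have e : (pieDPDE G Gd E τ).A x + (pieDPDE G Gd E τ).B ζ =
    ((G.dyn (E.Tq x.1) + (∑ j, (Gd j).dyn (E.Tq x.1)) +
      (∑ j, (Gd j).dyn ((pieTransport E τ).C x.2 j))) +
      (G.dyn (E.Tqz ζ) + ∑ j, (Gd j).dyn (E.Tqz ζ)), (0 + (pieTransport E τ).A x.2) + 0) := rfl
  have e2 : (E.lift𝒯 hab x + E.lift𝒯z (K := K) hab ζ).1 = E.sol hab x.1 + E.solz hab ζ := rfl
  rw [e, E.lift_deriv hab x ζ, ← pieTransport_A E hab, e2, ← E.Tq_add_Tqz hab, zero_add, add_zero]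
  congr 1
  simp only [obs_traceAt_lift E hab τ, Coeffs.dyn_eq, map_add, Finset.sum_add_distrib]
  abel

/-- The left side of the PIE is the L₂ function of the lift of (x', ζ'). Injectivity of `delayFun`
then removes the passage to L₂ functions in the delay component, so that the transport equation
holds in U × ℝ^{n_z} for almost every s. -/
theorem pieDPDE_eq_iff (G : Coeffs a b n₁ n₂ n₃ nz nw) (Gd : Fin K → Coeffs a b n₁ n₂ n₃ nz nw)
    (E : BCs a b n₁ n₂ n₃ nz) (hab : a < b) (τ : Fin K → ℝ)
    (x x' : (StateIdx n₁ n₂ n₃ → L2 a b ℝ) × Psi a b n₁ n₂ n₃ nz K) (ζ ζ' : Fin nz → ℝ) :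
    (pieDPDE G Gd E τ).Tw ζ' + (pieDPDE G Gd E τ).T x' =
        (pieDPDE G Gd E τ).A x + (pieDPDE G Gd E τ).B ζ ↔
      U.toFun (E.lift𝒯 hab x' + E.lift𝒯z hab ζ').1 =
        G.dyn (obs ((E.lift𝒯 hab x + E.lift𝒯z hab ζ).1, ζ)) +
          ∑ j, (Gd j).dyn (obs (endVal (E.lift𝒯 hab x + E.lift𝒯z hab ζ).2 j)) ∧
      ∀ᵐ s ∂(vol 0 1), ∀ j, (E.lift𝒯 hab x' + E.lift𝒯z hab ζ').2.1.1 s j =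
        -(1 / τ j) • (E.lift𝒯 hab x + E.lift𝒯z hab ζ).2.1.2 s j := by
  rw [add_comm, ← toState_lift E hab, pieDPDE_rhs G Gd E hab, toState_eq, toStateL_apply, Prod.mk.injEq,
    (mapL2_injective delayFun_injective).eq_iff]
  refine and_congr_right fun _ => ?_
  have hs := mapL2_coeFn (a := 0) (b := 1) (scaleL τ) (E.lift𝒯 hab x + E.lift𝒯z hab ζ).2.1.2
  constructor
  · intro h
    rw [h]
    filter_upwards [hs] with s h1 j
    rw [h1]; rfl
  · intro h
    refine Lp.ext ?_
    filter_upwards [hs, h] with s h1 h2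
    rw [h1]
    exact funext h2

theorem pieDPDE_out (G : Coeffs a b n₁ n₂ n₃ nz nw) (Gd : Fin K → Coeffs a b n₁ n₂ n₃ nz nw)
    (E : BCs a b n₁ n₂ n₃ nz) (hab : a < b) (τ : Fin K → ℝ)
    (x : (StateIdx n₁ n₂ n₃ → L2 a b ℝ) × Psi a b n₁ n₂ n₃ nz K) (ζ : Fin nz → ℝ) :
    (pieDPDE G Gd E τ).C x + (pieDPDE G Gd E τ).D ζ =
      G.out (obs ((E.lift𝒯 hab x + E.lift𝒯z hab ζ).1, ζ)) +
        ∑ j, (Gd j).out (obs (endVal (E.lift𝒯 hab x + E.lift𝒯z hab ζ).2 j)) := by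
  have e : (pieDPDE G Gd E τ).C x + (pieDPDE G Gd E τ).D ζ =
      (G.out (E.Tq x.1) + (∑ j, (Gd j).out (E.Tq x.1)) +
        (∑ j, (Gd j).out ((pieTransport E τ).C x.2 j))) +
        (G.out (E.Tqz ζ) + ∑ j, (Gd j).out (E.Tqz ζ)) := rfl
  have e2 : (E.lift𝒯 hab x + E.lift𝒯z hab ζ).1 = E.sol hab x.1 + E.solz hab ζ := rfl
  rw [e, e2, ← E.Tq_add_Tqz hab]
  simp only [obs_traceAt_lift E hab τ, Coeffs.out_eq hab.le, map_add, Finset.sum_add_distrib]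
  abel

end solutions

/-! ### Transfer of solutions in both directions -/

section equivalence

variable {a b : ℝ} {n₁ n₂ n₃ nz nw K : ℕ} {G : Coeffs a b n₁ n₂ n₃ nz nw}
  {Gd : Fin K → Coeffs a b n₁ n₂ n₃ nz nw} {E : BCs a b n₁ n₂ n₃ nz} {τ : Fin K → ℝ}
  {z : ℝ → Fin nz → ℝ}
  {x : ℝ → (StateIdx n₁ n₂ n₃ → L2 a b ℝ) × Psi a b n₁ n₂ n₃ nz K}
  {x₀ : (StateIdx n₁ n₂ n₃ → L2 a b ℝ) × Psi a b n₁ n₂ n₃ nz K}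
  {y : ℝ → U a b n₁ n₂ n₃ × DelayState a b n₁ n₂ n₃ nz K}
  {y₀ : U a b n₁ n₂ n₃ × DelayState a b n₁ n₂ n₃ nz K} {w : ℝ → Fin nw → ℝ}

theorem corresponds_iff (hab : a < b) : Corresponds (pieDPDE G Gd E τ) z x x₀ y y₀ ↔
    (∀ t, 0 ≤ t → y t = E.lift𝒯 hab (x t) + E.lift𝒯z hab (z t)) ∧
      y₀ = E.lift𝒯 hab x₀ + E.lift𝒯z hab (z 0) := by
  simp only [Corresponds, ← toState_lift E hab, toState_injective.eq_iff]

theorem hasDerivWithinAt_lift (hab : a < b) {t : ℝ}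
    {x' : (StateIdx n₁ n₂ n₃ → L2 a b ℝ) × Psi a b n₁ n₂ n₃ nz K} {z' : Fin nz → ℝ} {s : Set ℝ}
    (hx : HasDerivWithinAt x x' s t) (hz : HasDerivWithinAt z z' s t) :
    HasDerivWithinAt (fun t => E.lift𝒯 hab (x t) + E.lift𝒯z hab (z t))
      (E.lift𝒯 hab x' + E.lift𝒯z hab z') s t :=
  ((E.lift𝒯 hab).hasFDerivAt.comp_hasDerivWithinAt t hx).add
    ((E.lift𝒯z hab).hasFDerivAt.comp_hasDerivWithinAt t hz)

/-- Bounded maps in both directions transfer differentiability; existence of z' is the only further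
ingredient. Membership in X and Y is automatic on the PDE side, because every lifted state satisfies
the boundary conditions. -/
theorem isSolution_iff (hab : a < b) (hE : E.WellPosed) (hz : DifferentiableOn ℝ z (Ici 0))
    (hc : Corresponds (pieDPDE G Gd E τ) z x x₀ y y₀) :
    (pieDPDE G Gd E τ).IsSolution z x w x₀ ↔ IsDPDESolution G Gd E τ z y w y₀ := by
  obtain ⟨hy, hy₀⟩ := (corresponds_iff hab).1 hc
  have hx : ∀ t, 0 ≤ t → x t = fundState (y t) := fun t ht => by
    rw [hy t ht, E.fundState_lift]
  constructor
  · rintro ⟨h0, h⟩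
    -- The interconnection signals are the observations of u(t) with z(t), and of the delayed states
    -- at s = 1.
    refine ⟨?_, ?_, ?_, fun t => obs ((y t).1, z t), fun t j => obs (endVal (y t).2 j), fun t ht => ?_⟩
    · rw [hy₀]; exact E.lift_mem_X hE hab _ _
    · rw [hy₀]; exact E.lift_mem_Y hE hab _ _
    · rw [hy 0 le_rfl, hy₀, h0]
    obtain ⟨x', z', dx, dz, e1, e2⟩ := h t ht
    have e3 := (pieDPDE_eq_iff G Gd E hab τ (x t) x' (z t) z').1 e1
    rw [pieDPDE_out G Gd E hab τ (x t) (z t)] at e2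
    rw [← hy t ht] at e2 e3
    refine ⟨_, (hasDerivWithinAt_lift hab dx dz).congr (fun s hs => hy s hs) (hy t ht),
      ⟨?_, ?_, obs_apply hab _ _, ?_⟩, e3.2, fun j => obs_apply hab _ _, ?_⟩
    · rw [← obs_apply hab]; exact e3.1
    · rw [← obs_apply hab]; exact e2
    · rw [hy t ht]; exact E.lift_mem_X hE hab _ _
    · simp only [obs_apply hab]
      rw [hy t ht]; exact E.lift_mem_Y hE hab _ _
  · rintro ⟨-, -, h0, q, r, h⟩
    refine ⟨?_, fun t ht => ?_⟩
    · rw [hx 0 le_rfl, h0, hy₀, E.fundState_lift]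
    obtain ⟨y', dy, ⟨e1, e2, -, -⟩, e3, e4, -⟩ := h t ht
    have dz := (hz t ht).hasDerivWithinAt
    have dx : HasDerivWithinAt x (fundState y') (Ici 0) t :=
      (fundState.hasFDerivAt.comp_hasDerivWithinAt t dy).congr (fun s hs => hx s hs) (hx t ht)
    -- The trajectory y is the lift of (x, z) on [0, ∞), so the lift of the derivatives is also a
    -- derivative of y; derivatives within [0, ∞) are unique.
    have hy' : y' = E.lift𝒯 hab (fundState y') + E.lift𝒯z hab (derivWithin z (Ici 0) t) :=
      (uniqueDiffOn_Ici 0 t ht).eq_deriv _ dy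
        ((hasDerivWithinAt_lift hab dx dz).congr (fun s hs => hy s hs) (hy t ht))
    have e5 : ∀ j, r t j = obs (endVal (y t).2 j) := fun j => (e4 j).trans (obs_apply hab _ _).symm
    rw [← obs_apply hab] at e1 e2
    simp only [e5] at e1 e2
    refine ⟨fundState y', derivWithin z (Ici 0) t, dx, dz, ?_, ?_⟩
    · refine (pieDPDE_eq_iff G Gd E hab τ (x t) (fundState y') (z t) _).2 ?_
      rw [← hy', ← hy t ht]
      exact ⟨e1, e3⟩
    · rw [pieDPDE_out G Gd E hab τ (x t) (z t), ← hy t ht]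
      exact e2

/-- Surjectivity of the lift onto the admissible states. The initial value at s = 0 is prescribed by
Y_q, so the issue is whether ∂_sφ inherits the boundary conditions that φ(s) satisfies for every s.
-/
theorem eq_lift_fundState (hab : a < b) (hE : E.WellPosed) {ζ : Fin nz → ℝ}
    {p : U a b n₁ n₂ n₃ × DelayState a b n₁ n₂ n₃ nz K} (h1 : p.1 ∈ E.X ζ)
    (h2 : p.2 ∈ E.Y K (Dint p.1, Lbf p.1, ζ)) :
    p = E.lift𝒯 hab (fundState p) + E.lift𝒯z hab ζ := by
  have hX := (E.mem_X_iff hE hab p.1 ζ).1 h1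
  have h0 : (0 : ℝ) ∈ Icc (0 : ℝ) 1 := left_mem_Icc.2 zero_le_one
  have hp := H1.eq_mk zero_lt_one p.2
  have ht : ∀ s ∈ Icc (0 : ℝ) 1, traceAt p.2.1.1 s = bdry p.2.1 + ∫ θ in (0 : ℝ)..s, p.2.1.2 θ :=
    fun s hs => by rw [traceAt_eq_bdry zero_lt_one p.2.2 hs, primAt_apply hs]
  have hc : bdry p.2.1 = fun _ => (p.1, ζ) := by
    have e := ht 0 h0
    rw [intervalIntegral.integral_same, add_zero] at e
    rw [← e]
    funext j
    refine Prod.ext (U.toFun_injective ?_) (h2 j).2.1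
    rw [(h2 j).1]
    funext i
    exact Dint_stateToInt _ i
  -- the projection onto values that violate the boundary conditions
  let R : DelayVal a b n₁ n₂ n₃ nz K →L[ℝ] DelayVal a b n₁ n₂ n₃ nz K :=
    ContinuousLinearMap.id ℝ _ - E.delayVal hab ∘L delayFund
  have hR : ∀ s ∈ Icc (0 : ℝ) 1, R (traceAt p.2.1.1 s) = 0 := fun s hs =>
    sub_eq_zero.2 (E.delayVal_delayFund hE hab fun j => (h2 j).2.2 s hs).symm
  -- R is bounded and independent of s, so Rφ has weak derivative R∂_sφ. As Rφ = 0, uniqueness of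
  -- weak derivatives gives R∂_sφ = 0.
  have hRd : mapL2 R p.2.1.2 = 0 := by
    refine IsWeakDeriv.unique (u := 0) ?_ isWeakDeriv_zero
    have e := isWeakDeriv_of_prim zero_le_one (R (bdry p.2.1)) (mapL2 R p.2.1.2)
    convert e using 1
    rw [← mapL2_volterra, ← mapL2_const, ← map_add]
    symm
    refine mapL2_congr ?_
    filter_upwards [ae_mem_Icc, Lp.coeFn_zero (DelayVal a b n₁ n₂ n₃ nz K) 2 (vol 0 1),
      Lp.coeFn_add (constL2 (bdry p.2.1)) (volterra p.2.1.2),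
      constL2_coeFn (a := 0) (b := 1) (bdry p.2.1), volterra_coeFn p.2.1.2] with s hs e1 e2 e3 e4
    rw [e1, e2, Pi.add_apply, e3, e4, ← ht s hs]
    exact hR s hs
  have hd : mapL2 (E.delayVal hab) (mapL2 delayFund p.2.1.2) = p.2.1.2 := by
    refine Lp.ext ?_
    filter_upwards [mapL2_coeFn (a := 0) (b := 1) R p.2.1.2,
      Lp.coeFn_zero (DelayVal a b n₁ n₂ n₃ nz K) 2 (vol 0 1),
      mapL2_coeFn (a := 0) (b := 1) (E.delayVal hab) (mapL2 delayFund p.2.1.2),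
      mapL2_coeFn (a := 0) (b := 1) delayFund p.2.1.2] with s e1 e2 e3 e4
    rw [e3, e4]
    rw [hRd, e2] at e1
    exact (sub_eq_zero.1 e1.symm).symm
  rw [E.lift_eq, fundState_apply]
  refine Prod.ext hX.symm (hp.trans ?_)
  show mkH1 _ (bdry p.2.1, p.2.1.2) =
    mkH1 _ (_, mapL2 (E.delayVal hab) (mapL2 delayFund p.2.1.2))
  rw [hX, hd, hc]

theorem exists_unique_dpde (hab : a < b) (hE : E.WellPosed) (hz : DifferentiableOn ℝ z (Ici 0))
    (h : (pieDPDE G Gd E τ).IsSolution z x w x₀) :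
    ∃ y y₀, Corresponds (pieDPDE G Gd E τ) z x x₀ y y₀ ∧ IsDPDESolution G Gd E τ z y w y₀ ∧
      ∀ y' y₀', Corresponds (pieDPDE G Gd E τ) z x x₀ y' y₀' → EqOn y' y (Ici 0) ∧ y₀' = y₀ := by
  have hc : Corresponds (pieDPDE G Gd E τ) z x x₀ (fun t => E.lift𝒯 hab (x t) + E.lift𝒯z hab (z t))
      (E.lift𝒯 hab x₀ + E.lift𝒯z hab (z 0)) := (corresponds_iff hab).2 ⟨fun _ _ => rfl, rfl⟩
  refine ⟨_, _, hc, (isSolution_iff hab hE hz hc).1 h, fun y' y₀' hc' => ?_⟩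
  have h' := (corresponds_iff hab).1 hc'
  exact ⟨fun t ht => h'.1 t ht, h'.2⟩

theorem exists_unique_pie (hab : a < b) (hE : E.WellPosed) (hz : DifferentiableOn ℝ z (Ici 0))
    (h : IsDPDESolution G Gd E τ z y w y₀) :
    ∃ x x₀, Corresponds (pieDPDE G Gd E τ) z x x₀ y y₀ ∧ (pieDPDE G Gd E τ).IsSolution z x w x₀ ∧
      ∀ x' x₀', Corresponds (pieDPDE G Gd E τ) z x' x₀' y y₀ → EqOn x' x (Ici 0) ∧ x₀' = x₀ := by
  have hc : Corresponds (pieDPDE G Gd E τ) z (fun t => fundState (y t)) (fundState y₀) y y₀ := by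
    obtain ⟨h1, h2, -, q, r, h3⟩ := h
    refine (corresponds_iff hab).2 ⟨fun t ht => ?_, eq_lift_fundState hab hE h1 h2⟩
    obtain ⟨_, -, ⟨-, -, e1, e2⟩, -, -, e3⟩ := h3 t ht
    -- The signal q(t) is by the equations the observation of u(t) with z(t), as needed for
    -- membership in Y.
    exact eq_lift_fundState hab hE e2 (e1 ▸ e3)
  refine ⟨_, _, hc, (isSolution_iff hab hE hz hc).2 h, fun x' x₀' hc' => ?_⟩
  have h' := (corresponds_iff hab).1 hc'
  refine ⟨fun t ht => ?_, ?_⟩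
  · show x' t = fundState (y t)
    rw [h'.1 t ht, E.fundState_lift]
  · rw [h'.2, E.fundState_lift]

end equivalence

/-! ## Bounded operators that are PI operators -/

section scalar

variable {a b : ℝ}

/-- `S` is the sum of a bounded multiplier and a Hilbert–Schmidt operator. -/
def IsPI3 (S : L2 a b ℝ →L[ℝ] L2 a b ℝ) : Prop :=
  ∃ (r : ℝ → ℝ) (k : ℝ → ℝ → ℝ), MemLp r ∞ (vol a b) ∧
    MemLp (fun p : ℝ × ℝ => k p.1 p.2) 2 ((vol a b).prod (vol a b)) ∧
    ∀ u, S u =ᵐ[vol a b] fun x => r x * u x + ∫ θ, k x θ * u θ ∂(vol a b)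

theorem ae_integrable_kernel {k : ℝ → ℝ → ℝ}
    (hk : MemLp (fun p : ℝ × ℝ => k p.1 p.2) 2 ((vol a b).prod (vol a b))) (u : L2 a b ℝ) :
    ∀ᵐ x ∂(vol a b), Integrable (fun θ => k x θ * u θ) (vol a b) := by
  have h : Integrable (fun p : ℝ × ℝ => k p.1 p.2 * u p.2) ((vol a b).prod (vol a b)) :=
    MemLp.integrable_mul hk ((Lp.memLp u).comp_snd (vol a b))
  exact h.prod_right_ae

theorem IsPI3.zero : IsPI3 (0 : L2 a b ℝ →L[ℝ] L2 a b ℝ) := by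
  refine ⟨fun _ => 0, fun _ _ => 0, memLp_const 0, memLp_const 0, fun u => ?_⟩
  filter_upwards [Lp.coeFn_zero ℝ 2 (vol a b)] with x hx
  rw [zero_apply, hx]; simp

theorem IsPI3.add {S S' : L2 a b ℝ →L[ℝ] L2 a b ℝ} (h : IsPI3 S) (h' : IsPI3 S') :
    IsPI3 (S + S') := by
  obtain ⟨r, k, hr, hk, e⟩ := h
  obtain ⟨r', k', hr', hk', e'⟩ := h'
  refine ⟨fun x => r x + r' x, fun x θ => k x θ + k' x θ, hr.add hr', hk.add hk', fun u => ?_⟩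
  filter_upwards [e u, e' u, Lp.coeFn_add (S u) (S' u), ae_integrable_kernel hk u,
    ae_integrable_kernel hk' u] with x h1 h2 h3 h4 h5
  rw [add_apply, h3, Pi.add_apply, h1, h2]
  simp only [add_mul]
  rw [integral_add h4 h5]; ring

theorem IsPI3.sum {ι : Type} (s : Finset ι) {S : ι → L2 a b ℝ →L[ℝ] L2 a b ℝ}
    (h : ∀ i, IsPI3 (S i)) : IsPI3 (∑ i ∈ s, S i) := by
  classical
  induction s using Finset.induction_on with
  | empty => simpa using IsPI3.zero
  | insert i s hi ih => rw [Finset.sum_insert hi]; exact (h i).add ih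

theorem IsPI3.mul {S : L2 a b ℝ →L[ℝ] L2 a b ℝ} (h : IsPI3 S) {g : ℝ → ℝ}
    (hg : MemLp g ∞ (vol a b)) : IsPI3 (mulL2 g hg ∘L S) := by
  obtain ⟨r, k, hr, hk, e⟩ := h
  refine ⟨fun x => g x * r x, fun x θ => g x * k x θ, hr.mul hg, hk.mul (hg.comp_fst (vol a b)),
    fun u => ?_⟩
  filter_upwards [e u, mulL2_coeFn g hg (S u)] with x h1 h2
  rw [ContinuousLinearMap.comp_apply, h2, h1]
  simp only [mul_assoc, integral_const_mul]
  ring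

theorem IsPI3.smul {S : L2 a b ℝ →L[ℝ] L2 a b ℝ} (h : IsPI3 S) (c : ℝ) : IsPI3 (c • S) := by
  have e : c • S = mulL2 (fun _ => c) (memLp_const c) ∘L S := by
    refine ContinuousLinearMap.ext fun u => Lp.ext ?_
    filter_upwards [mulL2_coeFn (fun _ => c) (memLp_const c) (S u), Lp.coeFn_smul c (S u)]
      with x h1 h2
    rw [ContinuousLinearMap.comp_apply, h1, smul_apply, h2]; rfl
  rw [e]; exact h.mul _

/-- The Riesz representation of functionals. -/
theorem exists_pairing (ℓ : L2 a b ℝ →L[ℝ] ℝ) :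
    ∃ f : L2 a b ℝ, ∀ u, ℓ u = ∫ x, f x * u x ∂(vol a b) := by
  refine ⟨(InnerProductSpace.toDual ℝ (L2 a b ℝ)).symm ℓ, fun u => ?_⟩
  rw [← InnerProductSpace.toDual_symm_apply (x := u) (y := ℓ), MeasureTheory.L2.inner_def]
  refine integral_congr_ae (Filter.Eventually.of_forall fun x => ?_)
  simp [mul_comm]

/-- The kernel is g(x)f(θ) with f the Riesz representative of the functional; its square is a
product of two integrable functions. -/
theorem IsPI3.rankOne (ℓ : L2 a b ℝ →L[ℝ] ℝ) (g : L2 a b ℝ) : IsPI3 (ℓ.smulRight g) := by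
  obtain ⟨f, hf⟩ := exists_pairing ℓ
  refine ⟨fun _ => 0, fun x θ => g x * f θ, memLp_const 0, ?_, fun u => ?_⟩
  · have hg := Lp.memLp g
    have hf' := Lp.memLp f
    refine (memLp_two_iff_integrable_sq (f := fun p : ℝ × ℝ => g p.1 * f p.2)
      (hg.1.comp_fst.mul hf'.1.comp_snd)).2 ?_
    simp only [mul_pow]
    exact ((memLp_two_iff_integrable_sq hg.1).1 hg).mul_prod
      ((memLp_two_iff_integrable_sq hf'.1).1 hf')
  · filter_upwards [Lp.coeFn_smul (ℓ u) g] with x hx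
    rw [ContinuousLinearMap.smulRight_apply, hx, Pi.smul_apply, hf]
    simp only [mul_assoc, integral_const_mul, smul_eq_mul]
    ring

/-- Expansion in the standard basis of ℝⁿ gives a sum of rank-one operators. This covers every term
that factors through boundary values or through c. -/
theorem IsPI3.finiteRank {n : Type} [Fintype n] [DecidableEq n] (A : (n → ℝ) →L[ℝ] L2 a b ℝ)
    (B : L2 a b ℝ →L[ℝ] (n → ℝ)) : IsPI3 (A ∘L B) := by
  have e : A ∘L B = ∑ k, (ContinuousLinearMap.proj k ∘L B).smulRight (A (Pi.single k 1)) := by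
    refine ContinuousLinearMap.ext fun u => ?_
    rw [ContinuousLinearMap.comp_apply, sum_apply]
    conv_lhs => rw [pi_eq_sum_univ' (B u), map_sum]
    refine Finset.sum_congr rfl fun k _ => ?_
    rw [map_smul]
    rfl
  rw [e]
  exact IsPI3.sum _ fun k => IsPI3.rankOne _ _

end scalar

/-! ### 4-PI operators, row by row -/

section vector

variable {a b : ℝ} {m₀ m₁ n₀ n₁ : Type} [Fintype m₀] [Fintype m₁] [Fintype n₀] [Fintype n₁]

/-- `F` is a 4-PI operator. -/
def Is4PI (F : Z1 a b n₀ n₁ →L[ℝ] Z1 a b m₀ m₁) : Prop :=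
  ∃ B : N4 m₀ m₁ n₀ n₁, B.Admissible a b ∧ ∀ p, F p = B.op a b p

variable [DecidableEq n₁]

/-- The embedding of component `k` of `L₂^{n₁}` into `ℝ^{n₀} × L₂^{n₁}`. -/
def embFun (k : n₁) : L2 a b ℝ →L[ℝ] Z1 a b n₀ n₁ :=
  (0 : L2 a b ℝ →L[ℝ] (n₀ → ℝ)).prod (ContinuousLinearMap.single ℝ (fun _ => L2 a b ℝ) k)

/-- The unit vector `k` of `ℝ^{n₀}` in `ℝ^{n₀} × L₂^{n₁}`. -/
def embReal [DecidableEq n₀] (k : n₀) : Z1 a b n₀ n₁ := (Pi.single k 1, 0)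

theorem eq_sum_emb [DecidableEq n₀] (p : Z1 a b n₀ n₁) :
    p = ∑ k, p.1 k • (embReal k : Z1 a b n₀ n₁) + ∑ k, embFun k (p.2 k) := by
  refine Prod.ext ?_ ?_
  · simp only [Prod.fst_add, Prod.fst_sum, Prod.smul_fst, embReal, embFun]
    conv_lhs => rw [pi_eq_sum_univ' p.1]
    simp
  · simp only [Prod.snd_add, Prod.snd_sum, Prod.smul_snd, embReal, embFun]
    funext i
    simp [Finset.sum_apply, Pi.single_apply]

/-- The rows of 4-PI operators with values in `L₂`. -/
def IsPIRow (F : Z1 a b n₀ n₁ →L[ℝ] L2 a b ℝ) : Prop := ∀ k, IsPI3 (F ∘L embFun k)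

/-- Only the blocks L₂ → L₂ need a hypothesis. Functionals on L₂ have L₂ densities, and operators
from ℝⁿ to L₂ are given by L₂ columns, so the other blocks are automatic. -/
theorem is4PI_of_rows [DecidableEq n₀] (hab : a ≤ b) (F : Z1 a b n₀ n₁ →L[ℝ] Z1 a b m₀ m₁)
    (hF : ∀ i, IsPIRow (ContinuousLinearMap.proj i ∘L π₂ ∘L F)) : Is4PI F := by
  choose r k hr hk e using hF
  choose f hf using fun i l => exists_pairing
    (ContinuousLinearMap.proj i ∘L π₁ ∘L F ∘L (embFun l : L2 a b ℝ →L[ℝ] Z1 a b n₀ n₁) :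
      L2 a b ℝ →L[ℝ] ℝ)
  -- The Hilbert–Schmidt kernel `k` is used on both sides of the diagonal, as R₁ and as R₂.
  refine ⟨{ B₀₀ := Matrix.of fun i l => (F (embReal l)).1 i
            B₀₁ := fun x => Matrix.of fun i l => f i l x
            B₁₀ := fun x => Matrix.of fun i l => ((F (embReal l)).2 i) x
            B₁₁ := ⟨fun x => Matrix.of fun i l => r i l x, fun x θ => Matrix.of fun i l => k i l x θ,
              fun x θ => Matrix.of fun i l => k i l x θ⟩ },
    ⟨fun i l => Lp.memLp (f i l), fun i l => Lp.memLp _,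
      fun i l => ⟨hr i l, hk i l, hk i l⟩⟩, fun p => ?_⟩
  have hp := congrArg F (eq_sum_emb p)
  rw [map_add, map_sum, map_sum] at hp
  simp only [map_smul] at hp
  rw [hp]
  refine Prod.ext (funext fun i => ?_) (funext fun i => ?_)
  · simp only [Prod.fst_add, Prod.fst_sum, Prod.smul_fst, Pi.add_apply, Finset.sum_apply,
      Pi.smul_apply, N4.op, Matrix.mulVec, dotProduct, Matrix.of_apply, smul_eq_mul]
    congr 1
    · exact Finset.sum_congr rfl fun l _ => mul_comm _ _
    · refine Finset.sum_congr rfl fun l _ => ?_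
      rw [integral_eq_integral_Icc hab]
      exact hf i l (p.2 l)
  · have h1 : toL2 a b (fun x => ∑ l, ((F (embReal l)).2 i) x * p.1 l) =
        ∑ l, p.1 l • (F (embReal l)).2 i := by
      rw [← combL_apply]
      refine toL2_eq ((combL_coeFn (fun l => Lp.memLp ((F (embReal l)).2 i)) p.1).symm.trans ?_)
      simp only [toL2_coe]; rfl
    have h2 : (toL2 a b fun x => ∑ l, (r i l x * p.2 l x + (∫ θ in a..x, k i l x θ * p.2 l θ) +
        ∫ θ in x..b, k i l x θ * p.2 l θ)) = ∑ l, (F (embFun l (p.2 l))).2 i := by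
      refine toL2_eq ?_
      have h3 : ∀ᵐ x ∂(vol a b), ∀ l, ((F (embFun l (p.2 l))).2 i) x =
          r i l x * p.2 l x + ∫ θ, k i l x θ * p.2 l θ ∂(vol a b) := by
        rw [ae_all_iff]; exact fun l => e i l (p.2 l)
      have h4 : ∀ᵐ x ∂(vol a b), ∀ l, Integrable (fun θ => k i l x θ * p.2 l θ) (vol a b) := by
        rw [ae_all_iff]; exact fun l => ae_integrable_kernel (hk i l) (p.2 l)
      filter_upwards [h3, h4, ae_mem_Icc, coeFn_finset_sum Finset.univ fun l =>
        (F (embFun l (p.2 l))).2 i] with x e1 e2 hx e3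
      rw [e3]
      refine Finset.sum_congr rfl fun l _ => ?_
      rw [e1, add_assoc, intervalIntegral.integral_add_adjacent_intervals
        (intervalIntegrable_of_integrable (e2 l) ⟨le_rfl, hab⟩ hx)
        (intervalIntegrable_of_integrable (e2 l) hx ⟨hab, le_rfl⟩), integral_eq_integral_Icc hab]
    simp only [Prod.snd_add, Prod.snd_sum, Prod.smul_snd, Pi.add_apply, Finset.sum_apply,
      Pi.smul_apply]
    exact congrArg₂ (· + ·) h1.symm h2.symm

theorem IsPIRow.zero : IsPIRow (0 : Z1 a b n₀ n₁ →L[ℝ] L2 a b ℝ) := fun _ => by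
  rw [ContinuousLinearMap.zero_comp]; exact IsPI3.zero

theorem IsPIRow.add {F F' : Z1 a b n₀ n₁ →L[ℝ] L2 a b ℝ} (h : IsPIRow F) (h' : IsPIRow F') :
    IsPIRow (F + F') := fun k => by
  rw [ContinuousLinearMap.add_comp]; exact (h k).add (h' k)

theorem IsPIRow.sum {ι : Type} (s : Finset ι) {F : ι → Z1 a b n₀ n₁ →L[ℝ] L2 a b ℝ}
    (h : ∀ i, IsPIRow (F i)) : IsPIRow (∑ i ∈ s, F i) := by
  classical
  induction s using Finset.induction_on with
  | empty => simpa using IsPIRow.zero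
  | insert i s hi ih => rw [Finset.sum_insert hi]; exact (h i).add ih

theorem IsPIRow.smul {F : Z1 a b n₀ n₁ →L[ℝ] L2 a b ℝ} (h : IsPIRow F) (c : ℝ) :
    IsPIRow (c • F) := fun k => (h k).smul c

theorem IsPIRow.mul {F : Z1 a b n₀ n₁ →L[ℝ] L2 a b ℝ} (h : IsPIRow F) {g : ℝ → ℝ}
    (hg : MemLp g ∞ (vol a b)) : IsPIRow (mulL2 g hg ∘L F) := fun k => (h k).mul hg

theorem IsPIRow.finiteRank {n : Type} [Fintype n] [DecidableEq n] (A : (n → ℝ) →L[ℝ] L2 a b ℝ)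
    (B : Z1 a b n₀ n₁ →L[ℝ] (n → ℝ)) : IsPIRow (A ∘L B) := fun k =>
  IsPI3.finiteRank A (B ∘L embFun k)

end vector

/-! ### Rows of `D_int T` -/

section sol

variable {a b : ℝ} {n₁ n₂ n₃ nz nw K : ℕ}

/-- Taylor's formula with c = 0: a constant multiplier, and the affine kernel cut off to θ ≤ x. -/
theorem isPI3_Dint_mk (hab : a < b) (l : StateIdx n₁ n₂ n₃) (m : IntIdx n₁ n₂ n₃) :
    IsPI3 (ContinuousLinearMap.proj m ∘L DintL ∘L U.mk hab ∘L
      (0 : L2 a b ℝ →L[ℝ] (CoreIdx n₂ n₃ → ℝ)).prod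
        (ContinuousLinearMap.single ℝ (fun _ => L2 a b ℝ) l)) := by
  obtain ⟨α, β, hL⟩ := Lint_affine m l
  have hS : MeasurableSet {p : ℝ × ℝ | p.2 ≤ p.1} := measurableSet_le measurable_snd measurable_fst
  refine ⟨fun _ => Rint n₁ n₂ n₃ m l, fun x θ => {p : ℝ × ℝ | p.2 ≤ p.1}.indicator
    (fun p => Lint n₁ n₂ n₃ p.1 p.2 m l) (x, θ), memLp_const _, ?_, fun u => ?_⟩
  · refine MemLp.indicator hS ?_
    simp only [hL]
    have hid : MemLp (fun x : ℝ => x) 2 (vol a b) := memLp_of_continuousOn continuousOn_id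
    exact (memLp_const α).add (((hid.comp_fst (vol a b)).sub (hid.comp_snd (vol a b))).const_mul β)
  · have h0 : ∀ᵐ x ∂(vol a b), ∀ l', l' ≠ l →
        (Pi.single (M := fun _ => L2 a b ℝ) l u l' : L2 a b ℝ) x = 0 := by
      rw [ae_all_iff]
      intro l'
      filter_upwards [Lp.coeFn_zero ℝ 2 (vol a b)] with x hx hl
      rw [Pi.single_eq_of_ne hl, hx]; rfl
    show (DintL (U.mk hab (0, Pi.single l u)) m : L2 a b ℝ) =ᵐ[vol a b] _
    rw [DintL_apply]
    filter_upwards [Dint_mk hab 0 (Pi.single l u) m, ae_mem_Icc, h0] with x e1 hx e2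
    rw [e1, Matrix.mulVec_zero, Pi.zero_apply, zero_add, Finset.sum_eq_single l]
    · rw [Pi.single_eq_same, integral_prefix x hx]
      congr 2
      funext θ
      by_cases h : θ ≤ x <;> simp [indicator, h]
    · intro l' _ hl
      rw [e2 l' hl, mul_zero, zero_add, integral_congr_Icc (g := fun _ => 0) ?_ ⟨le_rfl, hab.le⟩ hx,
        intervalIntegral.integral_zero]
      filter_upwards [h0] with θ h
      rw [h l' hl, mul_zero]
    · intro h; exact absurd (Finset.mem_univ l) h

/-- The part of T that passes through c = −M⁻¹ ∫ N v has finite rank; the rest is the Taylor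
remainder. -/
theorem isPI3_Dint_sol (E : BCs a b n₁ n₂ n₃ nz) (hab : a < b) (l : StateIdx n₁ n₂ n₃)
    (m : IntIdx n₁ n₂ n₃) :
    IsPI3 (ContinuousLinearMap.proj m ∘L DintL ∘L E.sol hab ∘L
      ContinuousLinearMap.single ℝ (fun _ => L2 a b ℝ) l) := by
  have e : (ContinuousLinearMap.proj m ∘L DintL ∘L E.sol hab ∘L
      ContinuousLinearMap.single ℝ (fun _ => L2 a b ℝ) l) =
      (ContinuousLinearMap.proj m ∘L DintL ∘L U.mk hab ∘L ContinuousLinearMap.inl ℝ _ _) ∘L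
        ((-(mulVecL E.mat⁻¹ ∘L E.kerL)) ∘L ContinuousLinearMap.single ℝ (fun _ => L2 a b ℝ) l) +
      (ContinuousLinearMap.proj m ∘L DintL ∘L U.mk hab ∘L
      (0 : L2 a b ℝ →L[ℝ] (CoreIdx n₂ n₃ → ℝ)).prod
        (ContinuousLinearMap.single ℝ (fun _ => L2 a b ℝ) l)) := by
    refine ContinuousLinearMap.ext fun u => ?_
    have e : E.sol hab (Pi.single l u) =
        U.mk hab (-(E.mat⁻¹ *ᵥ E.kerL (Pi.single l u)), 0) + U.mk hab (0, Pi.single l u) := by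
      rw [E.sol_apply, ← map_add, Prod.mk_add_mk, add_zero, zero_add]
    exact (congrFun (congrArg DintL e) m).trans (congrFun (map_add DintL _ _) m)
  rw [e]
  exact (IsPI3.finiteRank _ _).add (isPI3_Dint_mk hab l m)

/-- The components of `D_int T` applied to a selection of the components of the argument. -/
theorem isPIRow_Dint_sol {p₀ p₁ : Type} [Fintype p₀] [Fintype p₁] [DecidableEq p₁]
    (E : BCs a b n₁ n₂ n₃ nz) (hab : a < b) (σ : StateIdx n₁ n₂ n₃ → p₁)
    (m : IntIdx n₁ n₂ n₃) :
    IsPIRow (ContinuousLinearMap.proj m ∘L DintL ∘L E.sol hab ∘L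
      (ContinuousLinearMap.pi fun l => ContinuousLinearMap.proj (σ l) ∘L π₂ :
        Z1 a b p₀ p₁ →L[ℝ] (StateIdx n₁ n₂ n₃ → L2 a b ℝ))) := by
  intro k
  -- Component k of the argument reaches every slot l with σ l = k, and the rows add up over these
  -- slots.
  have e : ((ContinuousLinearMap.pi fun l => ContinuousLinearMap.proj (σ l) ∘L π₂ :
        Z1 a b p₀ p₁ →L[ℝ] (StateIdx n₁ n₂ n₃ → L2 a b ℝ)) ∘L embFun k) =
      ∑ l ∈ Finset.univ.filter (fun l => σ l = k),
        ContinuousLinearMap.single ℝ (fun _ => L2 a b ℝ) l := by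
    refine ContinuousLinearMap.ext fun u => funext fun l => ?_
    rw [sum_apply, Finset.sum_apply]
    show (Pi.single k u : p₁ → L2 a b ℝ) (σ l) = ∑ l' ∈ Finset.univ.filter (fun l => σ l = k),
      (Pi.single l' u : StateIdx n₁ n₂ n₃ → L2 a b ℝ) l
    rw [Pi.single_apply]
    simp only [Pi.single_apply, Finset.sum_ite_eq, Finset.mem_filter, Finset.mem_univ, true_and]
  rw [ContinuousLinearMap.comp_assoc, ContinuousLinearMap.comp_assoc, ContinuousLinearMap.comp_assoc,
    e, ContinuousLinearMap.comp_finsetSum, ContinuousLinearMap.comp_finsetSum,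
    ContinuousLinearMap.comp_finsetSum]
  exact IsPI3.sum _ fun l => isPI3_Dint_sol E hab l m

end sol

/-! ### Criteria for 2D PI operators -/

section general

variable {a b c d : ℝ} {m₀ m₁ r₀ r₁ n₀ n₁ p₀ p₁ X Y : Type}
  [Fintype m₀] [Fintype m₁] [Fintype r₀] [Fintype r₁]
  [Fintype n₀] [Fintype n₁] [Fintype p₀] [Fintype p₁]

theorem isPI_of {e : X → Z12 a b c d n₀ n₁ p₀ p₁} {f : Y → Z12 a b c d m₀ m₁ r₀ r₁} {F : X → Y}
    {F₁₁ : Z1 a b n₀ n₁ →L[ℝ] Z1 a b m₀ m₁} {F₁₂ : Z1 a b p₀ p₁ →L[ℝ] Z1 a b m₀ m₁}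
    {F₂₁ : Z1 a b n₀ n₁ →L[ℝ] Z1 a b r₀ r₁} {N₀ N₁ N₂ : Z1 a b p₀ p₁ →L[ℝ] Z1 a b r₀ r₁}
    (h₁₁ : Is4PI F₁₁) (h₁₂ : Is4PI F₁₂) (h₂₁ : Is4PI F₂₁) (h₀ : Is4PI N₀) (h₁ : Is4PI N₁)
    (h₂ : Is4PI N₂) (h : ∀ x, f (F x) = (F₁₁ (e x).1 + ∫ s in c..d, F₁₂ ((e x).2 s),
      toL2 c d fun s => F₂₁ (e x).1 + N₀ ((e x).2 s) + (∫ ν in c..s, N₁ ((e x).2 ν)) +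
        ∫ ν in s..d, N₂ ((e x).2 ν))) : IsPI e f F := by
  obtain ⟨B₁₁, k₁₁, e₁₁⟩ := h₁₁
  obtain ⟨B₁₂, k₁₂, e₁₂⟩ := h₁₂
  obtain ⟨B₂₁, k₂₁, e₂₁⟩ := h₂₁
  obtain ⟨C₀, k₀, e₀⟩ := h₀
  obtain ⟨C₁, k₁, e₁⟩ := h₁
  obtain ⟨C₂, k₂, e₂⟩ := h₂
  refine ⟨⟨B₁₁, B₁₂, B₂₁, C₀, C₁, C₂⟩, ⟨k₁₁, k₁₂, k₂₁, k₀, k₁, k₂⟩, fun x => ?_⟩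
  rw [h]
  simp only [N12.op, e₁₁, e₁₂, e₂₁, e₀, e₁, e₂]

theorem is4PI_zero [DecidableEq n₀] [DecidableEq n₁] (hab : a ≤ b) :
    Is4PI (0 : Z1 a b n₀ n₁ →L[ℝ] Z1 a b m₀ m₁) :=
  is4PI_of_rows hab _ fun _ => IsPIRow.zero

/-- Operators between spaces without functions of `s`. -/
theorem isPI_of_real [DecidableEq n₀] [DecidableEq n₁] [DecidableEq p₀] [DecidableEq p₁]
    (hab : a ≤ b) {e : X → Z12 a b c d n₀ n₁ p₀ p₁} {f : Y → Z12 a b c d m₀ m₁ r₀ r₁} {F : X → Y}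
    {F₁₁ : Z1 a b n₀ n₁ →L[ℝ] Z1 a b m₀ m₁} {F₁₂ : Z1 a b p₀ p₁ →L[ℝ] Z1 a b m₀ m₁}
    {F₂₁ : Z1 a b n₀ n₁ →L[ℝ] Z1 a b r₀ r₁} (h₁₁ : Is4PI F₁₁) (h₁₂ : Is4PI F₁₂) (h₂₁ : Is4PI F₂₁)
    (h : ∀ x, f (F x) = (F₁₁ (e x).1 + ∫ s in c..d, F₁₂ ((e x).2 s),
      constL2 (F₂₁ (e x).1))) : IsPI e f F := by
  refine isPI_of h₁₁ h₁₂ h₂₁ (is4PI_zero hab) (is4PI_zero hab) (is4PI_zero hab) fun x => ?_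
  rw [h, ← toL2_const]
  simp

theorem is4PI_of_noFun [DecidableEq n₀] (hab : a ≤ b)
    (F : Z1 a b n₀ (Fin 0) →L[ℝ] Z1 a b m₀ m₁) : Is4PI F :=
  is4PI_of_rows hab F fun _ k => k.elim0

theorem is4PI_toReal [DecidableEq n₀] [DecidableEq n₁] (hab : a ≤ b)
    (F : Z1 a b n₀ n₁ →L[ℝ] Z1 a b m₀ (Fin 0)) : Is4PI F :=
  is4PI_of_rows hab F fun i => i.elim0

theorem toL2_add_prim {E F : Type} [NormedAddCommGroup E] [NormedSpace ℝ E]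
    [NormedAddCommGroup F] [NormedSpace ℝ F] [CompleteSpace F] (y : F) (N : E →L[ℝ] F)
    (u : L2 c d E) : toL2 c d (fun s => y + ∫ ν in c..s, N (u ν)) =
      constL2 y + volterra (mapL2 N u) := by
  refine toL2_eq ?_
  filter_upwards [ae_mem_Icc, Lp.coeFn_add (constL2 y) (volterra (mapL2 N u)),
    constL2_coeFn (a := c) (b := d) y, volterra_coeFn (mapL2 N u)] with s hs h1 h2 h3
  rw [h1, Pi.add_apply, h2, h3]
  congr 1
  exact integral_congr_Icc (mapL2_coeFn N u).symm ⟨le_rfl, hs.1.trans hs.2⟩ hs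

end general

/-! ### The six operators of the interconnection -/

section system

variable {a b : ℝ} {n₁ n₂ n₃ nz nw K : ℕ} {p₀ p₁ : Type} [Fintype p₀] [Fintype p₁]

/-- Selection of components. -/
def selFun (σ : StateIdx n₁ n₂ n₃ → p₁) : Z1 a b p₀ p₁ →L[ℝ] (StateIdx n₁ n₂ n₃ → L2 a b ℝ) :=
  ContinuousLinearMap.pi fun l => ContinuousLinearMap.proj (σ l) ∘L π₂

theorem isPIRow_toFun_sol [DecidableEq p₁] (E : BCs a b n₁ n₂ n₃ nz) (hab : a < b)
    (σ : StateIdx n₁ n₂ n₃ → p₁) (i : StateIdx n₁ n₂ n₃) :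
    IsPIRow (ContinuousLinearMap.proj i ∘L U.toFunL ∘L E.sol hab ∘L
      (selFun σ : Z1 a b p₀ p₁ →L[ℝ] _)) := by
  convert isPIRow_Dint_sol (p₀ := p₀) E hab σ (stateToInt i) using 1
  refine ContinuousLinearMap.ext fun p => ?_
  show U.toFunL (E.sol hab (selFun σ p)) i = DintL (E.sol hab (selFun σ p)) (stateToInt i)
  rw [U.toFunL_apply, DintL_apply, Dint_stateToInt]

/-- Only the A_p term can have infinite rank, and there A_p ∈ L_∞ multiplies a row of D_int T. The
boundary term factors through Λ_bf. -/
theorem isPIRow_dyn_sol [DecidableEq p₁] (G : Coeffs a b n₁ n₂ n₃ nz nw) (E : BCs a b n₁ n₂ n₃ nz)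
    (hab : a < b) (σ : StateIdx n₁ n₂ n₃ → p₁) (i : StateIdx n₁ n₂ n₃) :
    IsPIRow (ContinuousLinearMap.proj i ∘L G.dynL ∘L obs ∘L
      (E.sol hab ∘L (selFun σ : Z1 a b p₀ p₁ →L[ℝ] _)).prod 0) := by
  have e : ContinuousLinearMap.proj i ∘L G.dynL ∘L obs ∘L
      (E.sol hab ∘L (selFun σ : Z1 a b p₀ p₁ →L[ℝ] _)).prod 0 =
      (∑ k, mulL2 (fun x => G.Ap x i k) (G.memLp_Ap i k) ∘L
        (ContinuousLinearMap.proj k ∘L DintL ∘L E.sol hab ∘L selFun σ)) +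
      combL (fun k => toL2 a b fun x => G.Ab x i k) ∘L (LbfL ∘L E.sol hab ∘L selFun σ) := by
    refine ContinuousLinearMap.ext fun p => ?_
    rw [add_apply, sum_apply]
    refine (G.dynL_apply (obs (E.sol hab (selFun σ p), 0)) i).trans ?_
    refine congrArg₂ (· + ·) rfl ?_
    show _ + combL _ (0 : Fin nz → ℝ) = _
    rw [map_zero, add_zero]
    rfl
  rw [e]
  exact (IsPIRow.sum _ fun k => (isPIRow_Dint_sol E hab σ k).mul _).add (IsPIRow.finiteRank _ _)

theorem isPIRow_delayFun (E : BCs a b n₁ n₂ n₃ nz) (hab : a < b) (k : Fin K × StateIdx n₁ n₂ n₃) :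
    IsPIRow (ContinuousLinearMap.proj k ∘L π₂ ∘L (delayFun ∘L E.delayVal hab :
      Z1 a b (Fin K × Fin nz) (Fin K × StateIdx n₁ n₂ n₃) →L[ℝ]
        Z1 a b (Fin K × Fin nz) (Fin K × StateIdx n₁ n₂ n₃))) := by
  have e : ContinuousLinearMap.proj k ∘L π₂ ∘L (delayFun ∘L E.delayVal hab :
      Z1 a b (Fin K × Fin nz) (Fin K × StateIdx n₁ n₂ n₃) →L[ℝ]
        Z1 a b (Fin K × Fin nz) (Fin K × StateIdx n₁ n₂ n₃)) =
      ContinuousLinearMap.proj k.2 ∘L U.toFunL ∘L E.sol hab ∘L selFun (fun i => (k.1, i)) +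
      (ContinuousLinearMap.proj k.2 ∘L U.toFunL ∘L E.solz hab) ∘L blockReal k.1 :=
    ContinuousLinearMap.ext fun p => congrFun (map_add U.toFunL (E.sol hab (blockFun k.1 p))
      (E.solz hab (blockReal k.1 p))) k.2
  rw [e]
  exact (isPIRow_toFun_sol E hab _ _).add (IsPIRow.finiteRank _ _)

theorem is4PI_delayFun (E : BCs a b n₁ n₂ n₃ nz) (hab : a < b) :
    Is4PI (delayFun ∘L E.delayVal hab : Z1 a b (Fin K × Fin nz) (Fin K × StateIdx n₁ n₂ n₃) →L[ℝ]
      Z1 a b (Fin K × Fin nz) (Fin K × StateIdx n₁ n₂ n₃)) :=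
  is4PI_of_rows hab.le _ fun k => isPIRow_delayFun E hab k

theorem is4PI_delayFun_scale (E : BCs a b n₁ n₂ n₃ nz) (hab : a < b) (τ : Fin K → ℝ) :
    Is4PI (delayFun ∘L scaleL τ ∘L E.delayVal hab :
      Z1 a b (Fin K × Fin nz) (Fin K × StateIdx n₁ n₂ n₃) →L[ℝ]
      Z1 a b (Fin K × Fin nz) (Fin K × StateIdx n₁ n₂ n₃)) := by
  refine is4PI_of_rows hab.le _ fun k => ?_
  convert (isPIRow_delayFun E hab k).smul (-(1 / τ k.1)) using 1
  exact ContinuousLinearMap.ext fun p =>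
    congrFun (U.toFunL.map_smul (-(1 / τ k.1)) (E.delayVal hab p k.1).1) k.2

theorem isPIRow_dyn_delayVal (G : Coeffs a b n₁ n₂ n₃ nz nw) (E : BCs a b n₁ n₂ n₃ nz)
    (hab : a < b) (j : Fin K) (i : StateIdx n₁ n₂ n₃) :
    IsPIRow (ContinuousLinearMap.proj i ∘L G.dynL ∘L obs ∘L ContinuousLinearMap.proj j ∘L
      E.delayVal hab) := by
  have e : ContinuousLinearMap.proj i ∘L G.dynL ∘L obs ∘L ContinuousLinearMap.proj j ∘L
      E.delayVal hab = ContinuousLinearMap.proj i ∘L G.dynL ∘L obs ∘L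
        (E.sol hab ∘L selFun (fun i => (j, i))).prod 0 +
      (ContinuousLinearMap.proj i ∘L G.dynL ∘L obs ∘L
        (E.solz hab).prod (ContinuousLinearMap.id ℝ _)) ∘L blockReal j := by
    refine ContinuousLinearMap.ext fun p => ?_
    have h : E.delayVal hab p j = (E.sol hab (blockFun j p), 0) +
        (E.solz hab (blockReal j p), blockReal j p) := by
      rw [E.delayVal_apply, Prod.mk_add_mk, zero_add]
    show G.dynL (obs (E.delayVal hab p j)) i = _
    rw [h, map_add, map_add]
    rfl
  rw [e]
  exact (isPIRow_dyn_sol G E hab _ i).add (IsPIRow.finiteRank _ _)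

variable (G : Coeffs a b n₁ n₂ n₃ nz nw) (Gd : Fin K → Coeffs a b n₁ n₂ n₃ nz nw)
  (E : BCs a b n₁ n₂ n₃ nz) (τ : Fin K → ℝ)

/-- The initial value φ(0) = (u, ·) gives a block that is constant in s, and ∫_0^s ∂_sφ gives N₁;
the parameters N₀ and N₂ vanish. -/
theorem isPI_T (hab : a < b) : IsPI stateSig stateSig (pieDPDE G Gd E τ).T := by
  have h11 : Is4PI ((0 : Z1 a b (Fin 0) (StateIdx n₁ n₂ n₃) →L[ℝ] (Fin 0 → ℝ)).prod
      (U.toFunL ∘L E.sol hab ∘L selFun id)) :=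
    is4PI_of_rows hab.le _ fun i => isPIRow_toFun_sol E hab id i
  have h21 : Is4PI (delayFun ∘L (ContinuousLinearMap.pi fun _ => (E.sol hab ∘L selFun id).prod 0 :
      Z1 a b (Fin 0) (StateIdx n₁ n₂ n₃) →L[ℝ] DelayVal a b n₁ n₂ n₃ nz K)) :=
    is4PI_of_rows hab.le _ fun k => isPIRow_toFun_sol E hab id k.2
  refine isPI_of h11 (is4PI_zero hab.le) h21 (is4PI_zero hab.le) (is4PI_delayFun E hab)
    (is4PI_zero hab.le) fun x => ?_
  have e : (pieDPDE G Gd E τ).T x = (E.T x.1 + 0 + 0,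
    (pieTransport E τ).Tw (E.Tq x.1) + (pieTransport E τ).T x.2) := rfl
  rw [e, E.Tq_eq hab, E.T_eq hab, pieTransport_Tw E hab, pieTransport_T E hab, mapL2_mapL2]
  simp only [zero_apply, intervalIntegral.integral_zero, add_zero, toL2_add_prim]
  rw [← U.toFunL_apply]
  rfl

theorem isPI_Tw (hab : a < b) : IsPI (realSig a b 0 1) stateSig (pieDPDE G Gd E τ).Tw := by
  refine isPI_of_real hab.le
    (is4PI_of_noFun hab.le ((0 : Z1 a b (Fin nz) (Fin 0) →L[ℝ] (Fin 0 → ℝ)).prod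
      (U.toFunL ∘L E.solz hab ∘L π₁))) (is4PI_zero hab.le)
    (is4PI_of_noFun hab.le (delayFun ∘L (ContinuousLinearMap.pi fun _ =>
      (E.solz hab ∘L π₁).prod π₁ :
      Z1 a b (Fin nz) (Fin 0) →L[ℝ] DelayVal a b n₁ n₂ n₃ nz K))) fun ζ => ?_
  have e : (pieDPDE G Gd E τ).Tw ζ = (E.Tz ζ + 0, (pieTransport E τ).Tw (E.Tqz ζ)) := rfl
  rw [e, E.Tqz_eq hab, E.Tz_eq hab, pieTransport_Tw E hab]
  simp only [zero_apply, intervalIntegral.integral_zero, add_zero]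
  rw [← U.toFunL_apply]
  rfl

/-- The sum of the undelayed and the delayed terms. -/
def dynTot : Q a b n₁ n₂ n₃ nz →L[ℝ] (StateIdx n₁ n₂ n₃ → L2 a b ℝ) :=
  G.dynL + ∑ j, (Gd j).dynL

/-- The intended argument is ∫_0^1 ψ ds: the integral in r_j commutes with the bounded operators
applied after it. -/
def dynDelay (hab : a < b) : Z1 a b (Fin K × Fin nz) (Fin K × StateIdx n₁ n₂ n₃) →L[ℝ]
    (StateIdx n₁ n₂ n₃ → L2 a b ℝ) :=
  ∑ j, (Gd j).dynL ∘L obs ∘L ContinuousLinearMap.proj j ∘L E.delayVal hab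

def outTot : Q a b n₁ n₂ n₃ nz →L[ℝ] (Fin nw → ℝ) := G.outL + ∑ j, (Gd j).outL

def outDelay (hab : a < b) : Z1 a b (Fin K × Fin nz) (Fin K × StateIdx n₁ n₂ n₃) →L[ℝ]
    (Fin nw → ℝ) :=
  ∑ j, (Gd j).outL ∘L obs ∘L ContinuousLinearMap.proj j ∘L E.delayVal hab

theorem dynTot_apply (y : Q a b n₁ n₂ n₃ nz) :
    dynTot G Gd y = G.dyn y + ∑ j, (Gd j).dyn y := by
  rw [dynTot, add_apply, sum_apply]
  simp only [Coeffs.dyn_eq]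

theorem outTot_apply (hab : a < b) (y : Q a b n₁ n₂ n₃ nz) :
    outTot G Gd y = G.out y + ∑ j, (Gd j).out y := by
  rw [outTot, add_apply, sum_apply]
  simp only [Coeffs.out_eq hab.le]

theorem pieTransport_C_eq (hab : a < b) (ψ : Psi a b n₁ n₂ n₃ nz K) (j : Fin K) :
    (pieTransport E τ).C ψ j = obs (E.delayVal hab (∫ s in (0 : ℝ)..1, ψ s) j) := by
  have h0 : (0 : ℝ) ∈ Icc (0 : ℝ) 1 := left_mem_Icc.2 zero_le_one
  have h1 : (1 : ℝ) ∈ Icc (0 : ℝ) 1 := right_mem_Icc.2 zero_le_one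
  rw [pieTransport_C E hab, integral_congr_Icc (mapL2_coeFn _ _) h0 h1,
    (E.delayVal hab).intervalIntegral_comp_comm (intervalIntegrable_coe ψ h0 h1)]

theorem sum_dyn_pieTransport_C (hab : a < b) (ψ : Psi a b n₁ n₂ n₃ nz K) :
    ∑ j, (Gd j).dyn ((pieTransport E τ).C ψ j) =
      dynDelay Gd E hab (∫ s in (0 : ℝ)..1, ψ s) := by
  rw [dynDelay, sum_apply]
  simp only [Coeffs.dyn_eq, pieTransport_C_eq E τ hab]
  rfl

theorem sum_out_pieTransport_C (hab : a < b) (ψ : Psi a b n₁ n₂ n₃ nz K) :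
    ∑ j, (Gd j).out ((pieTransport E τ).C ψ j) =
      outDelay Gd E hab (∫ s in (0 : ℝ)..1, ψ s) := by
  rw [outDelay, sum_apply]
  simp only [Coeffs.out_eq hab.le, pieTransport_C_eq E τ hab]
  rfl

/-- The dependence of u_t on ψ is through ∫_0^1 ψ only, which is the block B₁₂. The transport part
acts pointwise in s, hence is a multiplier N₀. -/
theorem isPI_A (hab : a < b) : IsPI stateSig stateSig (pieDPDE G Gd E τ).A := by
  have h11 : Is4PI ((0 : Z1 a b (Fin 0) (StateIdx n₁ n₂ n₃) →L[ℝ] (Fin 0 → ℝ)).prod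
      (dynTot G Gd ∘L obs ∘L (E.sol hab ∘L selFun id).prod 0)) :=
    is4PI_of_rows hab.le _ fun i => by
      convert (isPIRow_dyn_sol (p₀ := Fin 0) G E hab id i).add
        (IsPIRow.sum _ fun j => isPIRow_dyn_sol (p₀ := Fin 0) (Gd j) E hab id i) using 1
      refine ContinuousLinearMap.ext fun p => ?_
      rw [add_apply, sum_apply]
      show dynTot G Gd (obs (E.sol hab (selFun id p), 0)) i = _
      rw [dynTot, add_apply, sum_apply, Pi.add_apply, Finset.sum_apply]
      rfl
  have h12 : Is4PI ((0 : Z1 a b (Fin K × Fin nz) (Fin K × StateIdx n₁ n₂ n₃) →L[ℝ]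
      (Fin 0 → ℝ)).prod (dynDelay Gd E hab)) :=
    is4PI_of_rows hab.le _ fun i => by
      convert IsPIRow.sum _ fun j => isPIRow_dyn_delayVal (Gd j) E hab j i using 1
      refine ContinuousLinearMap.ext fun p => ?_
      rw [sum_apply]
      show dynDelay Gd E hab p i = _
      rw [dynDelay, sum_apply, Finset.sum_apply]
      rfl
  refine isPI_of h11 h12 (is4PI_zero hab.le) (is4PI_delayFun_scale E hab τ) (is4PI_zero hab.le)
    (is4PI_zero hab.le) fun x => ?_
  have e : (pieDPDE G Gd E τ).A x = (G.dyn (E.Tq x.1) + (∑ j, (Gd j).dyn (E.Tq x.1)) +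
    ∑ j, (Gd j).dyn ((pieTransport E τ).C x.2 j), 0 + (pieTransport E τ).A x.2) := rfl
  rw [e, ← dynTot_apply, sum_dyn_pieTransport_C Gd E τ hab, pieTransport_A E hab, E.Tq_eq hab, mapL2_mapL2,
    mapL2_mapL2]
  rw [ContinuousLinearMap.intervalIntegral_comp_comm _ (intervalIntegrable_coe _
    (left_mem_Icc.2 zero_le_one) (right_mem_Icc.2 zero_le_one))]
  simp only [zero_apply, intervalIntegral.integral_zero, add_zero, zero_add, toL2_map]
  rw [stateSig]
  refine Prod.ext (Prod.ext (Subsingleton.elim _ _) rfl) rfl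

theorem isPI_B (hab : a < b) : IsPI (realSig a b 0 1) stateSig (pieDPDE G Gd E τ).B := by
  refine isPI_of_real hab.le
    (is4PI_of_noFun hab.le ((0 : Z1 a b (Fin nz) (Fin 0) →L[ℝ] (Fin 0 → ℝ)).prod
      (dynTot G Gd ∘L obs ∘L (E.solz hab ∘L π₁).prod π₁))) (is4PI_zero hab.le)
    (is4PI_zero hab.le) fun ζ => ?_
  have e : (pieDPDE G Gd E τ).B ζ = (G.dyn (E.Tqz ζ) + ∑ j, (Gd j).dyn (E.Tqz ζ), 0) := rfl
  rw [e, ← dynTot_apply, E.Tqz_eq hab]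
  simp only [zero_apply, intervalIntegral.integral_zero, add_zero, map_zero]
  rfl

theorem isPI_C (hab : a < b) : IsPI stateSig (realSig a b 0 1) (pieDPDE G Gd E τ).C := by
  refine isPI_of_real hab.le
    (is4PI_toReal hab.le ((outTot G Gd ∘L obs ∘L (E.sol hab ∘L selFun id).prod 0).prod
      (0 : Z1 a b (Fin 0) (StateIdx n₁ n₂ n₃) →L[ℝ] (Fin 0 → L2 a b ℝ))))
    (is4PI_toReal hab.le ((outDelay Gd E hab).prod 0)) (is4PI_zero hab.le) fun x => ?_
  have e : (pieDPDE G Gd E τ).C x = G.out (E.Tq x.1) + (∑ j, (Gd j).out (E.Tq x.1)) +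
    ∑ j, (Gd j).out ((pieTransport E τ).C x.2 j) := rfl
  rw [e, ← outTot_apply G Gd hab, sum_out_pieTransport_C Gd E τ hab, E.Tq_eq hab]
  rw [ContinuousLinearMap.intervalIntegral_comp_comm _ (intervalIntegrable_coe _
    (left_mem_Icc.2 zero_le_one) (right_mem_Icc.2 zero_le_one))]
  simp only [zero_apply, map_zero]
  refine Prod.ext (Prod.ext rfl (Subsingleton.elim _ _)) rfl

theorem isPI_D (hab : a < b) : IsPI (realSig a b 0 1) (realSig a b 0 1) (pieDPDE G Gd E τ).D := by
  refine isPI_of_real hab.le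
    (is4PI_toReal hab.le ((outTot G Gd ∘L obs ∘L (E.solz hab ∘L π₁).prod π₁).prod
      (0 : Z1 a b (Fin nz) (Fin 0) →L[ℝ] (Fin 0 → L2 a b ℝ)))) (is4PI_zero hab.le)
    (is4PI_zero hab.le) fun ζ => ?_
  have e : (pieDPDE G Gd E τ).D ζ = G.out (E.Tqz ζ) + ∑ j, (Gd j).out (E.Tqz ζ) := rfl
  rw [e, ← outTot_apply G Gd hab, E.Tqz_eq hab]
  simp only [zero_apply, intervalIntegral.integral_zero, add_zero, map_zero]
  rfl

end system

end DelayPIE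

end

theorem mainTheorem7 {n₁ n₂ n₃ nz nw K : ℕ} {a b : ℝ} (hab : a < b)
    (G : Coeffs a b n₁ n₂ n₃ nz nw) (Gd : Fin K → Coeffs a b n₁ n₂ n₃ nz nw)
    (E : BCs a b n₁ n₂ n₃ nz) (hE : E.WellPosed)
    (τ : Fin K → ℝ) (hτ : ∀ j, 0 < τ j) :
    -- the operators of the interconnection are PI operators
    (IsPI stateSig stateSig (pieDPDE G Gd E τ).T ∧
      IsPI (realSig a b 0 1) stateSig (pieDPDE G Gd E τ).Tw ∧
      IsPI stateSig stateSig (pieDPDE G Gd E τ).A ∧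
      IsPI (realSig a b 0 1) stateSig (pieDPDE G Gd E τ).B ∧
      IsPI stateSig (realSig a b 0 1) (pieDPDE G Gd E τ).C ∧
      IsPI (realSig a b 0 1) (realSig a b 0 1) (pieDPDE G Gd E τ).D) ∧
    ∀ z : ℝ → Fin nz → ℝ, DifferentiableOn ℝ z (Ici 0) →
      -- corresponding trajectories: one is a solution if and only if the other is
      (∀ x x₀ y y₀ w, Corresponds (pieDPDE G Gd E τ) z x x₀ y y₀ →
        ((pieDPDE G Gd E τ).IsSolution z x w x₀ ↔ IsDPDESolution G Gd E τ z y w y₀)) ∧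
      -- every solution of the PIE corresponds to exactly one solution of the delayed PDE
      (∀ x x₀ w, (pieDPDE G Gd E τ).IsSolution z x w x₀ →
        ∃ y y₀, Corresponds (pieDPDE G Gd E τ) z x x₀ y y₀ ∧ IsDPDESolution G Gd E τ z y w y₀ ∧
          ∀ y' y₀', Corresponds (pieDPDE G Gd E τ) z x x₀ y' y₀' → EqOn y' y (Ici 0) ∧ y₀' = y₀) ∧
      -- every solution of the delayed PDE corresponds to exactly one solution of the PIE
      (∀ y y₀ w, IsDPDESolution G Gd E τ z y w y₀ →
        ∃ x x₀, Corresponds (pieDPDE G Gd E τ) z x x₀ y y₀ ∧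
          (pieDPDE G Gd E τ).IsSolution z x w x₀ ∧
          ∀ x' x₀', Corresponds (pieDPDE G Gd E τ) z x' x₀' y y₀ →
            EqOn x' x (Ici 0) ∧ x₀' = x₀) := by
  refine ⟨⟨isPI_T G Gd E τ hab, isPI_Tw G Gd E τ hab, isPI_A G Gd E τ hab, isPI_B G Gd E τ hab,
    isPI_C G Gd E τ hab, isPI_D G Gd E τ hab⟩, fun z hz => ⟨fun x x₀ y y₀ w hc => ?_,
    fun x x₀ w h => ?_, fun y y₀ w h => ?_⟩⟩
  · exact isSolution_iff hab hE hz hc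
  · exact exists_unique_dpde hab hE hz h
  · exact exists_unique_pie hab hE hz h
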